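/- **Setting.** All graphs are finite, simple and undirected. For a graph $G=(V,E)$ let $N_G[v]=\{v\}\cup\{x: vx\in E\}$ and, for an edge $e=xy$, $N_G[e]=N_G[x]\cup N_G[y]$. A set $L\subseteq V$ is a *liar's vertex-edge dominating set* of $G$ if $|N_G[e]\cap L|\ge 2$ for every $e\in E$ and $|(N_G[e]\cup N_G[f])\cap L|\ge 3$ for every two distinct $e,f\in E$; it is *minimum* if it has the least cardinality among all such sets. A *proper interval representation* of $G$ assigns to each vertex $v$ a closed interval $I(v)=[l(v),r(v)]$ of the real line such that two distinct vertices are adjacent if and only if their intervals intersect, and such that $I(u)\not\subseteq I(v)$ for $u\neq v$. $G$ is a *proper interval graph* if it has such a representation. **Algorithm LVEDS-PROPER-INTERVAL.** Given a proper interval representation, write every edge as $e=uv$ with $r(u)<r(v)$, and let $e_1,\dots,e_m$ be the edge interval ordering: $u_iv_i$ precedes $u_jv_j$ if $r(v_i)<r(v_j)$, or $v_i=v_j$ and $r(u_i)<r(u_j)$. For $S\subseteq V$ let $T^q[S]$ be the set of the $q$ elements of $S$ with the largest right endpoints (all of $S$ if $|S|<q$). Start with $L=\emptyset$ and $i=1$;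 while $i\le m$ do the following. - If $|N_G[e_i]\cap L|\ge 3$, replace $i$ by $i+1$. - If $|N_G[e_i]\cap L|\le 2$, add $T^{q}[N_G[e_i]\setminus L]$ to $L$, where $q=2-|N_G[e_i]\cap L|$. Then let $k$ be the least index $k>i$ with $|N_G[e_k]\cap L|<2$ or $N_G[e_k]\cap L=N_G[e_i]\cap L$. If there is no such $k$, stop. If $|N_G[e_k]\cap L|<2$, add $T^{q_1}[N_G[e_k]\setminus L]$ to $L$, where $q_1=2-|N_G[e_k]\cap L|$; otherwise add $T^1[N_G[e_k]\setminus L]$ to $L$. Replace $i$ by $k$. The output is the final set $L$. **Theorem.** (a) For every finite graph $G$ and every proper interval representation of $G$, the output of LVEDS-PROPER-INTERVAL is a minimum liar's vertex-edge dominating set of $G$. (b) A minimum liar's vertex-edge dominating set of a proper interval graph can be computed in linear time, by an implementation of this algorithm: there are a program $P$ for a random access machine (unit cost per operation or comparison; the only arithmetic operations are successor and predecessor) and a constant $c$ such that, for every proper interval graph $G$ with vertex set $\{0,\dots,n-1\}$ and $m$ edges, $P$, started on any adjacency list encoding of $G$ (no interval representation is given), halts after at most $c\,(n+m+1)$ steps,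 and its output is a minimum liar's vertex-edge dominating set of $G$ and is the output of LVEDS-PROPER-INTERVAL for some proper interval representation of $G$. -/

import Mathlib

/-! ### Liar's vertex-edge domination -/

section LiarDomination

variable {V : Type*} [Fintype V]

open Classical in
/-- The closed neighbourhood `N_G[v]`. -/
noncomputable def closedNbhd (G : SimpleGraph V) (v : V) : Finset V :=
  Finset.univ.filter fun x => x = v ∨ G.Adj v x

open Classical in
/-- The closed neighbourhood `N_G[e]` of an edge, the union of the `N_G[v]` over the two
ends `v` of `e`. -/
noncomputable def edgeNbhd (G : SimpleGraph V) (e : Sym2 V) : Finset V :=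
  Finset.univ.filter fun x => ∃ v ∈ e, x ∈ closedNbhd G v

open Classical in
/-- `L` is a liar's vertex-edge dominating set of `G`. -/
def IsLiarVEDominating (G : SimpleGraph V) (L : Finset V) : Prop :=
  (∀ e ∈ G.edgeSet, 2 ≤ (edgeNbhd G e ∩ L).card) ∧
  ∀ e ∈ G.edgeSet, ∀ f ∈ G.edgeSet, e ≠ f → 3 ≤ ((edgeNbhd G e ∪ edgeNbhd G f) ∩ L).card

/-- `L` is a liar's vertex-edge dominating set of `G` of minimum cardinality. -/
def IsMinLiarVEDominating (G : SimpleGraph V) (L : Finset V) : Prop :=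
  IsLiarVEDominating G L ∧ ∀ L' : Finset V, IsLiarVEDominating G L' → L.card ≤ L'.card

end LiarDomination

/-! ### Proper interval graphs -/

/-- A proper interval representation of `G`: a compact interval `[l v, r v]` of the real line
for each vertex, two distinct vertices being adjacent exactly if their intervals meet, and no
interval being contained in another one. -/
structure ProperIntervalRep {V : Type*} (G : SimpleGraph V) where
  l : V → ℝ
  r : V → ℝ
  le : ∀ v, l v ≤ r v
  adj_iff : ∀ u v, u ≠ v → (G.Adj u v ↔ (Set.Icc (l u) (r u) ∩ Set.Icc (l v) (r v)).Nonempty)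
  proper : ∀ u v, u ≠ v → ¬ Set.Icc (l u) (r u) ⊆ Set.Icc (l v) (r v)

/-- `G` is a proper interval graph. -/
def IsProperIntervalGraph {V : Type*} (G : SimpleGraph V) : Prop :=
  Nonempty (ProperIntervalRep G)

/-! ### The greedy algorithm on an edge interval ordering -/

section Algorithm

variable {V : Type*}

/-- The order `<_E` on edges, an edge being written `(u, v)` with `r u < r v`. -/
def EdgeLT (r : V → ℝ) (e f : V × V) : Prop :=
  r e.2 < r f.2 ∨ (e.2 = f.2 ∧ r e.1 < r f.1)

/-- `σ` lists every edge `uv`, written `(u, v)` with `r u < r v`, in increasing order. -/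
def IsEdgeIntervalOrdering {G : SimpleGraph V} (R : ProperIntervalRep G)
    (σ : List (V × V)) : Prop :=
  σ.Pairwise (EdgeLT R.r) ∧ ∀ u v, (u, v) ∈ σ ↔ G.Adj u v ∧ R.r u < R.r v

open Classical in
/-- `T^q[S]`: the `q` elements of `S` with the largest right endpoints, that is, those
exceeded by fewer than `q` elements of `S` (all of `S` if it has fewer than `q` elements). -/
noncomputable def topRight (r : V → ℝ) (q : ℕ) (S : Finset V) : Finset V :=
  S.filter fun v => (S.filter fun w => r v < r w).card < q

variable [Fintype V]

open Classical in
/-- The first round on the edge `e`: complete `L` to two vertices of `N_G[e]`. -/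
noncomputable def completeToTwo (G : SimpleGraph V) (r : V → ℝ) (L : Finset V) (e : V × V) :
    Finset V :=
  L ∪ topRight r (2 - (edgeNbhd G s(e.1, e.2) ∩ L).card) (edgeNbhd G s(e.1, e.2) \ L)

open Classical in
/-- The second round, on the edge `f = e_min`. -/
noncomputable def secondRound (G : SimpleGraph V) (r : V → ℝ) (L : Finset V) (f : V × V) :
    Finset V :=
  if (edgeNbhd G s(f.1, f.2) ∩ L).card < 2 then completeToTwo G r L f
  else L ∪ topRight r 1 (edgeNbhd G s(f.1, f.2) \ L)

open Classical in
/-- The edge `f` is a candidate for `e_min` while `e` is being processed. -/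
def IsMinCandidate (G : SimpleGraph V) (L : Finset V) (e f : V × V) : Prop :=
  (edgeNbhd G s(f.1, f.2) ∩ L).card < 2 ∨
    edgeNbhd G s(f.1, f.2) ∩ L = edgeNbhd G s(e.1, e.2) ∩ L

open Classical in
/-- The main loop of LVEDS-PROPER-INTERVAL, run on the list of the edges `e_i, …, e_m` and the
current set `L`. If `N_G[e_i]` has at most two vertices in `L`, both rounds are carried out and
the loop goes on at `e_min`, the first candidate after `e_i`; it ends after the first round if
there is none. If `N_G[e_i]` has more than two vertices in `L`, the loop goes on at `e_{i+1}`. -/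
noncomputable def lvedsLoop (G : SimpleGraph V) (r : V → ℝ) :
    List (V × V) → Finset V → Finset V
  | [], L => L
  | e :: es, L =>
    if (edgeNbhd G s(e.1, e.2) ∩ L).card ≤ 2 then
      match h : es.dropWhile fun f => ¬ IsMinCandidate G (completeToTwo G r L e) e f with
      | [] => completeToTwo G r L e
      | f :: fs => lvedsLoop G r (f :: fs) (secondRound G r (completeToTwo G r L e) f)
    else lvedsLoop G r es L
  termination_by σ => σ.length
  decreasing_by
  · have h' := congrArg List.length h
    have := (List.dropWhile_sublist (l := es)
      (fun f => decide (¬ IsMinCandidate G (completeToTwo G r L e) e f))).length_le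
    simp only [List.length_cons] at *
    omega
  · simp

/-- The output of LVEDS-PROPER-INTERVAL for a proper interval representation `R` of `G` and
an edge interval ordering `σ`. -/
noncomputable def lvedsProperInterval {G : SimpleGraph V} (R : ProperIntervalRep G)
    (σ : List (V × V)) : Finset V :=
  lvedsLoop G R.r σ ∅

end Algorithm

/-! ### A random access machine with a step count

Programs work on natural number registers and on arrays of natural numbers, with indirect
addressing. The arithmetic is restricted to successor and predecessor, so that after `t` steps
no number in memory exceeds a number present at the start or in the program by more than `t`;
charging one time unit per operation is therefore legitimate. -/

namespace RAM

/-- Contents of the memory: registers `reg x` and arrays `arr a i`. -/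
structure State where
  reg : ℕ → ℕ
  arr : ℕ → ℕ → ℕ

/-- Elementary operations, on registers `x`, `y` and an array `a`. -/
inductive Op where
  | const (x k : ℕ)
  | copy (x y : ℕ)
  | succ (x : ℕ)
  | pred (x : ℕ)
  | load (x a y : ℕ)
  | store (a x y : ℕ)

/-- Effect of an operation: `x := k`, `x := y`, `x := x + 1`, `x := x - 1` (truncated),
`x := a[y]`, `a[x] := y`. -/
def Op.apply : Op → State → State
  | const x k, s => { s with reg := Function.update s.reg x k }
  | copy x y, s => { s with reg := Function.update s.reg x (s.reg y) }
  | succ x, s => { s with reg := Function.update s.reg x (s.reg x + 1) }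
  | pred x, s => { s with reg := Function.update s.reg x (s.reg x - 1) }
  | load x a y, s => { s with reg := Function.update s.reg x (s.arr a (s.reg y)) }
  | store a x y, s =>
    { s with arr := Function.update s.arr a (Function.update (s.arr a) (s.reg x) (s.reg y)) }

/-- Comparisons of two registers. -/
inductive Test where
  | lt (x y : ℕ)
  | eq (x y : ℕ)

def Test.Holds : Test → State → Prop
  | lt x y, s => s.reg x < s.reg y
  | eq x y, s => s.reg x = s.reg y

/-- Programs. -/
inductive Prog where
  | op (o : Op)
  | seq (p q : Prog)
  | ite (b : Test) (p q : Prog)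
  | while (b : Test) (p : Prog)

/-- `Exec p s t s'`: started in `s`, the program `p` halts after exactly `t` steps in `s'`.
Every operation and every evaluation of a test is one step. -/
inductive Exec : Prog → State → ℕ → State → Prop
  | op (o : Op) (s : State) : Exec (.op o) s 1 (o.apply s)
  | seq {p q : Prog} {s s' s'' : State} {t t' : ℕ} :
      Exec p s t s' → Exec q s' t' s'' → Exec (.seq p q) s (t + t') s''
  | ite_true {b : Test} {p q : Prog} {s s' : State} {t : ℕ} :
      b.Holds s → Exec p s t s' → Exec (.ite b p q) s (t + 1) s'
  | ite_false {b : Test} {p q : Prog} {s s' : State} {t : ℕ} :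
      ¬ b.Holds s → Exec q s t s' → Exec (.ite b p q) s (t + 1) s'
  | while_true {b : Test} {p : Prog} {s s' s'' : State} {t t' : ℕ} :
      b.Holds s → Exec p s t s' → Exec (.while b p) s' t' s'' →
      Exec (.while b p) s (t + t' + 1) s''
  | while_false {b : Test} {p : Prog} {s : State} :
      ¬ b.Holds s → Exec (.while b p) s 1 s

/-- `s` holds the graph `G` given by adjacency lists: register `0` contains the number `n` of
vertices, the neighbours of `v` are listed in some order, without repetition, in array `1` in
the positions `i` with `arr 0 v ≤ i < arr 0 (v + 1)`, and the rest of the memory is zero. -/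
structure Encodes {n : ℕ} (G : SimpleGraph (Fin n)) (s : State) : Prop where
  reg_zero : s.reg 0 = n
  reg_ne_zero : ∀ x, x ≠ 0 → s.reg x = 0
  offset_zero : s.arr 0 0 = 0
  offset_mono : ∀ v < n, s.arr 0 v ≤ s.arr 0 (v + 1)
  offset_rest : ∀ i, n < i → s.arr 0 i = 0
  neighbors : ∀ v : Fin n, Set.BijOn (s.arr 1)
    (Set.Ico (s.arr 0 v) (s.arr 0 (v + 1))) (Fin.val '' {w : Fin n | G.Adj v w})
  neighbors_rest : ∀ i, s.arr 0 n ≤ i → s.arr 1 i = 0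
  arr_rest : ∀ a i, 2 ≤ a → s.arr a i = 0

/-- The vertex set written to array `2`, given by its indicator function. -/
def output (n : ℕ) (s : State) : Finset (Fin n) :=
  Finset.univ.filter fun v => s.arr 2 v ≠ 0

end RAM

/-! ### Dominance of vertex sets along a linear order -/

section Dominance

variable {V : Type*}

/-! Order the vertices by right endpoint. Every edge neighbourhood is then an interval of the order,
and right ends of these intervals move monotonically along the edge ordering. The central notion is
`Dominated`. Suppose that a feasible set has at least q more vertices in a segment S than L, and
that L ∩ S is a final segment of L. Then adding to L the q rightmost missing vertices of S keeps L
dominated by that feasible set (`Dominated.union_topRight`).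

Every addition made by the algorithm is of this kind. Completing N[e] to two vertices uses S = N[e].
The single vertex added when N[e] and N[f] meet L in the same two vertices uses S = N[e] ∪ N[f],
where a feasible set has three. For feasibility, the invariant is that each passed edge is
`Settled`: it has three hits, or L reaches beyond its neighbourhood on the right, and in the latter
case each later edge contributes a hit outside that neighbourhood
(`LoopInvariant.three_le_current`). Edges skipped on the way to e_min have three hits. So the output
is feasible and dominated by every feasible set, which gives (a).

For a fixed order, domination is antisymmetric (`Dominated.antisymm`), so at most one feasible set
is dominated by all feasible sets. The program for (b) therefore need not simulate the algorithm:
any feasible set it finds with this property, for a representation inducing its own vertex order, is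
the output of LVEDS-PROPER-INTERVAL.

The order is found by two breadth-first searches. A vertex of least degree in the last layer of a
component is an end of some umbrella order (`exists_end_order`). Starting again from such ends,
sorting by layer and then by later minus earlier degree gives an umbrella order, because a misplaced
pair must consist of twins (`Layering.lt_or_twins`). In this order it suffices to enforce two hits
around consecutive pairs and three around consecutive triples of the same component
(`Extents.isLiarVEDominating`). Scanning these segments costs a constant times the sum of the closed
neighbourhood sizes, which is at most n + 2m. -/

/-- The number of elements of `S` that belong to `L`. -/
noncomputable def hits (S L : Finset V) : ℕ := by
  classical exact (S ∩ L).card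

open Classical in
theorem hits_eq (S L : Finset V) : hits S L = (S ∩ L).card := rfl

theorem hits_eq_filter (S L : Finset V) [DecidablePred (· ∈ L)] :
    hits S L = (S.filter (· ∈ L)).card := by
  classical
  rw [hits_eq, ← Finset.filter_mem_eq_inter]

theorem hits_mono {S S' L L' : Finset V} (hS : S ⊆ S') (hL : L ⊆ L') : hits S L ≤ hits S' L' := by
  classical
  exact Finset.card_le_card (Finset.inter_subset_inter hS hL)

open Classical in
theorem hits_insert {S L : Finset V} {y : V} (hy : y ∈ S) (hyL : y ∉ L) :
    hits S (insert y L) = hits S L + 1 := by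
  rw [hits_eq, hits_eq, Finset.inter_insert_of_mem hy, Finset.card_insert_of_notMem]
  simp [hyL]

/-- Along the order given by `r`, every initial segment contains at most as many elements of `L`
as of `L'`. -/
def Dominated (r : V → ℝ) (L L' : Finset V) : Prop :=
  ∀ D : Set V, (∀ a b, r a ≤ r b → b ∈ D → a ∈ D) →
    {x ∈ (L : Set V) | x ∈ D}.ncard ≤ {x ∈ (L' : Set V) | x ∈ D}.ncard

open Classical in
theorem dominated_iff {r : V → ℝ} {L L' : Finset V} : Dominated r L L' ↔
    ∀ D : Set V, (∀ a b, r a ≤ r b → b ∈ D → a ∈ D) →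
      (L.filter (· ∈ D)).card ≤ (L'.filter (· ∈ D)).card := by
  have key : ∀ (D : Set V) (M : Finset V),
      {x ∈ (M : Set V) | x ∈ D}.ncard = (M.filter (· ∈ D)).card := by
    intro D M
    rw [← Set.ncard_coe_finset]
    congr 1
    ext x
    simp
  simp only [Dominated, key]

theorem Dominated.empty (r : V → ℝ) (L : Finset V) : Dominated r ∅ L := by
  intro D _
  simp

theorem Dominated.card_le {r : V → ℝ} {L L' : Finset V} (h : Dominated r L L') :
    L.card ≤ L'.card := by
  classical
  simpa using dominated_iff.1 h Set.univ (by simp)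

/-- Equal counts on the segments up to y, with and without y, decide whether y is a member. This
uniqueness is what later identifies the output of the program with that of the algorithm. -/
theorem Dominated.antisymm {r : V → ℝ} (hr : Function.Injective r) {L L' : Finset V}
    (h : Dominated r L L') (h' : Dominated r L' L) : L = L' := by
  classical
  have heq : ∀ D : Set V, (∀ a b, r a ≤ r b → b ∈ D → a ∈ D) →
      (L.filter (· ∈ D)).card = (L'.filter (· ∈ D)).card := fun D hD =>
    le_antisymm (dominated_iff.1 h D hD) (dominated_iff.1 h' D hD)
  have split : ∀ (M : Finset V) (y : V), (M.filter (· ∈ {x | r x ≤ r y})).card =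
      (M.filter (· ∈ {x | r x < r y})).card + if y ∈ M then 1 else 0 := by
    intro M y
    have : M.filter (· ∈ {x | r x ≤ r y}) =
        M.filter (· ∈ {x | r x < r y}) ∪ M.filter (· = y) := by
      ext x
      simp only [Finset.mem_filter, Finset.mem_union, Set.mem_ofPred_eq, le_iff_lt_or_eq,
        hr.eq_iff]
      tauto
    rw [this, Finset.card_union_of_disjoint]
    · congr 1
      split_ifs with hy
      · rw [Finset.card_eq_one]
        exact ⟨y, by ext x; simp only [Finset.mem_filter, Finset.mem_singleton]; aesop⟩
      · rw [Finset.card_eq_zero, Finset.filter_eq_empty_iff]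
        rintro x hx rfl
        exact hy hx
    · rw [Finset.disjoint_left]
      rintro x hx hx'
      simp only [Finset.mem_filter, Set.mem_ofPred_eq] at hx hx'
      rw [hx'.2] at hx
      exact lt_irrefl _ hx.2
  ext y
  have h1 := heq {x | r x ≤ r y} (fun a b hab hb => le_trans hab hb)
  have h2 := heq {x | r x < r y} (fun a b hab hb => lt_of_le_of_lt hab hb)
  rw [split, split, h2] at h1
  by_cases hy : y ∈ L <;> by_cases hy' : y ∈ L' <;> simp_all

open Classical in
/-- Adding the `q` rightmost elements of `S \ L` to `L` keeps `L` dominated by every set that has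
`q` more elements in the segment `S` than `L`. -/
theorem Dominated.union_topRight {r : V → ℝ} {L L' S : Finset V} {q : ℕ}
    (hsuff : ∀ x ∈ L, ∀ z ∈ S, r z ≤ r x → x ∈ S)
    (hq : hits S L + q ≤ hits S L') (h : Dominated r L L')
    (hcard : (topRight r q (S \ L)).card ≤ q) :
    Dominated r (L ∪ topRight r q (S \ L)) L' := by
  rw [dominated_iff] at h ⊢
  intro D hD
  set T := topRight r q (S \ L) with hT
  have hTS : T ⊆ S \ L := Finset.filter_subset _ _
  by_cases hex : ∃ t ∈ T, t ∈ D
  · obtain ⟨t, htT, htD⟩ := hex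
    -- An element of S beyond D lies to the right of t, hence is exceeded by fewer missing elements
    -- than t is, and so is in T unless it is in L already.
    have hright : ∀ w ∈ S, w ∉ D → w ∈ L ∪ T := by
      intro w hw hwD
      by_cases hwL : w ∈ L
      · exact Finset.mem_union_left _ hwL
      refine Finset.mem_union_right _ ?_
      have hlt : r t < r w := by
        by_contra hcon
        exact hwD (hD w t (not_lt.1 hcon) htD)
      simp only [hT, topRight, Finset.mem_filter] at htT ⊢
      refine ⟨by simp [hw, hwL], lt_of_le_of_lt (Finset.card_le_card ?_) htT.2⟩
      intro x hx
      simp only [Finset.mem_filter] at hx ⊢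
      exact ⟨hx.1, hlt.trans hx.2⟩
    have htS : t ∈ S := (Finset.mem_sdiff.1 (hTS htT)).1
    -- B is the part of the order before all of S. In D, the new set consists of elements of L in B
    -- and elements of S; the former are counted by `h`. The latter are counted through the
    -- complement of D, where the new set contains all of S.
    obtain ⟨B, hB⟩ : ∃ B : Set V, ∀ v, v ∈ B ↔ ∀ z ∈ S, r v < r z := ⟨_, fun _ => Iff.rfl⟩
    have hbelow := h B (fun a b hab hb => (hB a).2 fun z hz =>
      lt_of_le_of_lt hab ((hB b).1 hb z hz))
    have e1 : (L ∪ T).filter (· ∈ D) ⊆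
        L.filter (· ∈ B) ∪ (S ∩ (L ∪ T)).filter (· ∈ D) := by
      intro x hx
      simp only [Finset.mem_filter, Finset.mem_union, Finset.mem_inter, hB] at hx ⊢
      by_cases hxS : x ∈ S
      · exact Or.inr ⟨⟨hxS, hx.1⟩, hx.2⟩
      · rcases hx.1 with hxL | hxT
        · refine Or.inl ⟨hxL, fun z hz => ?_⟩
          by_contra hcon
          exact hxS (hsuff x hxL z hz (not_lt.1 hcon))
        · exact absurd (Finset.mem_sdiff.1 (hTS hxT)).1 hxS
    have e2 : L'.filter (· ∈ B) ∪ (S ∩ L').filter (· ∈ D) ⊆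
        L'.filter (· ∈ D) := by
      intro x hx
      simp only [Finset.mem_filter, Finset.mem_union, Finset.mem_inter, hB] at hx ⊢
      rcases hx with hx | hx
      · exact ⟨hx.1, hD x t (hx.2 t htS).le htD⟩
      · exact ⟨hx.1.2, hx.2⟩
    have e2' : Disjoint (L'.filter (· ∈ B)) ((S ∩ L').filter (· ∈ D)) := by
      rw [Finset.disjoint_left]
      intro x hx hx'
      simp only [Finset.mem_filter, Finset.mem_inter, hB] at hx hx'
      exact lt_irrefl _ (hx.2 x hx'.1.1)
    have c1 := Finset.card_le_card e1
    have c1' := Finset.card_union_le (L.filter (· ∈ B))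
      ((S ∩ (L ∪ T)).filter (· ∈ D))
    have c2 := Finset.card_le_card e2
    rw [Finset.card_union_of_disjoint e2'] at c2
    have s1 := Finset.card_filter_add_card_filter_not (s := S ∩ (L ∪ T)) (· ∈ D)
    have s2 := Finset.card_filter_add_card_filter_not (s := S ∩ L') (· ∈ D)
    have s3 : ((S ∩ L').filter (¬ · ∈ D)).card ≤ ((S ∩ (L ∪ T)).filter (¬ · ∈ D)).card := by
      apply Finset.card_le_card
      intro x hx
      simp only [Finset.mem_filter, Finset.mem_inter] at hx ⊢
      exact ⟨⟨hx.1.1, hright x hx.1.1 hx.2⟩, hx.2⟩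
    have s4 : (S ∩ (L ∪ T)).card ≤ hits S L + q := by
      rw [Finset.inter_union_distrib_left]
      refine (Finset.card_union_le _ _).trans (add_le_add le_rfl ?_)
      exact (Finset.card_le_card Finset.inter_subset_right).trans hcard
    rw [hits_eq S L'] at hq
    omega
  · have : (L ∪ T).filter (· ∈ D) = L.filter (· ∈ D) := by
      ext x
      simp only [Finset.mem_filter, Finset.mem_union]
      constructor
      · rintro ⟨h1 | h1, h2⟩
        · exact ⟨h1, h2⟩
        · exact absurd ⟨x, h1, h2⟩ hex
      · rintro ⟨h1, h2⟩
        exact ⟨Or.inl h1, h2⟩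
    rw [this]
    exact h D hD

theorem topRight_subset (r : V → ℝ) (q : ℕ) (S : Finset V) : topRight r q S ⊆ S :=
  Finset.filter_subset _ _

/-- `topRight r q S` has `q` elements, if `S` has as many. -/
theorem card_topRight {r : V → ℝ} (hr : Function.Injective r) (q : ℕ) (S : Finset V) :
    (topRight r q S).card = min q S.card := by
  classical
  induction S using Finset.strongInduction generalizing q with
  | H S ih =>
  rcases S.eq_empty_or_nonempty with rfl | hne
  · simp [topRight]
  obtain ⟨m, hm, hmax⟩ := S.exists_max_image r hne
  rcases q with _ | q
  · simp [topRight]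
  -- The maximum m is always selected and uses up one of the q + 1 places.
  have hrec : topRight r (q + 1) S = insert m (topRight r q (S.erase m)) := by
    ext x
    by_cases hx : x = m
    · subst hx
      simp only [Finset.mem_insert, true_or, iff_true]
      simp only [topRight, Finset.mem_filter]
      refine ⟨hm, ?_⟩
      rw [Finset.filter_eq_empty_iff.2]
      · simp
      · intro y hy
        exact not_lt.2 (hmax y hy)
    · simp only [Finset.mem_insert, hx, false_or]
      simp only [topRight, Finset.mem_filter, Finset.mem_erase, ne_eq, hx, not_false_eq_true,
        true_and, and_congr_right_iff]
      intro hxS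
      have hlt : r x < r m := lt_of_le_of_ne (hmax x hxS) (fun h => hx (hr h))
      have : S.filter (fun w => r x < r w) =
          insert m ((S.erase m).filter (fun w => r x < r w)) := by
        ext w
        simp only [Finset.mem_filter, Finset.mem_insert, Finset.mem_erase]
        by_cases hw : w = m
        · subst hw; simp [hm, hlt]
        · simp [hw]
      have h2 := Finset.card_insert_of_notMem (s := (S.erase m).filter (fun w => r x < r w))
        (a := m) (by simp)
      rw [← this] at h2
      constructor
      · intro h; rw [h2] at h; omega
      · intro h; rw [h2]; omega
  rw [hrec, Finset.card_insert_of_notMem, ih _ (Finset.erase_ssubset hm),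
    Finset.card_erase_of_mem hm]
  · have := Finset.card_pos.2 hne
    omega
  · intro h
    simpa using topRight_subset _ _ _ h

theorem topRight_one {r : V → ℝ} (hr : Function.Injective r) {S : Finset V} {y : V} (hy : y ∈ S)
    (hmax : ∀ x ∈ S, r x ≤ r y) : topRight r 1 S = {y} := by
  classical
  have hmem : y ∈ topRight r 1 S := by
    simp only [topRight, Finset.mem_filter]
    refine ⟨hy, ?_⟩
    rw [Finset.filter_eq_empty_iff.2 fun x hx => not_lt.2 (hmax x hx)]
    simp
  refine (Finset.eq_of_subset_of_card_le (Finset.singleton_subset_iff.2 hmem) ?_).symm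
  rw [card_topRight hr]
  simp

/-- Adding the rightmost element of `S \ L`. -/
theorem Dominated.insert_max {r : V → ℝ} (hr : Function.Injective r) {L L' S M : Finset V} {y : V}
    (hsuff : ∀ x ∈ L, ∀ z ∈ S, r z ≤ r x → x ∈ S)
    (hyS : y ∈ S) (hyL : y ∉ L) (hmax : ∀ x ∈ S, x ∉ L → r x ≤ r y)
    (hq : hits S L < hits S L') (h : Dominated r L L') (hM : ∀ x, x ∈ M ↔ x = y ∨ x ∈ L) :
    Dominated r M L' := by
  classical
  have h1 := topRight_one hr (S := S \ L) (y := y) (by simp [hyS, hyL])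
    (fun x hx => hmax x (Finset.mem_sdiff.1 hx).1 (Finset.mem_sdiff.1 hx).2)
  have h2 := h.union_topRight (q := 1) hsuff hq
    (by rw [card_topRight hr]; exact min_le_left _ _)
  convert h2 using 1
  ext x
  have h3 : x ∈ topRight r 1 (S \ L) ↔ x = y := by rw [h1, Finset.mem_singleton]
  rw [hM, or_comm, ← h3, Finset.mem_union]

end Dominance

/-! ### Umbrella orders and edge neighbourhoods -/

section Umbrella

variable {V : Type*} {G : SimpleGraph V} {ρ : V → ℝ}

/-- Along `ρ`, a vertex between the ends of an edge is adjacent to both ends. -/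
def Umbrella (G : SimpleGraph V) (ρ : V → ℝ) : Prop :=
  ∀ u v w, ρ u < ρ v → ρ v < ρ w → G.Adj u w → G.Adj u v ∧ G.Adj v w

theorem ProperIntervalRep.not_contained (R : ProperIntervalRep G) {u v : V} (huv : u ≠ v)
    (hl : R.l v ≤ R.l u) : R.r v < R.r u := by
  by_contra h
  exact R.proper u v huv (Set.Icc_subset_Icc hl (not_lt.1 h))

theorem ProperIntervalRep.r_injective (R : ProperIntervalRep G) : Function.Injective R.r := by
  intro u v h
  by_contra huv
  rcases le_total (R.l v) (R.l u) with hl | hl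
  · exact absurd (R.not_contained huv hl) (by simp [h])
  · exact absurd (R.not_contained (Ne.symm huv) hl) (by simp [h])

theorem ProperIntervalRep.l_lt (R : ProperIntervalRep G) {u v : V} (h : R.r u < R.r v) :
    R.l u < R.l v := by
  by_contra hcon
  have huv : u ≠ v := by rintro rfl; exact lt_irrefl _ h
  exact absurd (R.not_contained huv (not_lt.1 hcon)) (not_lt.2 h.le)

theorem ProperIntervalRep.adj_iff_of_lt (R : ProperIntervalRep G) {u v : V} (h : R.r u < R.r v) :
    G.Adj u v ↔ R.l v ≤ R.r u := by
  have huv : u ≠ v := by rintro rfl; exact lt_irrefl _ h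
  rw [R.adj_iff u v huv]
  constructor
  · rintro ⟨x, hx, hx'⟩
    exact hx'.1.trans hx.2
  · intro h'
    exact ⟨R.r u, ⟨R.le u, le_rfl⟩, ⟨h', h.le⟩⟩

theorem ProperIntervalRep.umbrella (R : ProperIntervalRep G) : Umbrella G R.r := by
  intro u v w huv hvw huw
  rw [R.adj_iff_of_lt (huv.trans hvw)] at huw
  rw [R.adj_iff_of_lt huv, R.adj_iff_of_lt hvw]
  exact ⟨(R.l_lt hvw).le.trans huw, huw.trans huv.le⟩

theorem Umbrella.closedNbhd_convex (hU : Umbrella G ρ)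
    (hinj : Function.Injective ρ) {u x y z : V} (hx : x = u ∨ G.Adj u x) (hz : z = u ∨ G.Adj u z)
    (hxy : ρ x ≤ ρ y) (hyz : ρ y ≤ ρ z) : y = u ∨ G.Adj u y := by
  by_cases hyu : y = u
  · exact Or.inl hyu
  right
  by_cases hxy' : y = x
  · subst hxy'; exact hx.resolve_left hyu
  by_cases hyz' : y = z
  · subst hyz'; exact hz.resolve_left hyu
  have h1 : ρ x < ρ y := lt_of_le_of_ne hxy fun h => hxy' (hinj h).symm
  have h2 : ρ y < ρ z := lt_of_le_of_ne hyz fun h => hyz' (hinj h)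
  rcases lt_or_gt_of_ne (fun h => hyu (hinj h) : ρ y ≠ ρ u) with h | h
  · rcases hx with rfl | hx
    · exact absurd (h1.trans h) (lt_irrefl _)
    · exact (hU x y u h1 h hx.symm).2.symm
  · rcases hz with rfl | hz
    · exact absurd (h2.trans h) (lt_irrefl _)
    · exact (hU u y z h h2 hz).1

variable [Fintype V]

theorem mem_edgeNbhd {u v x : V} : x ∈ edgeNbhd G s(u, v) ↔
    (x = u ∨ G.Adj u x) ∨ (x = v ∨ G.Adj v x) := by
  classical
  unfold edgeNbhd closedNbhd
  rw [Finset.mem_filter]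
  simp only [Finset.mem_filter, Finset.mem_univ, true_and, Sym2.mem_iff]
  constructor
  · rintro ⟨w, rfl | rfl, h⟩
    · exact Or.inl h
    · exact Or.inr h
  · rintro (h | h)
    · exact ⟨u, Or.inl rfl, h⟩
    · exact ⟨v, Or.inr rfl, h⟩

theorem left_mem_edgeNbhd (u v : V) : u ∈ edgeNbhd G s(u, v) := by simp [mem_edgeNbhd]

theorem right_mem_edgeNbhd (u v : V) : v ∈ edgeNbhd G s(u, v) := by simp [mem_edgeNbhd]

/-- The closed neighbourhoods of the two ends are convex and both contain u and v, so their union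
has no gap. -/
theorem Umbrella.edgeNbhd_convex (hU : Umbrella G ρ)
    (hinj : Function.Injective ρ) {u v : V} (huv : G.Adj u v) {x y z : V}
    (hx : x ∈ edgeNbhd G s(u, v)) (hz : z ∈ edgeNbhd G s(u, v))
    (hxy : ρ x ≤ ρ y) (hyz : ρ y ≤ ρ z) : y ∈ edgeNbhd G s(u, v) := by
  rw [mem_edgeNbhd] at *
  have conv := fun {u x y z : V} => hU.closedNbhd_convex hinj (u := u) (x := x) (y := y) (z := z)
  rcases hx with hx | hx <;> rcases hz with hz | hz
  · exact Or.inl (conv hx hz hxy hyz)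
  · rcases le_total (ρ y) (ρ u) with h | h
    · exact Or.inl (conv hx (Or.inl rfl) hxy h)
    · exact Or.inr (conv (Or.inr huv.symm) hz h hyz)
  · rcases le_total (ρ y) (ρ u) with h | h
    · exact Or.inr (conv hx (Or.inr huv.symm) hxy h)
    · exact Or.inl (conv (Or.inl rfl) hz h hyz)
  · exact Or.inr (conv hx hz hxy hyz)

/-- Right ends of edge neighbourhoods are monotone along the right ends of the edges. -/
theorem Umbrella.edgeNbhd_right_mono (hU : Umbrella G ρ)
    (hinj : Function.Injective ρ) {u v u' v' : V} (huv : ρ u < ρ v) (hvv' : ρ v ≤ ρ v')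
    (hadj' : G.Adj u' v') {x z : V}
    (hx : x ∈ edgeNbhd G s(u, v)) (hz : z ∈ edgeNbhd G s(u', v')) (hzx : ρ z ≤ ρ x) :
    x ∈ edgeNbhd G s(u', v') := by
  rcases le_or_gt (ρ x) (ρ v') with h | h
  · exact hU.edgeNbhd_convex hinj hadj' hz (right_mem_edgeNbhd _ _) hzx h
  · rw [mem_edgeNbhd] at hx ⊢
    right; right
    rcases hx with (rfl | hx) | (rfl | hx)
    · exact absurd (huv.trans_le hvv') (not_lt.2 h.le)
    · exact (hU u v' x (huv.trans_le hvv') h hx).2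
    · exact absurd hvv' (not_le.2 h)
    · rcases hvv'.eq_or_lt with e | e
      · rw [← hinj e]; exact hx
      · exact (hU v v' x e h hx).2

/-- Two different edges with intersecting neighbourhoods: each neighbourhood has a vertex outside
any given pair. -/
theorem exists_mem_edgeNbhd_ne {u v u' v' : V} (h : G.Adj u v) (h' : G.Adj u' v')
    (hne : s(u, v) ≠ s(u', v')) {x : V}
    (hx : x ∈ edgeNbhd G s(u, v)) (hx' : x ∈ edgeNbhd G s(u', v')) (p q : V) :
    ∃ z ∈ edgeNbhd G s(u, v), z ≠ p ∧ z ≠ q := by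
  by_contra hcon
  have hcon : ∀ z ∈ edgeNbhd G s(u, v), z = p ∨ z = q := fun z hz => by
    by_contra h0
    exact hcon ⟨z, hz, not_or.1 h0⟩
  have huv := h.ne
  have hu := hcon u (left_mem_edgeNbhd _ _)
  have hv := hcon v (right_mem_edgeNbhd _ _)
  -- If p and q exhaust the neighbourhood, it is {u, v}, and no edge leaves this pair. The second
  -- edge meets it through x, so it is the same edge.
  have hall : ∀ z ∈ edgeNbhd G s(u, v), z = u ∨ z = v := by
    intro z hz
    have := hcon z hz
    grind
  have key : ∀ a b, (a = u ∨ a = v) → G.Adj a b → (b = u ∨ b = v) := by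
    intro a b ha hab
    apply hall
    rw [mem_edgeNbhd]
    rcases ha with rfl | rfl
    · exact Or.inl (Or.inr hab)
    · exact Or.inr (Or.inr hab)
  have hx1 := hall x hx
  have : (u' = u ∨ u' = v) ∧ (v' = u ∨ v' = v) := by
    rw [mem_edgeNbhd] at hx'
    rcases hx' with (rfl | hx') | (rfl | hx')
    · exact ⟨hx1, key _ _ hx1 h'⟩
    · have := key _ _ hx1 hx'.symm
      exact ⟨this, key _ _ this h'⟩
    · exact ⟨key _ _ hx1 h'.symm, hx1⟩
    · have := key _ _ hx1 hx'.symm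
      exact ⟨key _ _ this h'.symm, this⟩
  have hne' := h'.ne
  apply hne
  rw [Sym2.eq_iff]
  grind

end Umbrella

section LiarHits

variable {V : Type*} [Fintype V] {G : SimpleGraph V}

open Classical in
theorem isLiarVEDominating_iff {L : Finset V} : IsLiarVEDominating G L ↔
    (∀ e ∈ G.edgeSet, 2 ≤ hits (edgeNbhd G e) L) ∧
    ∀ e ∈ G.edgeSet, ∀ f ∈ G.edgeSet, e ≠ f → 3 ≤ hits (edgeNbhd G e ∪ edgeNbhd G f) L :=
  Iff.rfl

end LiarHits

/-! ### Correctness of the greedy algorithm -/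

section Greedy

variable {V : Type*} {G : SimpleGraph V} {r : V → ℝ}

theorem EdgeLT.right_le {e f : V × V} (h : EdgeLT r e f) : r e.2 ≤ r f.2 := by
  rcases h with h | ⟨h, -⟩
  · exact h.le
  · rw [h]

theorem EdgeLT.sym2_ne {e f : V × V} (h : EdgeLT r e f) (he : r e.1 < r e.2) (hf : r f.1 < r f.2) :
    s(e.1, e.2) ≠ s(f.1, f.2) := by
  intro heq
  rw [Sym2.eq_iff] at heq
  rcases heq with ⟨h1, h2⟩ | ⟨h1, h2⟩ <;> rcases h with h | ⟨-, h⟩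
  · rw [h2] at h; exact lt_irrefl _ h
  · rw [h1] at h; exact lt_irrefl _ h
  · rw [h1, h2] at he; exact lt_irrefl _ (he.trans hf)
  · rw [h1, h2] at he; exact lt_irrefl _ (he.trans hf)

open Classical in
/-- Two final segments of `L`: the smaller one is contained in the larger one. -/
theorem upper_inter_subset {S S' L : Finset V}
    (hS : ∀ x ∈ L, ∀ z ∈ S, r z ≤ r x → x ∈ S) (hS' : ∀ x ∈ L, ∀ z ∈ S', r z ≤ r x → x ∈ S')
    (h : hits S L ≤ hits S' L) : S ∩ L ⊆ S' ∩ L := by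
  by_contra hcon
  rw [Finset.not_subset] at hcon
  obtain ⟨x, hx, hx'⟩ := hcon
  simp only [Finset.mem_inter, not_and] at hx hx'
  have hx'' : x ∉ S' := fun h => hx' h hx.2
  have hss : S' ∩ L ⊂ S ∩ L := by
    rw [Finset.ssubset_iff_of_subset]
    · exact ⟨x, by simp [hx], by simp [hx'']⟩
    · intro y hy
      rw [Finset.mem_inter] at hy ⊢
      refine ⟨?_, hy.2⟩
      rcases le_total (r x) (r y) with hle | hle
      · exact hS y hy.2 x hx.1 hle
      · exact absurd (hS' x hx.2 y hy.1 hle) hx''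
  exact absurd (Finset.card_lt_card hss) (not_lt.2 h)

theorem three_le_hits {S L L' : Finset V} {t : V} (h : hits S L = 2) (hL : L ⊆ L') (ht : t ∈ S)
    (htL : t ∉ L) (htL' : t ∈ L') : 3 ≤ hits S L' := by
  classical
  have h1 := hits_insert ht htL
  have h2 := hits_mono (le_refl S) (Finset.insert_subset htL' hL)
  omega

variable [Fintype V]

/-- The neighbourhood of the edge `(u, v)`. -/
noncomputable abbrev pairNbhd (G : SimpleGraph V) (e : V × V) : Finset V := edgeNbhd G s(e.1, e.2)

open Classical in
/-- Part of the loop invariant: `pre` are the edges that have been passed, `σ` those to come. -/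
structure LoopInvariant (G : SimpleGraph V) (r : V → ℝ) (pre σ : List (V × V)) (L : Finset V) :
    Prop where
  sorted : (pre ++ σ).Pairwise (EdgeLT r)
  isEdge : ∀ e ∈ pre ++ σ, G.Adj e.1 e.2 ∧ r e.1 < r e.2
  -- For every edge still to come, the chosen vertices in its neighbourhood form a final segment of
  -- L. This is the hypothesis needed for rightmost additions to preserve domination.
  upper : ∀ g ∈ σ, ∀ x ∈ L, ∀ z ∈ pairNbhd G g, r z ≤ r x → x ∈ pairNbhd G g
  two_le : ∀ f ∈ pre, 2 ≤ hits (pairNbhd G f) L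
  three_le : ∀ f ∈ pre, ∀ g ∈ pre, f ≠ g → 3 ≤ hits (pairNbhd G f ∪ pairNbhd G g) L
  dominated : ∀ L', IsLiarVEDominating G L' → Dominated r L L'

/-- `L` has three vertices in the neighbourhood of `f`, or a vertex to the right of one of them
and outside of that neighbourhood. -/
def Settled (G : SimpleGraph V) (r : V → ℝ) (L : Finset V) (f : V × V) : Prop :=
  3 ≤ hits (pairNbhd G f) L ∨
    ∃ s ∈ pairNbhd G f, s ∈ L ∧ ∃ t ∈ L, t ∉ pairNbhd G f ∧ r s < r t

theorem Settled.mono {L L' : Finset V} {f : V × V} (h : Settled G r L f) (hL : L ⊆ L') :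
    Settled G r L' f := by
  rcases h with h | ⟨s, hs, hsL, t, ht, h⟩
  · exact Or.inl (h.trans (hits_mono le_rfl hL))
  · exact Or.inr ⟨s, hs, hL hsL, t, hL ht, h⟩

namespace LoopInvariant

variable {pre σ : List (V × V)} {L : Finset V} {e : V × V}

theorem of_mem_right (h : LoopInvariant G r pre (e :: σ) L) : G.Adj e.1 e.2 ∧ r e.1 < r e.2 :=
  h.isEdge e (by simp)

open Classical in
/-- Enlarging `L` by vertices of the neighbourhood of the current edge. -/
theorem union (hr : Function.Injective r) (hU : Umbrella G r)
    (h : LoopInvariant G r pre (e :: σ) L) {T : Finset V} (hT : T ⊆ pairNbhd G e)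
    (hdom : ∀ L', IsLiarVEDominating G L' → Dominated r (L ∪ T) L') :
    LoopInvariant G r pre (e :: σ) (L ∪ T) where
  sorted := h.sorted
  isEdge := h.isEdge
  upper := by
    intro g hg x hx z hz hzx
    rcases Finset.mem_union.1 hx with hx | hx
    · exact h.upper g hg x hx z hz hzx
    · rcases List.mem_cons.1 hg with rfl | hg'
      · exact hT hx
      · have hlt : EdgeLT r e g := by
          have := (List.pairwise_append.1 h.sorted).2.1
          exact (List.pairwise_cons.1 this).1 g hg'
        exact hU.edgeNbhd_right_mono hr h.of_mem_right.2 hlt.right_le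
          (h.isEdge g (by simp [hg'])).1 (hT hx) hz hzx
  two_le f hf := (h.two_le f hf).trans (hits_mono le_rfl Finset.subset_union_left)
  three_le f hf g hg hne :=
    (h.three_le f hf g hg hne).trans (hits_mono le_rfl Finset.subset_union_left)
  dominated := hdom

open Classical in
/-- A passed edge and the current one. -/
theorem three_le_current (hr : Function.Injective r) (hU : Umbrella G r)
    (h : LoopInvariant G r pre (e :: σ) L) (he : 2 ≤ hits (pairNbhd G e) L) {f : V × V}
    (hf : f ∈ pre) (hset : Settled G r L f) : 3 ≤ hits (pairNbhd G f ∪ pairNbhd G e) L := by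
  rcases hset with h1 | ⟨s, hs, -, t, ht, htf, hst⟩
  · exact h1.trans (hits_mono Finset.subset_union_left le_rfl)
  have h2 := h.two_le f hf
  have hlt : ∀ x ∈ pairNbhd G f, r x < r t := by
    intro x hx
    by_contra hcon
    exact htf (hU.edgeNbhd_convex hr (h.isEdge f (by simp [hf])).1 hs hx hst.le (not_lt.1 hcon))
  -- The whole neighbourhood of f lies left of t. If t is not near e, a hit of e inside the
  -- neighbourhood of f would lie left of t, and `upper` would put t into the neighbourhood of e.
  obtain ⟨y, hy, hyf⟩ : ∃ y ∈ pairNbhd G e ∩ L, y ∉ pairNbhd G f := by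
    by_cases hte : t ∈ pairNbhd G e
    · exact ⟨t, by simp [hte, ht], htf⟩
    · have : (pairNbhd G e ∩ L).Nonempty := by
        rw [← Finset.card_pos, ← hits_eq]; omega
      obtain ⟨y, hy⟩ := this
      rw [Finset.mem_inter] at hy
      refine ⟨y, by simp [hy], fun hyf => hte ?_⟩
      exact h.upper e (by simp) t ht y hy.1 (hlt y hyf).le
  rw [Finset.mem_inter] at hy
  have hsub : insert y (pairNbhd G f ∩ L) ⊆ (pairNbhd G f ∪ pairNbhd G e) ∩ L := by
    intro x hx
    simp only [Finset.mem_insert, Finset.mem_inter, Finset.mem_union] at hx ⊢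
    rcases hx with rfl | hx
    · exact ⟨Or.inr hy.1, hy.2⟩
    · exact ⟨Or.inl hx.1, hx.2⟩
  have := Finset.card_le_card hsub
  rw [Finset.card_insert_of_notMem (by simp [hyf])] at this
  rw [hits_eq] at h2 ⊢
  omega

open Classical in
/-- Passing the current edge. -/
theorem pass (h : LoopInvariant G r pre (e :: σ) L) (he : 2 ≤ hits (pairNbhd G e) L)
    (hpair : ∀ f ∈ pre, 3 ≤ hits (pairNbhd G f ∪ pairNbhd G e) L) :
    LoopInvariant G r (pre ++ [e]) σ L where
  sorted := by simpa using h.sorted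
  isEdge := by simpa using h.isEdge
  upper g hg := h.upper g (List.mem_cons_of_mem _ hg)
  two_le f hf := by
    rcases List.mem_append.1 hf with hf | hf
    · exact h.two_le f hf
    · rw [List.mem_singleton.1 hf]; exact he
  three_le f hf g hg hne := by
    rcases List.mem_append.1 hf with hf | hf <;> rcases List.mem_append.1 hg with hg | hg
    · exact h.three_le f hf g hg hne
    · rw [List.mem_singleton.1 hg]; exact hpair f hf
    · rw [List.mem_singleton.1 hf, Finset.union_comm]; exact hpair g hg
    · rw [List.mem_singleton.1 hf, List.mem_singleton.1 hg] at hne; exact absurd rfl hne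
  dominated := h.dominated

/-- Passing a block of edges that have three hits each. -/
theorem pass_all {τ : List (V × V)}
    (hτ : ∀ e ∈ τ, 3 ≤ hits (pairNbhd G e) L) (h : LoopInvariant G r pre (τ ++ σ) L) :
    LoopInvariant G r (pre ++ τ) σ L := by
  classical
  induction τ generalizing pre with
  | nil => simpa using h
  | cons e τ ih =>
    have h3 := hτ e (by simp)
    have := ih (fun f hf => hτ f (by simp [hf])) (pass h (by omega) fun f _ =>
      h3.trans (hits_mono Finset.subset_union_right le_rfl))
    simpa using this

end LoopInvariant

theorem two_le_card_pairNbhd {e : V × V} (h : G.Adj e.1 e.2) : 2 ≤ (pairNbhd G e).card := by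
  classical
  have hsub : ({e.1, e.2} : Finset V) ⊆ pairNbhd G e := by
    intro x hx
    rcases Finset.mem_insert.1 hx with rfl | hx
    · exact left_mem_edgeNbhd _ _
    · rw [Finset.mem_singleton.1 hx]; exact right_mem_edgeNbhd _ _
  have := Finset.card_le_card hsub
  rwa [Finset.card_pair h.ne] at this

open Classical in
theorem hits_completeToTwo (hr : Function.Injective r) {e : V × V} (h : G.Adj e.1 e.2)
    {L : Finset V} (hle : hits (pairNbhd G e) L ≤ 2) :
    hits (pairNbhd G e) (completeToTwo G r L e) = 2 := by
  have hc := two_le_card_pairNbhd h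
  set S := pairNbhd G e
  have hT := topRight_subset r (2 - hits S L) (S \ L)
  have hcard := card_topRight hr (2 - hits S L) (S \ L)
  have hS : (S ∩ L).card + (S \ L).card = S.card := Finset.card_inter_add_card_sdiff S L
  have : S ∩ completeToTwo G r L e = S ∩ L ∪ topRight r (2 - hits S L) (S \ L) := by
    unfold completeToTwo
    rw [Finset.inter_union_distrib_left]
    congr 1
    exact Finset.inter_eq_right.2 (hT.trans Finset.sdiff_subset)
  rw [hits_eq, this, Finset.card_union_of_disjoint, hcard, ← hits_eq]
  · rw [← hits_eq] at hS
    omega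
  · rw [Finset.disjoint_left]
    intro x hx hx'
    exact (Finset.mem_sdiff.1 (hT hx')).2 (Finset.mem_inter.1 hx).2

namespace LoopInvariant

variable {pre σ : List (V × V)} {L : Finset V} {e : V × V}

-- The demand 2 − |N[e] ∩ L| is exactly what every feasible set has in excess, at least, over L in
-- N[e], so domination survives.
open Classical in
theorem completeToTwo (hr : Function.Injective r) (hU : Umbrella G r)
    (h : LoopInvariant G r pre (e :: σ) L) (hle : hits (pairNbhd G e) L ≤ 2) :
    LoopInvariant G r pre (e :: σ) (completeToTwo G r L e) := by
  refine h.union hr hU ((topRight_subset _ _ _).trans Finset.sdiff_subset) fun L' hL' => ?_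
  refine Dominated.union_topRight (h.upper e (by simp)) ?_ (h.dominated L' hL') ?_
  · have := (isLiarVEDominating_iff.1 hL').1 s(e.1, e.2) h.of_mem_right.1
    change hits (pairNbhd G e) L + (2 - hits (pairNbhd G e) L) ≤ _
    omega
  · rw [card_topRight hr]
    exact min_le_left _ _

end LoopInvariant


open Classical in
theorem subset_secondRound (L : Finset V) (f : V × V) : L ⊆ secondRound G r L f := by
  unfold secondRound completeToTwo
  split_ifs <;> exact Finset.subset_union_left

-- A new vertex t near f is either a third hit for e or lies outside N[e]. In the latter case, f had
-- fewer hits than e, so some old hit p of e is not near f; since L ∩ N[f] is a final segment of L,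
-- p lies left of t.
open Classical in
theorem settled_completeToTwo (hr : Function.Injective r) {L : Finset V} {e f : V × V}
    (hupper : ∀ x ∈ L, ∀ z ∈ pairNbhd G f, r z ≤ r x → x ∈ pairNbhd G f)
    (hf : G.Adj f.1 f.2) (he2 : hits (pairNbhd G e) L = 2) (hf2 : hits (pairNbhd G f) L < 2) :
    Settled G r (completeToTwo G r L f) e := by
  have hsub : L ⊆ completeToTwo G r L f := Finset.subset_union_left
  obtain ⟨t, ht, htL⟩ : ∃ t ∈ pairNbhd G f ∩ completeToTwo G r L f, t ∉ L := by
    by_contra! hcon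
    have : hits (pairNbhd G f) (completeToTwo G r L f) ≤ hits (pairNbhd G f) L :=
      Finset.card_le_card fun x hx =>
        Finset.mem_inter.2 ⟨(Finset.mem_inter.1 hx).1, hcon x hx⟩
    rw [hits_completeToTwo hr hf hf2.le] at this
    omega
  rw [Finset.mem_inter] at ht
  by_cases hte : t ∈ pairNbhd G e
  · exact Or.inl (three_le_hits he2 hsub hte htL ht.2)
  obtain ⟨p, hp, hpf⟩ : ∃ p ∈ pairNbhd G e ∩ L, p ∉ pairNbhd G f := by
    by_contra! hcon
    have : hits (pairNbhd G e) L ≤ hits (pairNbhd G f) L :=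
      Finset.card_le_card fun x hx =>
        Finset.mem_inter.2 ⟨hcon x hx, (Finset.mem_inter.1 hx).2⟩
    omega
  rw [Finset.mem_inter] at hp
  refine Or.inr ⟨p, hp.1, hsub hp.2, t, ht.2, hte, ?_⟩
  by_contra hcon
  exact hpf (hupper p hp.2 t ht.1 (not_lt.1 hcon))

-- Two distinct edges with a common vertex in their neighbourhoods cannot both live on two vertices
-- only. Hence each neighbourhood has a vertex besides the two common hits, so the second round has
-- something to add.
open Classical in
theorem exists_notMem_of_inter_eq {L : Finset V} {e f : V × V} (he : G.Adj e.1 e.2)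
    (hf : G.Adj f.1 f.2) (hne : s(e.1, e.2) ≠ s(f.1, f.2))
    (he2 : hits (pairNbhd G e) L = 2) (heq : pairNbhd G f ∩ L = pairNbhd G e ∩ L) :
    ∃ p ∈ pairNbhd G e, p ∈ L ∧ p ∈ pairNbhd G f ∧
      (∃ z ∈ pairNbhd G e, z ∉ L) ∧ ∃ z ∈ pairNbhd G f, z ∉ L := by
  obtain ⟨p, q, -, hpq⟩ := Finset.card_eq_two.1 he2
  have hp : p ∈ pairNbhd G e ∩ L := by rw [hpq]; simp
  have hpf : p ∈ pairNbhd G f ∩ L := by rw [heq]; exact hp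
  rw [Finset.mem_inter] at hp hpf
  refine ⟨p, hp.1, hp.2, hpf.1, ?_, ?_⟩
  · obtain ⟨z, hz, hzp, hzq⟩ := exists_mem_edgeNbhd_ne he hf hne hp.1 hpf.1 p q
    refine ⟨z, hz, fun hzL => ?_⟩
    have : z ∈ pairNbhd G e ∩ L := Finset.mem_inter.2 ⟨hz, hzL⟩
    rw [hpq] at this
    simp [hzp, hzq] at this
  · obtain ⟨z, hz, hzp, hzq⟩ := exists_mem_edgeNbhd_ne hf he hne.symm hpf.1 hp.1 p q
    refine ⟨z, hz, fun hzL => ?_⟩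
    have : z ∈ pairNbhd G f ∩ L := Finset.mem_inter.2 ⟨hz, hzL⟩
    rw [heq, hpq] at this
    simp [hzp, hzq] at this

-- Let y be the added vertex and p an old hit of e. If y is outside N[e] but not right of p, then it
-- is left of the interval N[e], hence left of an unchosen z in N[e]. Monotonicity of right ends
-- puts z into N[f], against the choice of y as rightmost missing vertex there.
open Classical in
theorem settled_union_topRight (hr : Function.Injective r) (hU : Umbrella G r) {L : Finset V}
    {e f : V × V} (he : G.Adj e.1 e.2 ∧ r e.1 < r e.2) (hf : G.Adj f.1 f.2 ∧ r f.1 < r f.2)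
    (hef : EdgeLT r e f) (he2 : hits (pairNbhd G e) L = 2)
    (heq : pairNbhd G f ∩ L = pairNbhd G e ∩ L) :
    Settled G r (L ∪ topRight r 1 (pairNbhd G f \ L)) e := by
  obtain ⟨p, hpe, hpL, -, ⟨z, hze, hzL⟩, ⟨z', hzf, hzL'⟩⟩ :=
    exists_notMem_of_inter_eq he.1 hf.1 (hef.sym2_ne he.2 hf.2) he2 heq
  obtain ⟨y, hy, hymax⟩ := (pairNbhd G f \ L).exists_max_image r
    ⟨z', Finset.mem_sdiff.2 ⟨hzf, hzL'⟩⟩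
  rw [topRight_one hr hy hymax]
  rw [Finset.mem_sdiff] at hy
  have hyU : y ∈ L ∪ {y} := by simp
  by_cases hye : y ∈ pairNbhd G e
  · exact Or.inl (three_le_hits he2 Finset.subset_union_left hye hy.2 hyU)
  refine Or.inr ⟨p, hpe, Finset.mem_union_left _ hpL, y, hyU, hye, ?_⟩
  by_contra hcon
  rw [not_lt] at hcon
  have hyz : r y < r z := by
    by_contra hzy
    exact hye (hU.edgeNbhd_convex hr he.1 hze hpe (not_lt.1 hzy) hcon)
  have hzf' : z ∈ pairNbhd G f :=
    hU.edgeNbhd_right_mono hr he.2 hef.right_le hf.1 hze hy.1 hyz.le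
  exact absurd (hymax z (Finset.mem_sdiff.2 ⟨hzf', hzL⟩)) (not_le.2 hyz)

-- Both neighbourhoods meet L in the same two vertices, so L has two hits in their union while a
-- feasible set has three. By monotonicity of right ends, the rightmost missing vertex of N[f] is
-- the rightmost missing vertex of the union.
open Classical in
theorem dominated_union_topRight (hr : Function.Injective r) (hU : Umbrella G r) {L L' : Finset V}
    {e f : V × V} (he : G.Adj e.1 e.2 ∧ r e.1 < r e.2) (hf : G.Adj f.1 f.2 ∧ r f.1 < r f.2)
    (hef : EdgeLT r e f) (he2 : hits (pairNbhd G e) L = 2)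
    (heq : pairNbhd G f ∩ L = pairNbhd G e ∩ L)
    (huppere : ∀ x ∈ L, ∀ z ∈ pairNbhd G e, r z ≤ r x → x ∈ pairNbhd G e)
    (hupper : ∀ x ∈ L, ∀ z ∈ pairNbhd G f, r z ≤ r x → x ∈ pairNbhd G f)
    (hL' : IsLiarVEDominating G L') (hdom : Dominated r L L') :
    Dominated r (L ∪ topRight r 1 (pairNbhd G f \ L)) L' := by
  have hne := hef.sym2_ne he.2 hf.2
  obtain ⟨-, -, -, -, -, ⟨z', hzf, hzL'⟩⟩ := exists_notMem_of_inter_eq he.1 hf.1 hne he2 heq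
  obtain ⟨y, hy, hymax⟩ := (pairNbhd G f \ L).exists_max_image r
    ⟨z', Finset.mem_sdiff.2 ⟨hzf, hzL'⟩⟩
  rw [topRight_one hr hy hymax]
  rw [Finset.mem_sdiff] at hy
  refine Dominated.insert_max (S := pairNbhd G e ∪ pairNbhd G f) hr ?_
    (Finset.mem_union_right _ hy.1) hy.2 ?_ ?_ hdom (by simp)
  · intro x hx z hz hzx
    rcases Finset.mem_union.1 hz with hz | hz
    · exact Finset.mem_union_left _ (huppere x hx z hz hzx)
    · exact Finset.mem_union_right _ (hupper x hx z hz hzx)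
  · intro x hx hxL
    by_contra hcon
    rw [not_le] at hcon
    refine absurd (hymax x (Finset.mem_sdiff.2 ⟨?_, hxL⟩)) (not_le.2 hcon)
    rcases Finset.mem_union.1 hx with hx | hx
    · exact hU.edgeNbhd_right_mono hr he.2 hef.right_le hf.1 hx hy.1 hcon.le
    · exact hx
  · have h3 := (isLiarVEDominating_iff.1 hL').2 _ he.1 _ hf.1 hne
    refine lt_of_lt_of_le ?_ h3
    rw [hits_eq, Finset.union_inter_distrib_right, heq, Finset.union_idempotent, ← hits_eq, he2]
    norm_num

-- Induction on the number of remaining edges, as the loop may jump. `Settled` is required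
-- separately from the invariant: after the second round, e is settled although f is not yet passed.
open Classical in
theorem lvedsLoop_correct (hr : Function.Injective r) (hU : Umbrella G r) (n : ℕ) :
    ∀ (σ pre : List (V × V)) (L : Finset V), σ.length = n → LoopInvariant G r pre σ L →
      (∀ f ∈ pre, Settled G r L f) →
      ∃ pre', (∀ f, f ∈ pre ++ σ ↔ f ∈ pre') ∧
        LoopInvariant G r pre' [] (lvedsLoop G r σ L) := by
  induction n using Nat.strong_induction_on with
  | _ n ih =>
  intro σ pre L hn h hset
  rcases σ with _ | ⟨e, es⟩
  · refine ⟨pre, by simp, ?_⟩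
    rwa [lvedsLoop]
  rw [lvedsLoop]
  split_ifs with hle
  · replace hle : hits (pairNbhd G e) L ≤ 2 := hle
    have hadj := h.of_mem_right
    have h1 := h.completeToTwo hr hU hle
    have he2 := hits_completeToTwo hr hadj.1 hle
    have hset1 : ∀ f ∈ pre, Settled G r (completeToTwo G r L e) f := fun f hf =>
      (hset f hf).mono Finset.subset_union_left
    set L₁ := completeToTwo G r L e with hL₁
    have h2 := h1.pass he2.ge fun f hf => h1.three_le_current hr hU he2.ge hf (hset1 f hf)
    -- A non-candidate g has at least two hits. Both hit sets are final segments of L₁, so those of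
    -- e are among those of g; they differ, so g has a third.
    have hskip : ∀ g ∈ es, ¬ IsMinCandidate G L₁ e g → 3 ≤ hits (pairNbhd G g) L₁ := by
      intro g hg hng
      rw [IsMinCandidate, not_or, not_lt] at hng
      obtain ⟨hg2, hgne⟩ := hng
      have hsub := upper_inter_subset (h1.upper e (by simp)) (h2.upper g hg)
        (he2.trans_le hg2 : hits (pairNbhd G e) L₁ ≤ hits (pairNbhd G g) L₁)
      have := Finset.card_lt_card (hsub.ssubset_of_ne (Ne.symm hgne))
      rw [← hits_eq, ← hits_eq] at this
      omega
    have hsplit := List.takeWhile_append_dropWhile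
      (p := fun f => decide (¬ IsMinCandidate G L₁ e f)) (l := es)
    have htake : ∀ g ∈ es.takeWhile fun f => decide (¬ IsMinCandidate G L₁ e f),
        3 ≤ hits (pairNbhd G g) L₁ := fun g hg =>
      hskip g ((List.takeWhile_sublist _).subset hg) (by simpa using List.mem_takeWhile_imp hg)
    set skip := es.takeWhile fun f => decide (¬ IsMinCandidate G L₁ e f) with hskipdef
    split
    · rename_i hdrop
      rw [hdrop, List.append_nil] at hsplit
      refine ⟨pre ++ [e] ++ skip, by simp [hsplit], ?_⟩
      exact LoopInvariant.pass_all htake (by rw [List.append_nil, hsplit]; exact h2)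
    · rename_i f fs hdrop
      rw [hdrop] at hsplit
      have h3 : LoopInvariant G r (pre ++ [e] ++ skip) (f :: fs) L₁ :=
        LoopInvariant.pass_all htake (by rw [hsplit]; exact h2)
      have hcand : IsMinCandidate G L₁ e f := by
        have := List.head?_dropWhile_not (fun f => decide (¬ IsMinCandidate G L₁ e f)) es
        rw [hdrop] at this
        simpa using this
      have hfes : f ∈ es := by rw [← hsplit]; simp
      have hlen : (f :: fs).length < n := by
        have := congrArg List.length hsplit
        rw [List.length_append] at this
        rw [← hn, List.length_cons (as := es)]
        omega
      have hLL := subset_secondRound (G := G) (r := r) L₁ f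
      have hef : EdgeLT r e f :=
        (List.pairwise_cons.1 (List.pairwise_append.1 h1.sorted).2.1).1 f hfes
      have hfadj := h3.of_mem_right
      -- The edge f remains at the head of the list and is processed next as the current edge; only
      -- e and the skipped edges are passed here.
      suffices hgoal : LoopInvariant G r (pre ++ [e] ++ skip) (f :: fs) (secondRound G r L₁ f) ∧
          Settled G r (secondRound G r L₁ f) e by
        obtain ⟨pre', hmem, hinv⟩ := ih _ hlen _ _ _ rfl hgoal.1 (by
          intro g hg
          rw [List.mem_append, List.mem_append, List.mem_singleton] at hg
          rcases hg with (hg | rfl) | hg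
          · exact (hset1 g hg).mono hLL
          · exact hgoal.2
          · exact Or.inl ((htake g hg).trans (hits_mono le_rfl hLL)))
        refine ⟨pre', fun g => ?_, hinv⟩
        rw [← hmem, ← hsplit]
        simp
      have hlt : hits (pairNbhd G f) L₁ < 2 ∨ pairNbhd G f ∩ L₁ = pairNbhd G e ∩ L₁ := hcand
      by_cases hf2 : hits (pairNbhd G f) L₁ < 2
      · have heq : secondRound G r L₁ f = completeToTwo G r L₁ f := if_pos hf2
        rw [heq]
        exact ⟨h3.completeToTwo hr hU hf2.le,
          settled_completeToTwo hr (h3.upper f (by simp)) hfadj.1 he2 hf2⟩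
      · have heq : secondRound G r L₁ f = L₁ ∪ topRight r 1 (pairNbhd G f \ L₁) := if_neg hf2
        have hNeq := hlt.resolve_left hf2
        rw [heq]
        refine ⟨h3.union hr hU ((topRight_subset _ _ _).trans Finset.sdiff_subset) fun L' hL' => ?_,
          settled_union_topRight hr hU hadj hfadj hef he2 hNeq⟩
        exact dominated_union_topRight hr hU hadj hfadj hef he2 hNeq
          (h1.upper e (by simp)) (h2.upper f hfes) hL' (h3.dominated L' hL')
  · have h3 : 3 ≤ hits (pairNbhd G e) L := by
      change ¬ hits (pairNbhd G e) L ≤ 2 at hle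
      omega
    have h2 := h.pass (by omega) fun f _ => h3.trans (hits_mono Finset.subset_union_right le_rfl)
    obtain ⟨pre', hmem, hinv⟩ := ih es.length (by simp at hn; omega) es (pre ++ [e]) L rfl h2 (by
      intro f hf
      rcases List.mem_append.1 hf with hf | hf
      · exact hset f hf
      · rw [List.mem_singleton.1 hf]; exact Or.inl h3)
    exact ⟨pre', fun f => by rw [← hmem]; simp, hinv⟩

/-- The output of the algorithm is a liar's vertex-edge dominating set, and is dominated by every
such set. -/
theorem lvedsProperInterval_spec (R : ProperIntervalRep G) {σ : List (V × V)}
    (hσ : IsEdgeIntervalOrdering R σ) : IsLiarVEDominating G (lvedsProperInterval R σ) ∧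
      ∀ L', IsLiarVEDominating G L' → Dominated R.r (lvedsProperInterval R σ) L' := by
  classical
  obtain ⟨pre, hmem, hinv⟩ := lvedsLoop_correct R.r_injective R.umbrella σ.length σ [] ∅ rfl
    { sorted := by simpa using hσ.1
      isEdge := fun e he => (hσ.2 e.1 e.2).1 (by simpa using he)
      upper := by simp
      two_le := by simp
      three_le := by simp
      dominated := fun L' _ => Dominated.empty _ _ } (by simp)
  have hedge : ∀ e ∈ G.edgeSet, ∃ f ∈ pre, s(f.1, f.2) = e := by
    intro e he
    induction e using Sym2.ind with
    | _ u v =>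
    rcases lt_trichotomy (R.r u) (R.r v) with h | h | h
    · exact ⟨(u, v), (hmem _).1 (by simpa using (hσ.2 u v).2 ⟨he, h⟩), rfl⟩
    · exact absurd (R.r_injective h) he.ne
    · exact ⟨(v, u), (hmem _).1 (by simpa using (hσ.2 v u).2 ⟨he.symm, h⟩), Sym2.eq_swap⟩
  refine ⟨isLiarVEDominating_iff.2 ⟨?_, ?_⟩, hinv.dominated⟩
  · intro e he
    obtain ⟨f, hf, rfl⟩ := hedge e he
    exact hinv.two_le f hf
  · intro e he e' he' hne
    obtain ⟨f, hf, rfl⟩ := hedge e he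
    obtain ⟨f', hf', rfl⟩ := hedge e' he'
    exact hinv.three_le f hf f' hf' fun h => hne (by rw [h])

theorem isMin_of_dominated {L : Finset V} (hL : IsLiarVEDominating G L)
    (hdom : ∀ L', IsLiarVEDominating G L' → Dominated r L L') : IsMinLiarVEDominating G L :=
  ⟨hL, fun L' hL' => (hdom L' hL').card_le⟩

end Greedy

/-! ### Breadth-first layers of a proper interval graph -/

section Layers

variable {V : Type*} {H : SimpleGraph V} {ρ : V → ℝ} {D : V → ℕ} {s : V}

theorem Umbrella.neg (hU : Umbrella H ρ) : Umbrella H (fun v => -ρ v) := by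
  intro u v w huv hvw huw
  have := hU w v u (by linarith) (by linarith) huw.symm
  exact ⟨this.2.symm, this.1.symm⟩

/-- Distinct adjacent vertices with the same closed neighbourhood. -/
def Twins (H : SimpleGraph V) (u v : V) : Prop :=
  H.Adj u v ∧ ∀ w, w ≠ u → w ≠ v → (H.Adj u w ↔ H.Adj v w)

open Classical in
theorem Twins.adj_swap {u v : V} (h : Twins H u v) (a b : V) :
    H.Adj (Equiv.swap u v a) (Equiv.swap u v b) ↔ H.Adj a b := by
  obtain ⟨h1, h2⟩ := h
  have hs := h1.symm
  have h3 := fun a b => H.adj_comm a b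
  have h4 := H.irrefl (v := u)
  have h5 := H.irrefl (v := v)
  simp only [Equiv.swap_apply_def]
  split_ifs <;> grind

open Classical in
-- Exchanging twins is an automorphism of the graph, which is the freedom used to turn a vertex into
-- an end of the order.
theorem Umbrella.comp_swap (hU : Umbrella H ρ) {u v : V} (h : Twins H u v) :
    Umbrella H (ρ ∘ Equiv.swap u v) := by
  intro a b c hab hbc hac
  have := hU _ _ _ hab hbc ((h.adj_swap a c).2 hac)
  rwa [h.adj_swap, h.adj_swap] at this

/-- On the component of the root `s`, `D` is the distance from `s` up to an additive constant. -/
structure Layering (H : SimpleGraph V) (D : V → ℕ) (s : V) : Prop where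
  adj_le : ∀ x y, H.Adj x y → D y ≤ D x + 1
  parent : ∀ x, H.Reachable s x → x ≠ s → ∃ y, H.Adj x y ∧ D x = D y + 1

/-- Follow the parent y of v. If y lies left of u, the edge from y to v spans u, so u is adjacent to
y and at most one level deeper. If y lies right of u, use induction with y in place of v. -/
theorem Layering.mono_right (hD : Layering H D s) (hinj : Function.Injective ρ)
    (hU : Umbrella H ρ) {u v : V}
    (hsv : H.Reachable s v) (hsu : ρ s ≤ ρ u) (huv : ρ u ≤ ρ v) : D u ≤ D v := by
  induction hn : D v using Nat.strong_induction_on generalizing v with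
  | _ n ih =>
  subst hn
  rcases huv.eq_or_lt with h | h
  · rw [hinj h]
  have hne : v ≠ s := by
    rintro rfl
    exact absurd h (not_lt.2 hsu)
  obtain ⟨y, hy, hDy⟩ := hD.parent v hsv hne
  rcases lt_trichotomy (ρ y) (ρ u) with hyu | hyu | hyu
  · have := hD.adj_le y u (hU y u v hyu h hy.symm).1
    omega
  · have := hinj hyu
    subst this
    omega
  · have := ih (D y) (by omega) (hsv.trans hy.reachable) hyu.le rfl
    omega

theorem Layering.mono_left (hD : Layering H D s) (hinj : Function.Injective ρ)
    (hU : Umbrella H ρ) {u v : V}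
    (hsv : H.Reachable s v) (hsu : ρ u ≤ ρ s) (huv : ρ v ≤ ρ u) : D u ≤ D v :=
  hD.mono_right (ρ := fun v => -ρ v) (fun _ _ h => hinj (neg_injective h)) hU.neg hsv
    (neg_le_neg hsu) (neg_le_neg huv)

/-- Let a be the leftmost vertex of the component. It is in the last layer too, and its parent lies
right of z, so the umbrella property gives N[a] ⊆ N[z]. As z has least degree in that layer,
equality holds: a and z are twins and can be exchanged. -/
theorem exists_end_order_of_le (hD : Layering H D s) (hinj : Function.Injective ρ)
    (hU : Umbrella H ρ) (hfin : {x | H.Reachable s x}.Finite) {z : V} (hsz : H.Reachable s z)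
    (hzD : ∀ x, H.Reachable s x → D x ≤ D z)
    (hzdeg : ∀ x, H.Reachable s x → D x = D z → (H.neighborSet z).ncard ≤ (H.neighborSet x).ncard)
    (hzs : ρ z ≤ ρ s) :
    ∃ ρ' : V → ℝ, Function.Injective ρ' ∧ Umbrella H ρ' ∧ ∀ x, H.Reachable z x → ρ' z ≤ ρ' x := by
  classical
  obtain ⟨a, ha, hamin⟩ := Set.exists_min_image _ ρ hfin ⟨s, SimpleGraph.Reachable.refl s⟩
  have haz := hamin z hsz
  have hDaz : D a = D z := le_antisymm (hzD a ha) (hD.mono_left hinj hU ha hzs haz)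
  rcases haz.eq_or_lt with h | h
  · refine ⟨ρ, hinj, hU, fun x hx => ?_⟩
    rw [← h]
    exact hamin x (hsz.trans hx)
  have has : a ≠ s := by
    rintro rfl
    exact absurd h (not_lt.2 hzs)
  obtain ⟨y, hy, hDy⟩ := hD.parent a ha has
  have hzy : ρ z < ρ y := by
    by_contra hcon
    have := hD.mono_left hinj hU (ha.trans hy.reachable) hzs (not_lt.1 hcon)
    omega
  have hadj := hU a z y h hzy hy
  have nfin : ∀ x, H.Reachable s x → (H.neighborSet x).Finite := fun x hx =>
    hfin.subset fun w hw => hx.trans (SimpleGraph.Adj.reachable hw)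
  have hsub : insert a (H.neighborSet a) ⊆ insert z (H.neighborSet z) := by
    rintro w (rfl | hw)
    · exact Or.inr hadj.1.symm
    · rcases lt_trichotomy (ρ w) (ρ z) with hwz | hwz | hwz
      · have haw : ρ a < ρ w := lt_of_le_of_ne (hamin w (ha.trans (SimpleGraph.Adj.reachable hw)))
          fun h => (SimpleGraph.Adj.ne hw) (hinj h)
        exact Or.inr (hU a w z haw hwz hadj.1).2.symm
      · exact Or.inl (hinj hwz)
      · exact Or.inr (hU a z w h hwz hw).2
  have heq := Set.eq_of_subset_of_ncard_le hsub (by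
    rw [Set.ncard_insert_of_notMem (by simp) (nfin z hsz),
      Set.ncard_insert_of_notMem (by simp) (nfin a ha)]
    have := hzdeg a ha hDaz
    omega) ((nfin z hsz).insert z)
  have htw : Twins H a z := by
    refine ⟨hadj.1, fun w hwa hwz => ?_⟩
    have := Set.ext_iff.1 heq w
    simpa [hwa, hwz] using this
  refine ⟨ρ ∘ Equiv.swap a z, hinj.comp (Equiv.injective _), hU.comp_swap htw, fun x hx => ?_⟩
  simp only [Function.comp, Equiv.swap_apply_right]
  apply hamin
  rw [Equiv.swap_apply_def]
  split_ifs
  · exact hsz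
  · exact ha
  · exact hsz.trans hx

/-- A vertex of least degree in the last layer is an end of some umbrella order. -/
theorem exists_end_order (hD : Layering H D s) (hinj : Function.Injective ρ)
    (hU : Umbrella H ρ) (hfin : {x | H.Reachable s x}.Finite) {z : V} (hsz : H.Reachable s z)
    (hzD : ∀ x, H.Reachable s x → D x ≤ D z)
    (hzdeg : ∀ x, H.Reachable s x → D x = D z →
      (H.neighborSet z).ncard ≤ (H.neighborSet x).ncard) :
    ∃ ρ' : V → ℝ, Function.Injective ρ' ∧ Umbrella H ρ' ∧ ∀ x, H.Reachable z x → ρ' z ≤ ρ' x := by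
  rcases le_total (ρ z) (ρ s) with h | h
  · exact exists_end_order_of_le hD hinj hU hfin hsz hzD hzdeg h
  · exact exists_end_order_of_le (ρ := fun v => -ρ v) hD (fun a b h => hinj (neg_injective h))
      hU.neg hfin hsz hzD hzdeg (neg_le_neg h)

/-- The parent of v is in an earlier layer, hence left of u; the edge from it to v spans u. -/
theorem Layering.adj_of_eq (hD : Layering H D s) (hinj : Function.Injective ρ)
    (hU : Umbrella H ρ) (hmin : ∀ x, H.Reachable s x → ρ s ≤ ρ x) {u v : V}
    (hu : H.Reachable s u) (hv : H.Reachable s v) (huv : ρ u < ρ v) (h : D u = D v) :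
    H.Adj u v := by
  have hvs : v ≠ s := by
    rintro rfl
    exact absurd huv (not_lt.2 (hmin u hu))
  obtain ⟨y, hy, hDy⟩ := hD.parent v hv hvs
  have hyu : ρ y < ρ u := by
    by_contra hcon
    have := hD.mono_right hinj hU (hv.trans hy.reachable) (hmin u hu) (not_lt.1 hcon)
    omega
  exact (hU y u v hyu huv hy.symm).2

/-- Numbers of neighbours in the later and in the earlier layers. -/
noncomputable def laterDegree (H : SimpleGraph V) (D : V → ℕ) (v : V) : ℕ :=
  {w | H.Adj v w ∧ D v < D w}.ncard

/-- Number of neighbours in the earlier layers. -/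
noncomputable def earlierDegree (H : SimpleGraph V) (D : V → ℕ) (v : V) : ℕ :=
  {w | H.Adj v w ∧ D w < D v}.ncard

/-- `u` comes before `v` if vertices are sorted by layers, and inside a layer by the difference of
the numbers of neighbours in later and in earlier layers. -/
def LayerLE (H : SimpleGraph V) (D : V → ℕ) (u v : V) : Prop :=
  D u < D v ∨ D u = D v ∧
    laterDegree H D u + earlierDegree H D v ≤ laterDegree H D v + earlierDegree H D u

/-- Suppose v lies left of u; then the layers agree. Later neighbours of v are neighbours of u, and
earlier neighbours of u are neighbours of v. The degree inequality of `LayerLE` goes the opposite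
way, so both inclusions are equalities. Vertices of the same layer are adjacent to each other, so u
and v are twins. -/
theorem Layering.lt_or_twins (hD : Layering H D s) (hinj : Function.Injective ρ)
    (hU : Umbrella H ρ) (hmin : ∀ x, H.Reachable s x → ρ s ≤ ρ x)
    (hfin : {x | H.Reachable s x}.Finite) {u v : V}
    (hu : H.Reachable s u) (hv : H.Reachable s v) (hne : u ≠ v) (h : LayerLE H D u v) :
    ρ u < ρ v ∨ Twins H u v := by
  by_contra! hcon
  obtain ⟨hvu, hnt⟩ := hcon
  replace hvu : ρ v < ρ u := lt_of_le_of_ne hvu fun h => hne (hinj h).symm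
  have hDvu := hD.mono_right hinj hU hu (hmin v hv) hvu.le
  have hmono : ∀ x y, H.Reachable s x → H.Reachable s y → D x < D y → ρ x < ρ y := by
    intro x y hx hy hxy
    by_contra hcon
    have := hD.mono_right hinj hU hx (hmin y hy) (not_lt.1 hcon)
    omega
  rcases h with h | ⟨hDeq, hle⟩
  · omega
  have nfin : ∀ x, H.Reachable s x → (H.neighborSet x).Finite := fun x hx =>
    hfin.subset fun w hw => hx.trans (SimpleGraph.Adj.reachable hw)
  have hsub1 : {w | H.Adj v w ∧ D v < D w} ⊆ {w | H.Adj u w ∧ D u < D w} := by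
    rintro w ⟨hw, hDw⟩
    have huw := hmono u w hu (hv.trans hw.reachable) (by omega)
    exact ⟨(hU v u w hvu huw hw).2, by omega⟩
  have hsub2 : {w | H.Adj u w ∧ D w < D u} ⊆ {w | H.Adj v w ∧ D w < D v} := by
    rintro w ⟨hw, hDw⟩
    have hwv := hmono w v (hu.trans hw.reachable) hv (by omega)
    exact ⟨(hU w v u hwv hvu hw.symm).1.symm, by omega⟩
  have f1 : {w | H.Adj u w ∧ D u < D w}.Finite := (nfin u hu).subset fun w hw => hw.1
  have f2 : {w | H.Adj v w ∧ D w < D v}.Finite := (nfin v hv).subset fun w hw => hw.1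
  have c1 := Set.ncard_le_ncard hsub1 f1
  have c2 := Set.ncard_le_ncard hsub2 f2
  unfold laterDegree earlierDegree at hle
  have e1 := Set.eq_of_subset_of_ncard_le hsub1 (by omega) f1
  have e2 := Set.eq_of_subset_of_ncard_le hsub2 (by omega) f2
  have hadj : ∀ x y, H.Reachable s x → H.Reachable s y → x ≠ y → D x = D y → H.Adj x y := by
    intro x y hx hy hxy hDxy
    rcases lt_or_gt_of_ne (fun h => hxy (hinj h) : ρ x ≠ ρ y) with h | h
    · exact hD.adj_of_eq hinj hU hmin hx hy h hDxy
    · exact (hD.adj_of_eq hinj hU hmin hy hx h hDxy.symm).symm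
  refine hnt ⟨hadj u v hu hv hne hDeq, fun w hwu hwv => ?_⟩
  have g1 := Set.ext_iff.1 e1 w
  have g2 := Set.ext_iff.1 e2 w
  simp only [Set.mem_ofPred_eq] at g1 g2
  rcases lt_trichotomy (D w) (D u) with h | h | h
  · rw [← hDeq] at g2
    tauto
  · constructor
    · intro hw
      exact hadj v w hv (hu.trans hw.reachable) (Ne.symm hwv) (by omega)
    · intro hw
      exact hadj u w hu (hv.trans hw.reachable) (Ne.symm hwu) (by omega)
  · rw [← hDeq] at g1
    tauto

/-- An enumeration compatible with `LayerLE` is an umbrella order. -/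
theorem adj_of_layerLE (hfin : ∀ s, {x | H.Reachable s x}.Finite) {u v w : V}
    (hroot : ∃ s, H.Reachable s u ∧ Layering H D s ∧ ∃ ρ : V → ℝ, Function.Injective ρ ∧
      Umbrella H ρ ∧ ∀ x, H.Reachable s x → ρ s ≤ ρ x)
    (hreach : D v = D u ∨ D v = D w → H.Reachable u v)
    (huv : u ≠ v) (hvw : v ≠ w) (h1 : LayerLE H D u v) (h2 : LayerLE H D v w)
    (huw : H.Adj u w) : H.Adj u v ∧ H.Adj v w := by
  obtain ⟨s, hsu, hD, ρ, hinj, hU, hmin⟩ := hroot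
  have hDuw := hD.adj_le u w huw
  have hr : H.Reachable u v := by
    apply hreach
    rcases h1 with h1 | h1 <;> rcases h2 with h2 | h2 <;> omega
  have hsv := hsu.trans hr
  have hsw := hsu.trans huw.reachable
  rcases hD.lt_or_twins hinj hU hmin (hfin s) hsu hsv huv h1 with a | a
  · rcases hD.lt_or_twins hinj hU hmin (hfin s) hsv hsw hvw h2 with b | b
    · exact hU u v w a b huw
    · refine ⟨?_, b.1⟩
      by_cases e : u = w
      · subst e; exact b.1.symm
      · exact ((b.2 u huv e).2 huw.symm).symm
  · refine ⟨a.1, ?_⟩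
    exact (a.2 w huw.ne.symm hvw.symm).1 huw

end Layers

/-! ### Reasoning about programs -/

namespace RAM

infixr:60 ";;" => Prog.seq

/-- Registers written by an operation. -/
def Op.regs : Op → List ℕ
  | const x _ => [x]
  | copy x _ => [x]
  | succ x => [x]
  | pred x => [x]
  | load x _ _ => [x]
  | store _ _ _ => []

/-- Arrays written by an operation. -/
def Op.arrs : Op → List ℕ
  | store a _ _ => [a]
  | _ => []

/-- Registers written by a program. -/
def Prog.regs : Prog → List ℕ
  | op o => o.regs
  | seq p q => p.regs ++ q.regs
  | ite _ p q => p.regs ++ q.regs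
  | .while _ p => p.regs

/-- Arrays written by a program. -/
def Prog.arrs : Prog → List ℕ
  | op o => o.arrs
  | seq p q => p.arrs ++ q.arrs
  | ite _ p q => p.arrs ++ q.arrs
  | .while _ p => p.arrs

/-- `s` and `s'` agree outside the memory that `p` may write to. -/
structure Frame (p : Prog) (s s' : State) : Prop where
  reg : ∀ x, x ∉ p.regs → s'.reg x = s.reg x
  arr : ∀ a, a ∉ p.arrs → s'.arr a = s.arr a

theorem Frame.refl (p : Prog) (s : State) : Frame p s s := ⟨fun _ _ => rfl, fun _ _ => rfl⟩

theorem Frame.trans {p : Prog} {s s' s'' : State} (h : Frame p s s') (h' : Frame p s' s'') :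
    Frame p s s'' :=
  ⟨fun x hx => (h'.reg x hx).trans (h.reg x hx), fun a ha => (h'.arr a ha).trans (h.arr a ha)⟩

theorem Frame.mono {p q : Prog} {s s' : State} (h : Frame p s s') (hr : p.regs ⊆ q.regs)
    (ha : p.arrs ⊆ q.arrs) : Frame q s s' :=
  ⟨fun x hx => h.reg x fun h' => hx (hr h'), fun a h' => h.arr a fun h'' => h' (ha h'')⟩

theorem Exec.frame {p : Prog} {s s' : State} {t : ℕ} (h : Exec p s t s') : Frame p s s' := by
  induction h with
  | op o s =>
    constructor
    · intro x hx
      cases o <;> simp_all [Op.apply, Prog.regs, Op.regs]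
    · intro a ha
      cases o <;> simp_all [Op.apply, Prog.arrs, Op.arrs]
  | seq _ _ ih ih' =>
    exact (ih.mono (List.subset_append_left _ _) (List.subset_append_left _ _)).trans
      (ih'.mono (List.subset_append_right _ _) (List.subset_append_right _ _))
  | ite_true _ _ ih => exact ih.mono (List.subset_append_left _ _) (List.subset_append_left _ _)
  | ite_false _ _ ih => exact ih.mono (List.subset_append_right _ _) (List.subset_append_right _ _)
  | while_true _ _ _ ih ih' =>
    exact Frame.trans (p := .while _ _) ⟨ih.reg, ih.arr⟩ ih'
  | while_false _ => exact Frame.refl _ _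

/-- Started in `s` with the clock showing `c`, the program halts in a state and with a clock that
satisfy `Q`. -/
def wp (p : Prog) (Q : State → ℕ → Prop) (s : State) (c : ℕ) : Prop :=
  ∃ t s', Exec p s t s' ∧ Q s' (c + t)

theorem wp_mono {p : Prog} {Q Q' : State → ℕ → Prop} {s : State} {c : ℕ} (h : wp p Q s c)
    (hQ : ∀ s' c', Frame p s s' → Q s' c' → Q' s' c') : wp p Q' s c := by
  obtain ⟨t, s', he, hq⟩ := h
  exact ⟨t, s', he, hQ _ _ he.frame hq⟩

theorem wp_op {o : Op} {Q : State → ℕ → Prop} {s : State} {c : ℕ} :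
    wp (.op o) Q s c ↔ Q (o.apply s) (c + 1) := by
  constructor
  · rintro ⟨t, s', he, hq⟩
    cases he
    exact hq
  · exact fun h => ⟨1, _, .op o s, h⟩

theorem wp_seq {p q : Prog} {Q : State → ℕ → Prop} {s : State} {c : ℕ} :
    wp (p ;; q) Q s c ↔ wp p (wp q Q) s c := by
  constructor
  · rintro ⟨t, s', he, hq⟩
    cases he with
    | seq h1 h2 => exact ⟨_, _, h1, _, _, h2, by rwa [add_assoc]⟩
  · rintro ⟨t, s', h1, t', s'', h2, hq⟩
    exact ⟨_, _, .seq h1 h2, by rwa [← add_assoc]⟩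

theorem wp_ite {b : Test} {p q : Prog} {Q : State → ℕ → Prop} {s : State} {c : ℕ} :
    wp (.ite b p q) Q s c ↔
      (b.Holds s → wp p Q s (c + 1)) ∧ (¬ b.Holds s → wp q Q s (c + 1)) := by
  constructor
  · rintro ⟨t, s', he, hq⟩
    cases he with
    | ite_true hb h =>
      exact ⟨fun _ => ⟨_, _, h, by rwa [add_right_comm, add_assoc]⟩, fun h' => absurd hb h'⟩
    | ite_false hb h =>
      exact ⟨fun h' => absurd h' hb, fun _ => ⟨_, _, h, by rwa [add_right_comm, add_assoc]⟩⟩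
  · rintro ⟨h1, h2⟩
    by_cases hb : b.Holds s
    · obtain ⟨t, s', h, hq⟩ := h1 hb
      exact ⟨_, _, .ite_true hb h, by rwa [← add_assoc, add_right_comm]⟩
    · obtain ⟨t, s', h, hq⟩ := h2 hb
      exact ⟨_, _, .ite_false hb h, by rwa [← add_assoc, add_right_comm]⟩

/-- Each round may use that the state agrees with the initial one outside the memory written by the
body, so invariants need not mention unchanged registers and arrays. The clock is part of the
invariant; the variant μ serves termination only. -/
theorem wp_while {b : Test} {p : Prog} (I : State → ℕ → Prop) (μ : State → ℕ)
    {Q : State → ℕ → Prop} {s : State} {c : ℕ} (h0 : I s c)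
    (hstep : ∀ s' c', Frame p s s' → I s' c' → b.Holds s' →
      wp p (fun s'' c'' => I s'' c'' ∧ μ s'' < μ s') s' (c' + 1))
    (hend : ∀ s' c', Frame p s s' → I s' c' → ¬ b.Holds s' → Q s' (c' + 1)) :
    wp (.while b p) Q s c := by
  have key : ∀ (m : ℕ) (s' : State) (c' : ℕ), μ s' = m → Frame p s s' → I s' c' →
      wp (.while b p) Q s' c' := by
    intro m
    induction m using Nat.strong_induction_on with
    | _ m ih =>
    intro s' c' hm hF hI
    by_cases hb : b.Holds s'
    · obtain ⟨t, s'', he, hI', hμ⟩ := hstep s' c' hF hI hb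
      obtain ⟨t', s₃, he', hq⟩ := ih (μ s'') (hm ▸ hμ) s'' _ rfl (hF.trans he.frame) hI'
      exact ⟨_, _, .while_true hb he he', by convert hq using 1; omega⟩
    · exact ⟨1, s', .while_false hb, hend s' c' hF hI hb⟩
  exact key _ s c rfl (Frame.refl _ _) h0

/-- Loops with a known number of rounds. -/
theorem wp_for {b : Test} {p : Prog} (I : ℕ → State → ℕ → Prop) {k N : ℕ}
    {Q : State → ℕ → Prop} {s : State} {c : ℕ} (hk : k ≤ N) (h0 : I k s c)
    (htest : ∀ i s' c', Frame p s s' → I i s' c' → (b.Holds s' ↔ i < N))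
    (hstep : ∀ i s' c', k ≤ i → i < N → Frame p s s' → I i s' c' → wp p (I (i + 1)) s' (c' + 1))
    (hend : ∀ s' c', Frame p s s' → I N s' c' → Q s' (c' + 1)) :
    wp (.while b p) Q s c := by
  have key : ∀ (m i : ℕ) (s' : State) (c' : ℕ), N = i + m → k ≤ i → Frame p s s' → I i s' c' →
      wp (.while b p) Q s' c' := by
    intro m
    induction m with
    | zero =>
      intro i s' c' hm hki hF hI
      obtain rfl : i = N := by omega
      have hb : ¬ b.Holds s' := by rw [htest i s' c' hF hI]; omega
      exact ⟨1, s', .while_false hb, hend s' c' hF hI⟩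
    | succ m ih =>
      intro i s' c' hm hki hF hI
      have hb : b.Holds s' := by rw [htest i s' c' hF hI]; omega
      obtain ⟨t, s'', he, hI'⟩ := hstep i s' c' hki (by omega) hF hI
      obtain ⟨t', s₃, he', hq⟩ := ih (i + 1) s'' _ (by omega) (by omega) (hF.trans he.frame) hI'
      exact ⟨_, _, .while_true hb he he', by convert hq using 1; omega⟩
  exact key (N - k) k s c (by omega) le_rfl (Frame.refl _ _) h0

/-! ### Adjacency lists -/

/-- `off` and `adj` are adjacency lists of the graph `H` on `{0, …, n - 1}`. -/
structure AdjLists (n : ℕ) (H : SimpleGraph ℕ) (off adj : ℕ → ℕ) : Prop where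
  lt : ∀ v w, H.Adj v w → v < n ∧ w < n
  off_mono : ∀ v < n, off v ≤ off (v + 1)
  bijOn : ∀ v < n, Set.BijOn adj (Set.Ico (off v) (off (v + 1))) {w | H.Adj v w}

open Classical in
/-- The neighbours of `v`. -/
noncomputable def nbrs (n : ℕ) (H : SimpleGraph ℕ) (v : ℕ) : Finset ℕ :=
  (Finset.range n).filter (H.Adj v)

theorem AdjLists.mem_nbrs {n : ℕ} {H : SimpleGraph ℕ} {off adj : ℕ → ℕ}
    (hG : AdjLists n H off adj) {v w : ℕ} : w ∈ nbrs n H v ↔ H.Adj v w := by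
  classical
  unfold nbrs
  rw [Finset.mem_filter, Finset.mem_range]
  exact ⟨fun h => h.2, fun h => ⟨(hG.lt v w h).2, h⟩⟩

/-- For all neighbours `x` of the vertex in register `v`, with `x` in register `15`. -/
def nbrLoop (v : ℕ) (body : Prog) : Prog :=
  .op (.load 13 0 v) ;; .op (.copy 14 v) ;; .op (.succ 14) ;; .op (.load 14 0 14) ;;
    .while (.lt 13 14) (.op (.load 15 1 13) ;; .op (.succ 13) ;; body)

/-- The invariant is indexed by the set of neighbours already visited instead of the cursor, which
hides the layout of the adjacency lists. The offset 4 is the set-up; the 3 in each round are the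
test, the load and the increment. -/
theorem wp_nbrLoop {n : ℕ} {H : SimpleGraph ℕ} {off adj : ℕ → ℕ} (hG : AdjLists n H off adj)
    {rv v : ℕ} {body : Prog} {Q : State → ℕ → Prop} {s : State} {c : ℕ}
    (hoff : s.arr 0 = off) (hadj : s.arr 1 = adj) (hrv : s.reg rv = v) (hv : v < n) (hrv' : rv ≠ 13)
    (hregs : 13 ∉ body.regs ∧ 14 ∉ body.regs) (harrs : 0 ∉ body.arrs ∧ 1 ∉ body.arrs)
    (I : Finset ℕ → State → ℕ → Prop)
    (h0 : ∀ j j', I ∅ ⟨Function.update (Function.update s.reg 13 j) 14 j', s.arr⟩ (c + 4))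
    (hstep : ∀ P w s' c' j, H.Adj v w → w ∉ P → P ⊆ nbrs n H v → Frame (nbrLoop rv body) s s' →
      I P s' c' → wp body (I (insert w P))
        ⟨Function.update (Function.update s'.reg 15 w) 13 j, s'.arr⟩ (c' + 3))
    (hend : ∀ s' c', Frame (nbrLoop rv body) s s' → I (nbrs n H v) s' c' → Q s' (c' + 1)) :
    wp (nbrLoop rv body) Q s c := by
  subst hoff hadj
  have hbij := hG.bijOn v hv
  have hF0 : ∀ {j j' : ℕ} {s' : State}, Frame (.op (.load 15 1 13) ;; .op (.succ 13) ;; body)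
      ⟨Function.update (Function.update s.reg 13 j) 14 j', s.arr⟩ s' →
      Frame (nbrLoop rv body) s s' := by
    intro j j' s' hF
    refine Frame.trans (s' := ⟨Function.update (Function.update s.reg 13 j) 14 j', s.arr⟩) ?_
      (hF.mono ?_ ?_)
    · constructor
      · intro x hx
        simp only [nbrLoop, Prog.regs, Op.regs, List.mem_append, List.mem_singleton, not_or] at hx
        change Function.update (Function.update s.reg 13 j) 14 j' x = s.reg x
        rw [Function.update_of_ne (by tauto), Function.update_of_ne (by tauto)]
      · intro a ha
        rfl
    · simp only [nbrLoop, Prog.regs]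
      intro x hx
      simp only [List.mem_append] at hx ⊢
      tauto
    · simp only [nbrLoop, Prog.arrs]
      intro x hx
      simp only [List.mem_append] at hx ⊢
      tauto
  have himg : ∀ k, k ≤ s.arr 0 (v + 1) →
      (Finset.Ico (s.arr 0 v) k).image (s.arr 1) ⊆ nbrs n H v := by
    intro k hk w hw
    obtain ⟨i, hi, rfl⟩ := Finset.mem_image.1 hw
    rw [Finset.mem_Ico] at hi
    exact hG.mem_nbrs.2 (hbij.mapsTo ⟨hi.1, by omega⟩)
  simp only [nbrLoop, wp_seq, wp_op, Op.apply]
  rw [Function.update_of_ne hrv', Function.update_self, Function.update_idem, Function.update_self,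
    Function.update_idem, hrv]
  refine wp_for (fun k s' c' => s'.reg 13 = k ∧ s'.reg 14 = s.arr 0 (v + 1) ∧
      I ((Finset.Ico (s.arr 0 v) k).image (s.arr 1)) s' c') (k := s.arr 0 v)
      (N := s.arr 0 (v + 1)) (hG.off_mono v hv) ?_ ?_ ?_ ?_
  · refine ⟨by simp, by simp, ?_⟩
    simpa using h0 _ _
  · intro i s' c' _ hI
    simp only [Test.Holds, hI.1, hI.2.1]
  · intro i s' c' hvi hi hF hI
    have hF' := hF0 hF
    have harr0 : s'.arr 1 = s.arr 1 := by
      refine hF.arr 1 ?_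
      simp [Prog.arrs, Op.arrs, harrs]
    have hwadj : H.Adj v (s.arr 1 i) := hbij.mapsTo ⟨hvi, hi⟩
    simp only [wp_seq, wp_op, Op.apply]
    rw [hI.1, harr0, Function.update_of_ne (by norm_num : (13 : ℕ) ≠ 15), hI.1]
    refine wp_mono (hstep _ _ s' c' (i + 1) hwadj ?_ (himg i (by omega)) hF' hI.2.2) ?_
    · intro hmem
      obtain ⟨i', hi', heq⟩ := Finset.mem_image.1 hmem
      rw [Finset.mem_Ico] at hi'
      have := hbij.injOn ⟨hi'.1, by omega⟩ ⟨hvi, hi⟩ heq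
      omega
    · intro s'' c'' hF'' hI''
      refine ⟨?_, ?_, ?_⟩
      · rw [hF''.reg 13 hregs.1]; simp
      · rw [hF''.reg 14 hregs.2]; simp [hI.2.1]
      · rw [← Finset.insert_Ico_right_eq_Ico_add_one hvi, Finset.image_insert]
        exact hI''
  · intro s' c' hF hI
    refine hend s' c' (hF0 hF) ?_
    convert hI.2.2 using 1
    ext w
    rw [hG.mem_nbrs]
    constructor
    · intro hw
      obtain ⟨i, hi, hiw⟩ := hbij.surjOn hw
      exact Finset.mem_image.2 ⟨i, by simpa using hi, hiw⟩
    · intro hw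
      exact hG.mem_nbrs.1 (himg _ le_rfl hw)

end RAM

/-! ### Breadth-first search: the invariant -/

namespace RAM

/-- `z` is a vertex of least degree in the last layer of its component. -/
def IsBest (n : ℕ) (H : SimpleGraph ℕ) (D : ℕ → ℕ) (z : ℕ) : Prop :=
  ∀ x, H.Reachable z x →
    D x ≠ 0 ∧ D x ≤ D z ∧ (D x = D z → (nbrs n H z).card ≤ (nbrs n H x).card)

/-- The queue is `Q 0, …, Q (qt - 1)`, its head is at `qh`. The component of `s` is being searched;
it starts at position `q0` of the queue and at level `dn`. The vertices `B 0, …, B (nb - 1)` are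
the best ones of the components that have been finished. -/
structure BfsInv (n : ℕ) (H : SimpleGraph ℕ) (src roots : Set ℕ) (s q0 dn : ℕ) (D Q : ℕ → ℕ)
    (qh qt : ℕ) (B : ℕ → ℕ) (nb : ℕ) : Prop where
  start_le : q0 ≤ qh
  head_le : qh ≤ qt
  nb_le : nb ≤ q0
  mem : ∀ i < qt, Q i < n ∧ D (Q i) ≠ 0
  inj : ∀ i < qt, ∀ j < qt, Q i = Q j → i = j
  surj : ∀ x, D x ≠ 0 → ∃ i < qt, Q i = x
  sorted : ∀ i j, i ≤ j → j < qt → D (Q i) ≤ D (Q j)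
  -- Bounds levels by n in the end, so that they can serve as keys of a counting sort.
  level_le : ∀ i < qt, D (Q i) ≤ i + 1
  window : ∀ j < qt, qh < qt → D (Q j) ≤ D (Q qh) + 1
  done : ∀ i < qh, ∀ y, H.Adj (Q i) y → D y ≠ 0 ∧ D y ≤ D (Q i) + 1
  parent : ∀ x, D x ≠ 0 → x ∈ roots ∨ ∃ y, H.Adj x y ∧ D y ≠ 0 ∧ D x = D y + 1
  same : ∀ x y, D x ≠ 0 → D x = D y → H.Reachable x y
  roots_src : ∀ x ∈ roots, x ∈ src ∧ D x ≠ 0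
  roots_unique : ∀ x ∈ roots, ∀ y ∈ roots, H.Reachable x y → x = y
  old : ∀ i < q0, D (Q i) < dn
  cur : ∀ i, q0 ≤ i → i < qt → dn ≤ D (Q i) ∧ H.Reachable s (Q i)
  best : ∀ k < nb, IsBest n H D (B k)
  cover : ∀ i < q0, ∃ k < nb, H.Reachable (B k) (Q i)

namespace BfsInv

variable {n : ℕ} {H : SimpleGraph ℕ} {src roots : Set ℕ} {s q0 dn : ℕ} {D Q : ℕ → ℕ}
  {qh qt : ℕ} {B : ℕ → ℕ} {nb : ℕ}

theorem tail_le (h : BfsInv n H src roots s q0 dn D Q qh qt B nb) : qt ≤ n := by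
  have := Finset.card_le_card_of_injOn (s := Finset.range qt) (t := Finset.range n) Q
    (fun i hi => by simpa using (h.mem i (by simpa using hi)).1)
    (fun i hi j hj hij => h.inj i (by simpa using hi) j (by simpa using hj) hij)
  simpa using this

theorem empty (hD : ∀ x, D x = 0) : BfsInv n H src ∅ 0 0 0 D Q 0 0 B 0 := by
  constructor <;> simp [hD]

/-- Visiting a new neighbour of the head of the queue. -/
theorem visit (h : BfsInv n H src roots s q0 dn D Q qh qt B nb) (hq : qh < qt) {x : ℕ}
    (hx : H.Adj (Q qh) x) (hxn : x < n) (hDx : D x = 0) :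
    BfsInv n H src roots s q0 dn (Function.update D x (D (Q qh) + 1)) (Function.update Q qt x)
      qh (qt + 1) B nb := by
  obtain ⟨D', hD'⟩ : ∃ D', D' = Function.update D x (D (Q qh) + 1) := ⟨_, rfl⟩
  obtain ⟨Q', hQ'⟩ : ∃ Q', Q' = Function.update Q qt x := ⟨_, rfl⟩
  have eQ : ∀ i < qt, Q' i = Q i := fun i hi => by
    rw [hQ', Function.update_of_ne (by omega)]
  have eQx : Q' qt = x := by rw [hQ', Function.update_self]
  have eD : ∀ y, D y ≠ 0 → D' y = D y := fun y hy => by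
    rw [hD', Function.update_of_ne]
    rintro rfl
    exact hy hDx
  have eDx : D' x = D (Q qh) + 1 := by rw [hD', Function.update_self]
  have eD0 : ∀ y, D' y ≠ 0 → y = x ∨ D y ≠ 0 ∧ D' y = D y := fun y hy => by
    by_cases hyx : y = x
    · exact Or.inl hyx
    · rw [hD', Function.update_of_ne hyx] at hy ⊢
      exact Or.inr ⟨hy, rfl⟩
  have eDQ : ∀ i < qt, D' (Q' i) = D (Q i) := fun i hi => by
    rw [eQ i hi, eD _ (h.mem i hi).2]
  have eDQx : D' (Q' qt) = D (Q qh) + 1 := by rw [eQx, eDx]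
  have hsplit : ∀ i, i < qt + 1 → i < qt ∨ i = qt := fun i hi => by omega
  rw [← hD', ← hQ']
  have hcurh := h.cur qh h.start_le hq
  have hsx : H.Reachable s x := hcurh.2.trans hx.reachable
  -- Finished components only have levels below dn, which is at most the level of the head, so equal
  -- levels still imply the same component.
  have hlow : ∀ y, D y ≠ 0 → D y = D (Q qh) + 1 → H.Reachable s y := by
    intro y hy hyd
    obtain ⟨j, hj, rfl⟩ := h.surj y hy
    by_cases hjq : j < q0
    · have := h.old j hjq
      omega
    · exact (h.cur j (by omega) hj).2
  refine
    { start_le := h.start_le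
      head_le := by have := h.head_le; omega
      nb_le := h.nb_le
      mem := ?_, inj := ?_, surj := ?_, sorted := ?_, level_le := ?_, window := ?_, done := ?_
      parent := ?_, same := ?_
      roots_src := fun r hr => ⟨(h.roots_src r hr).1, by
        rw [eD _ (h.roots_src r hr).2]; exact (h.roots_src r hr).2⟩
      roots_unique := h.roots_unique
      old := ?_, cur := ?_, best := ?_, cover := ?_ }
  · intro i hi
    rcases hsplit i hi with hi | rfl
    · rw [eDQ i hi, eQ i hi]; exact h.mem i hi
    · rw [eDQx, eQx]; exact ⟨hxn, by omega⟩
  · intro i hi j hj hij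
    rcases hsplit i hi with hi | rfl <;> rcases hsplit j hj with hj | rfl
    · rw [eQ i hi, eQ j hj] at hij; exact h.inj i hi j hj hij
    · rw [eQ i hi, eQx] at hij
      exact absurd (hij ▸ hDx) (h.mem i hi).2
    · rw [eQ j hj, eQx] at hij
      exact absurd (hij ▸ hDx) (h.mem j hj).2
    · rfl
  · intro y hy
    rcases eD0 y hy with rfl | ⟨hy', -⟩
    · exact ⟨qt, by omega, eQx⟩
    · obtain ⟨i, hi, rfl⟩ := h.surj y hy'
      exact ⟨i, by omega, eQ i hi⟩
  · intro i j hij hj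
    rcases hsplit j hj with hj | rfl
    · rw [eDQ i (by omega), eDQ j hj]; exact h.sorted i j hij hj
    · rw [eDQx]
      rcases hsplit i (by omega) with hi | rfl
      · rw [eDQ i hi]; exact h.window i hi hq
      · rw [eDQx]
  · intro i hi
    rcases hsplit i hi with hi | rfl
    · rw [eDQ i hi]; exact h.level_le i hi
    · rw [eDQx]
      have := h.level_le qh hq
      omega
  · intro j hj _
    rw [eDQ qh hq]
    rcases hsplit j hj with hj | rfl
    · rw [eDQ j hj]; exact h.window j hj hq
    · rw [eDQx]
  · intro i hi y hy
    have hiq : i < qt := by have := h.head_le; omega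
    rw [eQ i hiq] at hy
    have := h.done i hi y hy
    rw [eDQ i hiq, eD y this.1]
    exact this
  · intro y hy
    rcases eD0 y hy with rfl | ⟨hy', hey⟩
    · refine Or.inr ⟨Q qh, hx.symm, ?_⟩
      rw [eD _ (h.mem qh hq).2, eDx]
      exact ⟨(h.mem qh hq).2, rfl⟩
    · rcases h.parent y hy' with hr | ⟨w, hw, hw0, hwD⟩
      · exact Or.inl hr
      · exact Or.inr ⟨w, hw, by rw [eD w hw0]; exact hw0, by rw [hey, eD w hw0]; exact hwD⟩
  · intro y w hy hyw
    have hw : D' w ≠ 0 := by rw [← hyw]; exact hy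
    rcases eD0 y hy with rfl | ⟨hy', hey⟩ <;> rcases eD0 w hw with rfl | ⟨hw', hew⟩
    · exact SimpleGraph.Reachable.refl _
    · exact hsx.symm.trans (hlow w hw' (by rw [← hew, ← hyw, eDx]))
    · exact (hlow y hy' (by rw [← hey, hyw, eDx])).symm.trans hsx
    · exact h.same y w hy' (by rw [← hey, ← hew, hyw])
  · intro i hi
    have hiq : i < qt := by have := h.head_le; have := h.start_le; omega
    rw [eDQ i hiq]
    exact h.old i hi
  · intro i hi0 hi
    rcases hsplit i hi with hi | rfl
    · rw [eDQ i hi, eQ i hi]; exact h.cur i hi0 hi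
    · rw [eDQx, eQx]
      exact ⟨by omega, hsx⟩
  · intro k hk y hy
    have hb := h.best k hk y hy
    have hb' := h.best k hk (B k) (SimpleGraph.Reachable.refl _)
    rw [eD y hb.1, eD _ hb'.1]
    exact hb
  · intro i hi
    have hiq : i < qt := by have := h.head_le; have := h.start_le; omega
    rw [eQ i hiq]
    exact h.cover i hi

/-- The head of the queue has been processed. -/
theorem advance (h : BfsInv n H src roots s q0 dn D Q qh qt B nb) (hq : qh < qt)
    (hdone : ∀ y, H.Adj (Q qh) y → D y ≠ 0 ∧ D y ≤ D (Q qh) + 1) :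
    BfsInv n H src roots s q0 dn D Q (qh + 1) qt B nb :=
  { h with
    start_le := by have := h.start_le; omega
    head_le := hq
    window := fun j hj hq' => by
      have h1 := h.window j hj hq
      have h2 := h.sorted qh (qh + 1) (by omega) hq'
      omega
    done := fun i hi y hy => by
      rcases (show i < qh ∨ i = qh by omega) with hi | rfl
      · exact h.done i hi y hy
      · exact hdone y hy }

/-- With the head at the tail, every visited vertex has been processed, so the visited set is closed
under adjacency. -/
theorem reachable (h : BfsInv n H src roots s q0 dn D Q qt qt B nb) {x y : ℕ} (hx : D x ≠ 0)
    (hxy : H.Reachable x y) : D y ≠ 0 := by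
  obtain ⟨p⟩ := hxy
  induction p with
  | nil => exact hx
  | cons hadj p ih =>
    apply ih
    obtain ⟨i, hi, rfl⟩ := h.surj _ hx
    exact (h.done i hi _ hadj).1

/-- Starting the search of a new component. -/
theorem newRoot (h : BfsInv n H src roots s qt dn D Q qt qt B nb) {x : ℕ} (hxn : x < n)
    (hDx : D x = 0) (hsrc : x ∈ src) (hdn : 1 ≤ dn) (hdn' : dn ≤ qt + 1) :
    BfsInv n H src (insert x roots) x qt dn (Function.update D x dn) (Function.update Q qt x)
      qt (qt + 1) B nb := by
  obtain ⟨D', hD'⟩ : ∃ D', D' = Function.update D x dn := ⟨_, rfl⟩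
  obtain ⟨Q', hQ'⟩ : ∃ Q', Q' = Function.update Q qt x := ⟨_, rfl⟩
  have eQ : ∀ i < qt, Q' i = Q i := fun i hi => by
    rw [hQ', Function.update_of_ne (by omega)]
  have eQx : Q' qt = x := by rw [hQ', Function.update_self]
  have eD : ∀ y, D y ≠ 0 → D' y = D y := fun y hy => by
    rw [hD', Function.update_of_ne]
    rintro rfl
    exact hy hDx
  have eDx : D' x = dn := by rw [hD', Function.update_self]
  have eD0 : ∀ y, D' y ≠ 0 → y = x ∨ D y ≠ 0 ∧ D' y = D y := fun y hy => by
    by_cases hyx : y = x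
    · exact Or.inl hyx
    · rw [hD', Function.update_of_ne hyx] at hy ⊢
      exact Or.inr ⟨hy, rfl⟩
  have eDQ : ∀ i < qt, D' (Q' i) = D (Q i) := fun i hi => by
    rw [eQ i hi, eD _ (h.mem i hi).2]
  have eDQx : D' (Q' qt) = dn := by rw [eQx, eDx]
  have hsplit : ∀ i, i < qt + 1 → i < qt ∨ i = qt := fun i hi => by omega
  have hold : ∀ y, D y ≠ 0 → D y < dn := fun y hy => by
    obtain ⟨i, hi, rfl⟩ := h.surj y hy
    exact h.old i hi
  rw [← hD', ← hQ']
  refine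
    { start_le := le_rfl
      head_le := by omega
      nb_le := h.nb_le
      mem := ?_, inj := ?_, surj := ?_, sorted := ?_, level_le := ?_, window := ?_, done := ?_
      parent := ?_, same := ?_, roots_src := ?_, roots_unique := ?_
      old := ?_, cur := ?_, best := ?_, cover := ?_ }
  · intro i hi
    rcases hsplit i hi with hi | rfl
    · rw [eDQ i hi, eQ i hi]; exact h.mem i hi
    · rw [eDQx, eQx]; exact ⟨hxn, by omega⟩
  · intro i hi j hj hij
    rcases hsplit i hi with hi | rfl <;> rcases hsplit j hj with hj | rfl
    · rw [eQ i hi, eQ j hj] at hij; exact h.inj i hi j hj hij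
    · rw [eQ i hi, eQx] at hij
      exact absurd (hij ▸ hDx) (h.mem i hi).2
    · rw [eQ j hj, eQx] at hij
      exact absurd (hij ▸ hDx) (h.mem j hj).2
    · rfl
  · intro y hy
    rcases eD0 y hy with rfl | ⟨hy', -⟩
    · exact ⟨qt, by omega, eQx⟩
    · obtain ⟨i, hi, rfl⟩ := h.surj y hy'
      exact ⟨i, by omega, eQ i hi⟩
  · intro i j hij hj
    rcases hsplit j hj with hj | rfl
    · rw [eDQ i (by omega), eDQ j hj]; exact h.sorted i j hij hj
    · rw [eDQx]
      rcases hsplit i (by omega) with hi | rfl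
      · rw [eDQ i hi]; exact (h.old i hi).le
      · rw [eDQx]
  · intro i hi
    rcases hsplit i hi with hi | rfl
    · rw [eDQ i hi]; exact h.level_le i hi
    · rw [eDQx]; exact hdn'
  · intro j hj _
    rw [eDQx]
    rcases hsplit j hj with hj | rfl
    · rw [eDQ j hj]; have := h.old j hj; omega
    · rw [eDQx]; omega
  · intro i hi y hy
    rw [eQ i hi] at hy
    have := h.done i hi y hy
    rw [eDQ i hi, eD y this.1]
    exact this
  · intro y hy
    rcases eD0 y hy with rfl | ⟨hy', hey⟩
    · exact Or.inl (Or.inl rfl)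
    · rcases h.parent y hy' with hr | ⟨w, hw, hw0, hwD⟩
      · exact Or.inl (Or.inr hr)
      · exact Or.inr ⟨w, hw, by rw [eD w hw0]; exact hw0, by rw [hey, eD w hw0]; exact hwD⟩
  · intro y w hy hyw
    have hw : D' w ≠ 0 := by rw [← hyw]; exact hy
    rcases eD0 y hy with rfl | ⟨hy', hey⟩ <;> rcases eD0 w hw with rfl | ⟨hw', hew⟩
    · exact SimpleGraph.Reachable.refl _
    · have := hold w hw'; omega
    · have := hold y hy'; omega
    · exact h.same y w hy' (by rw [← hey, ← hew, hyw])
  · rintro r (rfl | hr)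
    · exact ⟨hsrc, by omega⟩
    · rw [eD _ (h.roots_src r hr).2]; exact h.roots_src r hr
  · rintro a (rfl | ha) b (rfl | hb) hab
    · rfl
    · exact absurd hDx (h.reachable (h.roots_src b hb).2 hab.symm)
    · exact absurd hDx (h.reachable (h.roots_src a ha).2 hab)
    · exact h.roots_unique a ha b hb hab
  · intro i hi
    rw [eDQ i hi]
    exact h.old i hi
  · intro i hi0 hi
    obtain rfl : i = qt := by omega
    rw [eDQx, eQx]
    exact ⟨le_rfl, SimpleGraph.Reachable.refl _⟩
  · intro k hk y hy
    have hb := h.best k hk y hy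
    have hb' := h.best k hk (B k) (SimpleGraph.Reachable.refl _)
    rw [eD y hb.1, eD _ hb'.1]
    exact hb
  · intro i hi
    rw [eQ i hi]
    exact h.cover i hi

end BfsInv

/-- `z` is the best vertex of the current component found so far, and `m` bounds degrees. -/
structure CurBest (n : ℕ) (H : SimpleGraph ℕ) (q0 : ℕ) (D Q : ℕ → ℕ) (qh qt z m : ℕ) : Prop where
  pos : ∃ i, q0 ≤ i ∧ i ≤ qh ∧ i < qt ∧ z = Q i
  deg_le : (nbrs n H z).card ≤ m
  le : ∀ i, q0 ≤ i → i < qh → D (Q i) ≤ D z ∧ (D (Q i) = D z → m ≤ (nbrs n H (Q i)).card)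

namespace BfsInv

variable {n : ℕ} {H : SimpleGraph ℕ} {src roots : Set ℕ} {s q0 dn : ℕ} {D Q : ℕ → ℕ}
  {qh qt : ℕ} {B : ℕ → ℕ} {nb z m : ℕ}

/-- A component has been searched. -/
theorem finish (h : BfsInv n H src roots s q0 dn D Q qt qt B nb)
    (hb : CurBest n H q0 D Q qt qt z m) :
    BfsInv n H src roots s qt (D (Q (qt - 1)) + 1) D Q qt qt (Function.update B nb z) (nb + 1) := by
  obtain ⟨i0, hi0, -, hi0q, hz⟩ := hb.pos
  have hcurz := h.cur i0 hi0 hi0q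
  have eB : ∀ k < nb, Function.update B nb z k = B k := fun k hk => by
    rw [Function.update_of_ne (by omega)]
  exact
  { h with
    start_le := le_rfl
    nb_le := by have := h.nb_le; omega
    old := fun i hi => by have := h.sorted i (qt - 1) (by omega) (by omega); omega
    cur := fun i h1 h2 => by omega
    best := fun k hk => by
      rcases (show k < nb ∨ k = nb by omega) with hk | rfl
      · rw [eB k hk]; exact h.best k hk
      · rw [Function.update_self]
        intro x hx
        -- A vertex reachable from z has been visited. Entries of older components have smaller
        -- levels and need no comparison of degrees.
        have hx0 : D x ≠ 0 := h.reachable (hz ▸ (h.mem i0 hi0q).2) hx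
        obtain ⟨i, hi, rfl⟩ := h.surj x hx0
        refine ⟨hx0, ?_⟩
        by_cases hiq : i < q0
        · have := h.old i hiq
          rw [hz]
          exact ⟨by omega, by omega⟩
        · have := hb.le i (by omega) hi
          exact ⟨this.1, fun he => hb.deg_le.trans (this.2 he)⟩
    cover := fun i hi => by
      by_cases hiq : i < q0
      · obtain ⟨k, hk, hr⟩ := h.cover i hiq
        exact ⟨k, by omega, by rw [eB k hk]; exact hr⟩
      · refine ⟨nb, by omega, ?_⟩
        rw [Function.update_self, hz]
        exact hcurz.2.symm.trans (h.cur i (by omega) hi).2 }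

/-- Updating the best vertex. -/
theorem curBest_advance (h : BfsInv n H src roots s q0 dn D Q qh qt B nb) (hq : qh < qt)
    (hb : CurBest n H q0 D Q qh qt z m) :
    (D z < D (Q qh) ∨ (nbrs n H (Q qh)).card < m →
      CurBest n H q0 D Q (qh + 1) qt (Q qh) (nbrs n H (Q qh)).card) ∧
    (¬ D z < D (Q qh) → ¬ (nbrs n H (Q qh)).card < m →
      CurBest n H q0 D Q (qh + 1) qt z m) := by
  obtain ⟨i0, hi0, hi0h, hi0q, hz⟩ := hb.pos
  have hle : D z ≤ D (Q qh) := by rw [hz]; exact h.sorted i0 qh hi0h hq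
  constructor
  · intro hor
    refine ⟨⟨qh, h.start_le, by omega, hq, rfl⟩, le_rfl, fun i h1 h2 => ?_⟩
    rcases (show i < qh ∨ i = qh by omega) with hi | rfl
    · refine ⟨h.sorted i qh hi.le hq, fun he => ?_⟩
      have := hb.le i h1 hi
      have h3 := this.2 (by omega)
      omega
    · exact ⟨le_rfl, fun _ => le_rfl⟩
  · intro h1 h2
    refine ⟨⟨i0, hi0, by omega, hi0q, hz⟩, hb.deg_le, fun i h3 h4 => ?_⟩
    rcases (show i < qh ∨ i = qh by omega) with hi | rfl
    · exact hb.le i h3 hi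
    · exact ⟨by omega, fun _ => by omega⟩

end BfsInv

end RAM

/-! ### Breadth-first search: the program -/

namespace RAM

/-- A program without effect. -/
def nop : Prog := .op (.copy 16 16)

/-- Visit the neighbour in register `15`. -/
def bfsVisit (Q D : ℕ) : Prog :=
  .op (.succ 12) ;; .op (.load 16 D 15) ;;
    .ite (.eq 16 18) (.op (.store D 15 11) ;; .op (.store Q 4 15) ;; .op (.succ 4)) nop

/-- Process the head of the queue. -/
def bfsStep (Q D : ℕ) : Prog :=
  .op (.load 9 Q 3) ;; .op (.succ 3) ;; .op (.load 10 D 9) ;; .op (.copy 11 10) ;;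
    .op (.succ 11) ;; .op (.const 12 0) ;; nbrLoop 9 (bfsVisit Q D) ;; .op (.load 16 D 7) ;;
    .ite (.lt 16 10) (.op (.copy 7 9) ;; .op (.copy 8 12))
      (.ite (.lt 12 8) (.op (.copy 7 9) ;; .op (.copy 8 12)) nop)

/-- Search the component of the vertex in register `5`. -/
def bfsComponent (Q D B : ℕ) : Prog :=
  .op (.store D 5 6) ;; .op (.store Q 4 5) ;; .op (.succ 4) ;; .op (.copy 7 5) ;;
    .op (.copy 8 0) ;; .while (.lt 3 4) (bfsStep Q D) ;; .op (.copy 6 10) ;; .op (.succ 6) ;;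
    .op (.store B 17 7) ;; .op (.succ 17)

/-- Search the graph from the sources listed in the array `S`, their number being in register `1`.
The levels are written to `D`, the best vertices of the components to `B`, their number to
register `17`. -/
def bfs (S Q D B : ℕ) : Prog :=
  .op (.const 2 0) ;; .op (.const 3 0) ;; .op (.const 4 0) ;; .op (.const 6 1) ;;
    .op (.const 17 0) ;;
    .while (.lt 2 1) (.op (.load 5 S 2) ;; .op (.succ 2) ;; .op (.load 16 D 5) ;;
      .ite (.eq 16 18) (bfsComponent Q D B) nop)

theorem CurBest.congr {n : ℕ} {H : SimpleGraph ℕ} {q0 : ℕ} {D Q D' Q' : ℕ → ℕ} {qh qt qt' z m : ℕ}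
    (h : CurBest n H q0 D Q qh qt z m) (hqt : qt ≤ qt') (hh : qh ≤ qt)
    (hQ : ∀ i < qt, Q' i = Q i ∧ D' (Q i) = D (Q i)) : CurBest n H q0 D' Q' qh qt' z m := by
  obtain ⟨i0, hi0, hi0h, hi0q, hz⟩ := h.pos
  refine ⟨⟨i0, hi0, hi0h, by omega, by rw [hz, (hQ i0 hi0q).1]⟩, h.deg_le, fun i h1 h2 => ?_⟩
  have hDz : D' z = D z := by rw [hz, (hQ i0 hi0q).2]
  rw [hDz, (hQ i (by omega)).1, (hQ i (by omega)).2]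
  exact h.le i h1 h2

section

variable {n : ℕ} {H : SimpleGraph ℕ} {off adj : ℕ → ℕ} {S Q D B : ℕ}

/-- The arrays used by `bfs` are different. -/
structure BfsArrays (S Q D B : ℕ) : Prop where
  hQ : 2 < Q
  hD : 2 < D
  hB : 2 < B
  QD : Q ≠ D
  QB : Q ≠ B
  DB : D ≠ B
  SQ : S ≠ Q
  SD : S ≠ D
  SB : S ≠ B

/-- Register 12 counts the neighbours met, so after the loop it holds the degree of the head, ready
for comparison with the best vertex so far. -/
theorem wp_bfsStep (hG : AdjLists n H off adj) (ha : BfsArrays S Q D B) {s : State} {c : ℕ}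
    (hoff : s.arr 0 = off) (hadj : s.arr 1 = adj) (hzero : s.reg 18 = 0)
    {src roots : Set ℕ} {r q0 dn qh qt nb : ℕ} {Bf : ℕ → ℕ} (hh : s.reg 3 = qh) (ht : s.reg 4 = qt)
    (hlt : qh < qt)
    (hinv : BfsInv n H src roots r q0 dn (s.arr D) (s.arr Q) qh qt Bf nb)
    (hbest : CurBest n H q0 (s.arr D) (s.arr Q) qh qt (s.reg 7) (s.reg 8)) :
    wp (bfsStep Q D) (fun s' c' => s'.reg 3 = qh + 1 ∧ qt ≤ s'.reg 4 ∧
      BfsInv n H src roots r q0 dn (s'.arr D) (s'.arr Q) (qh + 1) (s'.reg 4) Bf nb ∧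
      CurBest n H q0 (s'.arr D) (s'.arr Q) (qh + 1) (s'.reg 4) (s'.reg 7) (s'.reg 8) ∧
      s'.reg 10 = s'.arr D (s'.arr Q qh) ∧
      (∀ i < qt, s'.arr Q i = s.arr Q i) ∧
      c' ≤ c + 20 + 10 * (nbrs n H (s.arr Q qh)).card) s c := by
  obtain ⟨w, hw⟩ : ∃ w, w = s.arr Q qh := ⟨_, rfl⟩
  have hwn : w < n := by rw [hw]; exact (hinv.mem qh hlt).1
  have h0D : (0 : ℕ) ≠ D := by have := ha.hD; omega
  have h1D : (1 : ℕ) ≠ D := by have := ha.hD; omega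
  have h0Q : (0 : ℕ) ≠ Q := by have := ha.hQ; omega
  have h1Q : (1 : ℕ) ≠ Q := by have := ha.hQ; omega
  simp only [bfsStep, wp_seq, wp_op, Op.apply, ne_eq, Nat.reduceEqDiff,
    not_false_eq_true, Function.update_self, Function.update_of_ne, hh, ← hw]
  refine wp_nbrLoop hG (v := w) hoff hadj (by simp) hwn (by norm_num)
    (by simp [bfsVisit, nop, Prog.regs, Op.regs])
    (by simp [bfsVisit, nop, Prog.arrs, Op.arrs, h0D, h1D, h0Q, h1Q])
    (fun P s' c' => qt ≤ s'.reg 4 ∧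
      BfsInv n H src roots r q0 dn (s'.arr D) (s'.arr Q) qh (s'.reg 4) Bf nb ∧
      (∀ i < qt, s'.arr Q i = s.arr Q i ∧ s'.arr D (s.arr Q i) = s.arr D (s.arr Q i)) ∧
      s'.reg 12 = P.card ∧ (∀ y ∈ P, s'.arr D y ≠ 0 ∧ s'.arr D y ≤ s.arr D w + 1) ∧
      c' ≤ c + 10 + 10 * P.card) ?_ ?_ ?_
  · intro j j'
    simp [ht, hinv]
  · intro P x s' c' j hx hxP hPsub hF hI
    obtain ⟨hq, hinv', hold, h12, hP, hc⟩ := hI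
    have r11 : s'.reg 11 = s.arr D w + 1 := by
      rw [hF.reg 11 (by simp [nbrLoop, bfsVisit, nop, Prog.regs, Op.regs])]; simp
    have r18 : s'.reg 18 = 0 := by
      rw [hF.reg 18 (by simp [nbrLoop, bfsVisit, nop, Prog.regs, Op.regs])]; simp [hzero]
    have hxn : x < n := (hG.lt _ _ hx).2
    have hw' : s'.arr Q qh = w := by rw [(hold qh hlt).1, hw]
    have hDw : s'.arr D w = s.arr D w := by rw [hw]; exact (hold qh hlt).2
    simp only [bfsVisit, nop, wp_seq, wp_op, wp_ite, Op.apply, Test.Holds, ne_eq, Nat.reduceEqDiff,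
      not_false_eq_true, Function.update_self, Function.update_of_ne, r11, r18]
    constructor
    · intro hDx
      have hv := hinv'.visit (by omega) (by rw [hw']; exact hx) hxn hDx
      rw [hw', hDw] at hv
      simp only [ha.QD, ha.QD.symm, ne_eq, not_false_eq_true, Function.update_self,
        Function.update_of_ne, Finset.card_insert_of_notMem hxP]
      refine ⟨by omega, hv, ?_, by omega, ?_, by omega⟩
      · intro i hi
        rw [Function.update_of_ne (by omega), Function.update_of_ne]
        · exact hold i hi
        · rintro rfl
          rw [(hold i hi).2] at hDx
          exact (hinv.mem i hi).2 hDx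
      · intro y hy
        rcases Finset.mem_insert.1 hy with rfl | hy
        · rw [Function.update_self]; omega
        · rw [Function.update_of_ne (show y ≠ x from fun h => hxP (h ▸ hy))]
          exact hP y hy
    · intro hDx
      simp only [Finset.card_insert_of_notMem hxP]
      refine ⟨hq, hinv', hold, by omega, ?_, by omega⟩
      intro y hy
      rcases Finset.mem_insert.1 hy with rfl | hy
      · refine ⟨hDx, ?_⟩
        -- A neighbour visited before is in the queue, and `window` bounds its level by that of the
        -- head plus one.
        obtain ⟨i, hi, rfl⟩ := hinv'.surj _ hDx
        have := hinv'.window i hi (by omega)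
        rwa [hw', hDw] at this
      · exact hP y hy
  · intro s' c' hF hI
    obtain ⟨hq, hinv', hold, h12, hP, hc⟩ := hI
    have r3 : s'.reg 3 = qh + 1 := by 
      rw [hF.reg 3 (by simp [nbrLoop, bfsVisit, nop, Prog.regs, Op.regs])]; simp
    have r7 : s'.reg 7 = s.reg 7 := by 
      rw [hF.reg 7 (by simp [nbrLoop, bfsVisit, nop, Prog.regs, Op.regs])]; simp
    have r8 : s'.reg 8 = s.reg 8 := by 
      rw [hF.reg 8 (by simp [nbrLoop, bfsVisit, nop, Prog.regs, Op.regs])]; simp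
    have r9 : s'.reg 9 = w := by 
      rw [hF.reg 9 (by simp [nbrLoop, bfsVisit, nop, Prog.regs, Op.regs])]; simp
    have r10 : s'.reg 10 = s.arr D w := by 
      rw [hF.reg 10 (by simp [nbrLoop, bfsVisit, nop, Prog.regs, Op.regs])]; simp
    have hw' : s'.arr Q qh = w := by rw [(hold qh hlt).1, hw]
    have hDw : s'.arr D w = s.arr D w := by rw [hw]; exact (hold qh hlt).2
    have hadv := hinv'.advance (by omega) (by
      rw [hw', hDw]
      exact fun y hy => hP y (hG.mem_nbrs.2 hy))
    have hcb := hbest.congr hq hlt.le hold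
    have hnew := hinv'.curBest_advance (by omega) hcb
    rw [hw', hDw] at hnew
    simp only [nop, wp_seq, wp_op, wp_ite, Op.apply, Test.Holds, ne_eq, Nat.reduceEqDiff,
      not_false_eq_true, Function.update_self, Function.update_of_ne, r3, r7, r8, r9, r10, h12,
      hw', hDw]
    refine ⟨fun hlt' => ⟨trivial, hq, hadv, hnew.1 (Or.inl hlt'), trivial, fun i hi => (hold i hi).1,
      by omega⟩, fun hlt' => ⟨fun hlt'' => ⟨trivial, hq, hadv, hnew.1 (Or.inr hlt''), trivial,
      fun i hi => (hold i hi).1, by omega⟩, fun hlt'' => ⟨trivial, hq, hadv, hnew.2 hlt' hlt'',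
      trivial, fun i hi => (hold i hi).1, by omega⟩⟩⟩

end

end RAM

/-! ### Breadth-first search of a component and of the whole graph, with running time. -/

namespace RAM

section

variable {n : ℕ} {H : SimpleGraph ℕ} {off adj : ℕ → ℕ} {S Q D B : ℕ}

/-- Time bound for processing the first `k` elements of the queue. -/
noncomputable def bfsWork (n : ℕ) (H : SimpleGraph ℕ) (Q : ℕ → ℕ) (k : ℕ) : ℕ :=
  ∑ i ∈ Finset.range k, (21 + 10 * (nbrs n H (Q i)).card)

theorem bfsWork_congr {Q Q' : ℕ → ℕ} {k : ℕ} (h : ∀ i < k, Q i = Q' i) :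
    bfsWork n H Q k = bfsWork n H Q' k :=
  Finset.sum_congr rfl fun i hi => by rw [h i (Finset.mem_range.1 hi)]

theorem bfsWork_succ (Q : ℕ → ℕ) (k : ℕ) :
    bfsWork n H Q (k + 1) = bfsWork n H Q k + (21 + 10 * (nbrs n H (Q k)).card) :=
  Finset.sum_range_succ _ _

theorem AdjLists.card_nbrs_lt (hG : AdjLists n H off adj) {v : ℕ} (hv : v < n) :
    (nbrs n H v).card < n := by
  classical
  have : nbrs n H v ⊂ Finset.range n := by
    rw [Finset.ssubset_iff_of_subset]
    · exact ⟨v, by simpa using hv, fun h => H.irrefl (hG.mem_nbrs.1 h)⟩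
    · exact fun w hw => by simpa using (hG.lt _ _ (hG.mem_nbrs.1 hw)).2
  simpa using Finset.card_lt_card this

/-- The time is charged to the queue entries added: the work of the old queue appears on the left
and that of the new queue on the right, so the bounds telescope over components. -/
theorem wp_bfsComponent (hG : AdjLists n H off adj) (ha : BfsArrays S Q D B) {s : State} {c : ℕ}
    (hoff : s.arr 0 = off) (hadj : s.arr 1 = adj) (hn : s.reg 0 = n) (hzero : s.reg 18 = 0)
    {src roots : Set ℕ} {r dn qt nb x : ℕ} (hh : s.reg 3 = qt) (ht : s.reg 4 = qt)
    (hdn : s.reg 6 = dn) (hnb : s.reg 17 = nb) (hx : s.reg 5 = x) (hxn : x < n) (hxs : x ∈ src)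
    (hDx : s.arr D x = 0) (hdn1 : 1 ≤ dn) (hdn2 : dn ≤ qt + 1)
    (hinv : BfsInv n H src roots r qt dn (s.arr D) (s.arr Q) qt qt (s.arr B) nb) :
    wp (bfsComponent Q D B) (fun s' c' => ∃ roots' r', s'.reg 3 = s'.reg 4 ∧
      1 ≤ s'.reg 6 ∧ s'.reg 6 ≤ s'.reg 4 + 1 ∧ s'.arr D x ≠ 0 ∧ qt ≤ s'.reg 4 ∧
      BfsInv n H src roots' r' (s'.reg 4) (s'.reg 6) (s'.arr D) (s'.arr Q) (s'.reg 4) (s'.reg 4)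
        (s'.arr B) (s'.reg 17) ∧
      (∀ i < qt, s'.arr Q i = s.arr Q i) ∧
      c' + bfsWork n H (s.arr Q) qt ≤ c + 20 + bfsWork n H (s'.arr Q) (s'.reg 4)) s c := by
  have h0D : (0 : ℕ) ≠ D := by have := ha.hD; omega
  have h1D : (1 : ℕ) ≠ D := by have := ha.hD; omega
  have h0Q : (0 : ℕ) ≠ Q := by have := ha.hQ; omega
  have h1Q : (1 : ℕ) ≠ Q := by have := ha.hQ; omega
  have hroot := hinv.newRoot hxn hDx hxs hdn1 hdn2
  simp only [bfsComponent, wp_seq, wp_op, Op.apply, ne_eq, Nat.reduceEqDiff, not_false_eq_true,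
    Function.update_of_ne, ht, hdn, hx, hn, ha.QD]
  refine wp_while (fun s' c' => qt + 1 ≤ s'.reg 4 ∧
      BfsInv n H src (insert x roots) x qt dn (s'.arr D) (s'.arr Q) (s'.reg 3) (s'.reg 4)
        (s.arr B) nb ∧
      CurBest n H qt (s'.arr D) (s'.arr Q) (s'.reg 3) (s'.reg 4) (s'.reg 7) (s'.reg 8) ∧
      (qt < s'.reg 3 → s'.reg 10 = s'.arr D (s'.arr Q (s'.reg 3 - 1))) ∧
      (∀ i < qt + 1, s'.arr Q i = Function.update (s.arr Q) qt x i) ∧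
      c' + bfsWork n H (s.arr Q) qt ≤ c + 5 + bfsWork n H (s'.arr Q) (s'.reg 3))
    (fun s' => n - s'.reg 3) ?_ ?_ ?_
  · have hwork : bfsWork n H (Function.update (s.arr Q) qt x) qt = bfsWork n H (s.arr Q) qt :=
      bfsWork_congr fun i hi => by rw [Function.update_of_ne (by omega)]
    simp only [ne_eq, Nat.reduceEqDiff, not_false_eq_true,
      Function.update_self, Function.update_of_ne, hh, ha.QD.symm, hwork]
    -- The bound in register 8 starts at n, above every degree, so the root is an admissible best
    -- vertex before its degree is known.
    refine ⟨le_rfl, hroot, ⟨⟨qt, le_rfl, le_rfl, by omega, by rw [Function.update_self]⟩,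
      (hG.card_nbrs_lt hxn).le, fun i h1 h2 => by omega⟩, fun h => by omega, fun i _ => trivial,
      by omega⟩
  · intro s' c' hF hI hb
    obtain ⟨h4, hi, hcb, h10, hQs, hc⟩ := hI
    simp only [Test.Holds] at hb
    have a0 : s'.arr 0 = off := by
      rw [hF.arr 0 (by simp [bfsStep, nbrLoop, bfsVisit, nop, Prog.arrs, Op.arrs, h0D, h0Q])]
      simp [h0D, h0Q, hoff]
    have a1 : s'.arr 1 = adj := by
      rw [hF.arr 1 (by simp [bfsStep, nbrLoop, bfsVisit, nop, Prog.arrs, Op.arrs, h1D, h1Q])]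
      simp [h1D, h1Q, hadj]
    have r18 : s'.reg 18 = 0 := by
      rw [hF.reg 18 (by simp [bfsStep, nbrLoop, bfsVisit, nop, Prog.regs, Op.regs])]
      simp [hzero]
    have htail := hi.tail_le
    refine wp_mono (wp_bfsStep hG ha a0 a1 r18 rfl rfl hb hi hcb) ?_
    rintro s'' c'' - ⟨e3, e4, hi', hcb', e10, hQ', hc'⟩
    have hw := bfsWork_succ (n := n) (H := H) (s''.arr Q) (s'.reg 3)
    have hw' : bfsWork n H (s''.arr Q) (s'.reg 3) = bfsWork n H (s'.arr Q) (s'.reg 3) :=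
      bfsWork_congr fun i hi => hQ' i (by omega)
    rw [hQ' _ hb, hw'] at hw
    rw [e3]
    refine ⟨⟨by omega, hi', hcb', fun _ => by simpa using e10, fun i hi => ?_, by omega⟩, by omega⟩
    rw [hQ' i (by omega), hQs i hi]
  · intro s' c' hF hI hb
    obtain ⟨h4, hi, hcb, h10, hQs, hc⟩ := hI
    simp only [Test.Holds, not_lt] at hb
    have e34 : s'.reg 3 = s'.reg 4 := le_antisymm hi.head_le hb
    rw [e34] at hi hcb h10 hc
    have aB : s'.arr B = s.arr B := by
      rw [hF.arr B (by
        simp [bfsStep, nbrLoop, bfsVisit, nop, Prog.arrs, Op.arrs, ha.QB.symm, ha.DB.symm])]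
      simp [ha.QB.symm, ha.DB.symm]
    have r17 : s'.reg 17 = nb := by
      rw [hF.reg 17 (by simp [bfsStep, nbrLoop, bfsVisit, nop, Prog.regs, Op.regs])]
      simp [hnb]
    have hfin := hi.finish hcb
    have hQx : s'.arr Q qt = x := by rw [hQs qt (by omega), Function.update_self]
    simp only [wp_seq, wp_op, Op.apply, ne_eq, Nat.reduceEqDiff, not_false_eq_true,
      Function.update_self, Function.update_of_ne, r17, aB, ha.QB, ha.DB, h10 (by omega)]
    refine ⟨_, _, e34, by omega, ?_, ?_, by omega, hfin, ?_, by omega⟩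
    · have := hi.level_le (s'.reg 4 - 1) (by omega)
      omega
    · have := (hi.mem qt (by omega)).2
      rwa [hQx] at this
    · intro i hi'
      rw [hQs i (by omega), Function.update_of_ne (by omega)]

/-- What a breadth-first search from the sources `src` computes. -/
structure BfsResult (n : ℕ) (H : SimpleGraph ℕ) (src : Set ℕ) (D B : ℕ → ℕ) (nb : ℕ) : Prop where
  level : ∀ v < n, D v ≠ 0 ∧ D v ≤ n
  nb_le : nb ≤ n
  adj_le : ∀ x y, H.Adj x y → D y ≤ D x + 1
  same : ∀ x < n, ∀ y, D x = D y → H.Reachable x y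
  roots : ∃ roots ⊆ src, (∀ x ∈ roots, ∀ y ∈ roots, H.Reachable x y → x = y) ∧
    ∀ x < n, x ∈ roots ∨ ∃ y, H.Adj x y ∧ D x = D y + 1
  best : ∀ k < nb, B k < n ∧ IsBest n H D (B k)
  cover : ∀ v < n, ∃ k < nb, H.Reachable (B k) v

/-- Total size of the adjacency lists. -/
noncomputable def totalDegree (n : ℕ) (H : SimpleGraph ℕ) : ℕ :=
  ∑ v ∈ Finset.range n, (nbrs n H v).card

/-- Distinct entries pay for each adjacency list at most once; this serves the queue and, later, the
computed order. -/
theorem sum_nbrs_le {q : ℕ} {Q : ℕ → ℕ} (hlt : ∀ i < q, Q i < n)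
    (hinj : ∀ i < q, ∀ j < q, Q i = Q j → i = j) :
    ∑ i ∈ Finset.range q, (nbrs n H (Q i)).card ≤ totalDegree n H := by
  classical
  rw [totalDegree, ← Finset.sum_image (s := Finset.range q) (g := Q)
    (f := fun v => (nbrs n H v).card)]
  · refine Finset.sum_le_sum_of_subset fun v hv => ?_
    obtain ⟨i, hi, rfl⟩ := Finset.mem_image.1 hv
    simpa using hlt i (by simpa using hi)
  · intro i hi j hj hij
    exact hinj i (by simpa using hi) j (by simpa using hj) hij

theorem BfsInv.work_le {src roots : Set ℕ} {s q0 dn : ℕ} {D Q : ℕ → ℕ} {qh qt : ℕ} {B : ℕ → ℕ}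
    {nb : ℕ} (h : BfsInv n H src roots s q0 dn D Q qh qt B nb) :
    bfsWork n H Q qt ≤ 21 * n + 10 * totalDegree n H := by
  have h1 := sum_nbrs_le (H := H) (fun i hi => (h.mem i hi).1) h.inj
  have h2 := h.tail_le
  unfold bfsWork
  rw [Finset.sum_add_distrib, ← Finset.mul_sum]
  simp only [Finset.sum_const, Finset.card_range, smul_eq_mul]
  omega

theorem BfsInv.result {src roots : Set ℕ} {s dn : ℕ} {D Q : ℕ → ℕ} {qt : ℕ} {B : ℕ → ℕ}
    {nb : ℕ} (h : BfsInv n H src roots s qt dn D Q qt qt B nb)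
    (hsrc : ∀ v < n, ∃ x ∈ src, H.Reachable x v) (hvis : ∀ x ∈ src, D x ≠ 0)
    (hlt : ∀ v w, H.Adj v w → v < n ∧ w < n) :
    BfsResult n H src D B nb := by
  have hall : ∀ v < n, D v ≠ 0 := fun v hv => by
    obtain ⟨x, hx, hxv⟩ := hsrc v hv
    exact h.reachable (hvis x hx) hxv
  have hidx : ∀ v < n, ∃ i < qt, Q i = v := fun v hv => h.surj v (hall v hv)
  have htail := h.tail_le
  refine ⟨fun v hv => ⟨hall v hv, ?_⟩, h.nb_le.trans htail, ?_, fun x hx y hxy =>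
    h.same x y (hall x hx) hxy, ⟨roots, fun x hx => (h.roots_src x hx).1, h.roots_unique, ?_⟩,
    ?_, ?_⟩
  · obtain ⟨i, hi, rfl⟩ := hidx v hv
    have := h.level_le i hi
    omega
  · intro x y hxy
    obtain ⟨i, hi, rfl⟩ := hidx x (hlt _ _ hxy).1
    exact (h.done i hi y hxy).2
  · intro x hx
    rcases h.parent x (hall x hx) with hr | ⟨y, hy, -, hD⟩
    · exact Or.inl hr
    · exact Or.inr ⟨y, hy, hD⟩
  · intro k hk
    refine ⟨?_, h.best k hk⟩
    obtain ⟨i, hi, he⟩ := h.surj _ (h.best k hk _ (SimpleGraph.Reachable.refl _)).1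
    rw [← he]
    exact (h.mem i hi).1
  · intro v hv
    obtain ⟨i, hi, rfl⟩ := hidx v hv
    exact h.cover i hi

/-- Each source is charged 27 and each queue entry 21 plus ten times its degree; there are at most n
of either, whence 48. -/
theorem wp_bfs (hG : AdjLists n H off adj) (ha : BfsArrays S Q D B) {s : State} {c : ℕ}
    (hoff : s.arr 0 = off) (hadj : s.arr 1 = adj) (hn : s.reg 0 = n) (hzero : s.reg 18 = 0)
    (hD : ∀ x, s.arr D x = 0) {ns : ℕ} (hns : s.reg 1 = ns) (hnsn : ns ≤ n) {src : Set ℕ}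
    (hsrc : src = {x | ∃ i < ns, s.arr S i = x}) (hsrcn : ∀ x ∈ src, x < n)
    (hcov : ∀ v < n, ∃ x ∈ src, H.Reachable x v) :
    wp (bfs S Q D B) (fun s' c' =>
      BfsResult n H src (s'.arr D) (s'.arr B) (s'.reg 17) ∧
      c' ≤ c + 6 + 48 * n + 10 * totalDegree n H) s c := by
  have h0D : (0 : ℕ) ≠ D := by have := ha.hD; omega
  have h1D : (1 : ℕ) ≠ D := by have := ha.hD; omega
  have h0Q : (0 : ℕ) ≠ Q := by have := ha.hQ; omega
  have h1Q : (1 : ℕ) ≠ Q := by have := ha.hQ; omega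
  have h0B : (0 : ℕ) ≠ B := by have := ha.hB; omega
  have h1B : (1 : ℕ) ≠ B := by have := ha.hB; omega
  simp only [bfs, wp_seq, wp_op, Op.apply]
  refine wp_for (fun i s' c' => s'.reg 2 = i ∧ s'.reg 3 = s'.reg 4 ∧
      1 ≤ s'.reg 6 ∧ s'.reg 6 ≤ s'.reg 4 + 1 ∧
      (∃ roots r, BfsInv n H src roots r (s'.reg 4) (s'.reg 6) (s'.arr D) (s'.arr Q)
        (s'.reg 4) (s'.reg 4) (s'.arr B) (s'.reg 17)) ∧
      (∀ j < i, s'.arr D (s.arr S j) ≠ 0) ∧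
      c' ≤ c + 5 + 27 * i + bfsWork n H (s'.arr Q) (s'.reg 4)) (k := 0) (N := ns)
      (Nat.zero_le _) ?_ ?_ ?_ ?_
  · simp only [ne_eq, Nat.reduceEqDiff, not_false_eq_true, Function.update_self, Function.update_of_ne]
    refine ⟨trivial, trivial, le_rfl, le_rfl, ⟨∅, 0, ?_⟩, fun j hj => by omega, by omega⟩
    -- The program starts at level 1, as level 0 marks unvisited vertices; with an empty queue the
    -- fields depending on the level are vacuous.
    have := BfsInv.empty (n := n) (H := H) (src := src) (Q := s.arr Q) (B := s.arr B) hD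
    exact { this with old := fun i hi => by omega, cur := fun i _ hi => by omega }
  · intro i s' c' hF hI
    have r1 : s'.reg 1 = ns := by
      rw [hF.reg 1 (by simp [bfsComponent, bfsStep, nbrLoop, bfsVisit, nop, Prog.regs, Op.regs])]
      simp [hns]
    simp only [Test.Holds, hI.1, r1]
  · intro i s' c' _ hi hF hI
    obtain ⟨e2, e34, h6, h6', ⟨roots, r, hinv⟩, hvis, hc⟩ := hI
    have a0 : s'.arr 0 = off := by
      rw [hF.arr 0 (by simp [bfsComponent, bfsStep, nbrLoop, bfsVisit, nop, Prog.arrs, Op.arrs,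
        h0D, h0Q, h0B])]
      exact hoff
    have a1 : s'.arr 1 = adj := by
      rw [hF.arr 1 (by simp [bfsComponent, bfsStep, nbrLoop, bfsVisit, nop, Prog.arrs, Op.arrs,
        h1D, h1Q, h1B])]
      exact hadj
    have aS : s'.arr S = s.arr S := by
      rw [hF.arr S (by simp [bfsComponent, bfsStep, nbrLoop, bfsVisit, nop, Prog.arrs, Op.arrs,
        ha.SQ, ha.SD, ha.SB])]
    have r0 : s'.reg 0 = n := by
      rw [hF.reg 0 (by simp [bfsComponent, bfsStep, nbrLoop, bfsVisit, nop, Prog.regs, Op.regs])]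
      simp [hn]
    have r18 : s'.reg 18 = 0 := by
      rw [hF.reg 18 (by simp [bfsComponent, bfsStep, nbrLoop, bfsVisit, nop, Prog.regs, Op.regs])]
      simp [hzero]
    have hxs : s.arr S i ∈ src := by rw [hsrc]; exact ⟨i, hi, rfl⟩
    simp only [nop, wp_seq, wp_op, wp_ite, Op.apply, Test.Holds, ne_eq, Nat.reduceEqDiff,
      not_false_eq_true, Function.update_self, Function.update_of_ne, aS, e2, r18]
    constructor
    · intro hDx
      refine wp_mono (wp_bfsComponent (s := ⟨Function.update (Function.update (Function.update
        s'.reg 5 (s.arr S i)) 2 (i + 1)) 16 _, s'.arr⟩) hG ha (x := s.arr S i) a0 a1 (by simp [r0]) (by simp [r18])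
        (qt := s'.reg 4) (dn := s'.reg 6) (nb := s'.reg 17) (by simp [e34]) rfl rfl rfl rfl (hsrcn _ hxs) hxs hDx
        (by simpa using h6) (by simpa using h6') (by simpa using hinv)) ?_
      rintro s'' c'' hF' ⟨roots', r', e34', g6, g6', hDx', h4, hinv', hQ, hc'⟩
      refine ⟨?_, e34', g6, g6', ⟨roots', r', hinv'⟩, ?_, ?_⟩
      · rw [hF'.reg 2 (by simp [bfsComponent, bfsStep, nbrLoop, bfsVisit, nop, Prog.regs, Op.regs])]
        simp
      · intro j hj
        rcases (show j < i ∨ j = i by omega) with hj | rfl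
        · obtain ⟨k, hk, he⟩ := hinv.surj _ (hvis j hj)
          have := (hinv'.mem k (by omega)).2
          rwa [hQ k hk, he] at this
        · exact hDx'
      · change c'' + bfsWork n H (s'.arr Q) _ ≤ _ at hc'
        omega
    · intro hDx
      refine ⟨trivial, e34, h6, h6', ⟨roots, r, hinv⟩, ?_, by omega⟩
      intro j hj
      rcases (show j < i ∨ j = i by omega) with hj | rfl
      · exact hvis j hj
      · exact hDx
  · intro s' c' hF hI
    obtain ⟨e2, e34, h6, h6', ⟨roots, r, hinv⟩, hvis, hc⟩ := hI
    have := hinv.work_le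
    refine ⟨hinv.result hcov ?_ hG.lt, by omega⟩
    intro x hx
    rw [hsrc] at hx
    obtain ⟨i, hi, rfl⟩ := hx
    exact hvis i hi

end

end RAM

/-! ### Counting sort -/

namespace RAM

section Rank

variable (n : ℕ) (κ : ℕ → ℕ)

/-- Number of items with a key less than `k`. -/
def countLT (k : ℕ) : ℕ := ((Finset.range n).filter fun j => κ j < k).card

/-- Number of items among the first `i` ones with key `k`. -/
def countEq (i k : ℕ) : ℕ := ((Finset.range i).filter fun j => κ j = k).card

/-- Position of item `i` after sorting. -/
def sortRank (i : ℕ) : ℕ := countLT n κ (κ i) + countEq κ i (κ i)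

variable {n κ}

theorem countEq_succ (i k : ℕ) :
    countEq κ (i + 1) k = countEq κ i k + if κ i = k then 1 else 0 := by
  unfold countEq
  rw [Finset.range_add_one, Finset.filter_insert]
  split_ifs
  · rw [Finset.card_insert_of_notMem (by simp)]
  · rfl

theorem countLT_succ (k : ℕ) : countLT n κ (k + 1) = countLT n κ k + countEq κ n k := by
  unfold countLT countEq
  rw [← Finset.card_union_of_disjoint]
  · congr 1
    ext j
    simp only [Finset.mem_filter, Finset.mem_union, Finset.mem_range]
    omega
  · rw [Finset.disjoint_left]
    intro j
    simp only [Finset.mem_filter]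
    omega

theorem countLT_le (k : ℕ) : countLT n κ k ≤ n := by
  have := Finset.card_filter_le (Finset.range n) fun j => κ j < k
  rwa [Finset.card_range] at this

theorem countLT_mono {k k' : ℕ} (h : k ≤ k') : countLT n κ k ≤ countLT n κ k' := by
  refine Finset.card_le_card fun j hj => ?_
  rw [Finset.mem_filter] at hj ⊢
  exact ⟨hj.1, hj.2.trans_le h⟩

theorem countEq_lt {i j : ℕ} (h : i < j) : countEq κ i (κ i) < countEq κ j (κ i) := by
  have h1 := countEq_succ (κ := κ) i (κ i)
  have h2 : countEq κ (i + 1) (κ i) ≤ countEq κ j (κ i) := by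
    refine Finset.card_le_card fun j => ?_
    simp only [Finset.mem_filter, Finset.mem_range]
    omega
  simp only [if_true] at h1
  omega

theorem sortRank_lt_countLT {i : ℕ} (hi : i < n) : sortRank n κ i < countLT n κ (κ i + 1) := by
  rw [countLT_succ, sortRank]
  have := countEq_lt (κ := κ) hi
  omega

theorem sortRank_lt {i : ℕ} (hi : i < n) : sortRank n κ i < n :=
  (sortRank_lt_countLT hi).trans_le (countLT_le _)

/-- Besides sorting, this says that equal keys keep their input order, which makes two passes sort
lexicographically. -/
theorem sortRank_lt_sortRank {i j : ℕ} (hi : i < n) (h : κ i < κ j ∨ κ i = κ j ∧ i < j) :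
    sortRank n κ i < sortRank n κ j := by
  rcases h with h | ⟨h, hij⟩
  · have h1 := sortRank_lt_countLT (κ := κ) hi
    have h2 := countLT_mono (n := n) (κ := κ) (show κ i + 1 ≤ κ j from h)
    unfold sortRank at *
    omega
  · have := countEq_lt (κ := κ) hij
    unfold sortRank
    rw [← h]
    omega

/-- `Y` lists the items `X 0, …, X (n - 1)` stably sorted by the key `K`. -/
def Sorted (n : ℕ) (X K Y : ℕ → ℕ) : Prop :=
  ∃ rank : ℕ → ℕ, (∀ i < n, rank i < n ∧ Y (rank i) = X i) ∧
    ∀ i < n, ∀ j < n, K (X i) < K (X j) ∨ K (X i) = K (X j) ∧ i < j → rank i < rank j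

end Rank

/-- Count the keys. -/
def sortCount (X K C : ℕ) : Prog :=
  .op (.const 2 0) ;; .while (.lt 2 0) (.op (.load 9 X 2) ;; .op (.load 10 K 9) ;;
    .op (.load 12 C 10) ;; .op (.succ 12) ;; .op (.store C 10 12) ;; .op (.succ 2))

/-- Compute the first position of each key. -/
def sortStart (C : ℕ) : Prog :=
  .op (.const 3 0) ;; .op (.const 4 0) ;; .while (.lt 3 20) (.op (.load 12 C 3) ;;
    .op (.store C 3 4) ;; .while (.lt 18 12) (.op (.pred 12) ;; .op (.succ 4)) ;; .op (.succ 3))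

/-- Put the items into place. -/
def sortPlace (X K Y C : ℕ) : Prog :=
  .op (.const 2 0) ;; .while (.lt 2 0) (.op (.load 9 X 2) ;; .op (.load 10 K 9) ;;
    .op (.load 4 C 10) ;; .op (.store Y 4 9) ;; .op (.succ 4) ;; .op (.store C 10 4) ;;
    .op (.succ 2))

/-- Sort the array `X` by the key `K` to the array `Y`. Keys are bounded by register `20`. -/
def sort (X K Y C : ℕ) : Prog := sortCount X K C ;; sortStart C ;; sortPlace X K Y C

section

variable {n : ℕ} {X K Y C : ℕ} {s : State} {c : ℕ}

theorem wp_sortCount (hn : s.reg 0 = n) (hC : ∀ k, s.arr C k = 0) (hXC : X ≠ C) (hKC : K ≠ C) :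
    wp (sortCount X K C) (fun s' c' =>
      (∀ k, s'.arr C k = countEq (fun i => s.arr K (s.arr X i)) n k) ∧ c' = c + 2 + 7 * n) s c := by
  simp only [sortCount, wp_seq, wp_op, Op.apply]
  refine wp_for (fun i s' c' => s'.reg 2 = i ∧
      (∀ k, s'.arr C k = countEq (fun i => s.arr K (s.arr X i)) i k) ∧ c' = c + 1 + 7 * i)
      (k := 0) (N := n) (Nat.zero_le _) ?_ ?_ ?_ ?_
  · simp [hC, countEq]
  · intro i s' c' hF hI
    have r0 : s'.reg 0 = n := by rw [hF.reg 0 (by simp [Prog.regs, Op.regs])]; simp [hn]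
    simp only [Test.Holds, hI.1, r0]
  · rintro i s' c' - hi hF ⟨h2, hI, hc⟩
    have aX : s'.arr X = s.arr X := by rw [hF.arr X (by simp [Prog.arrs, Op.arrs, hXC])]
    have aK : s'.arr K = s.arr K := by rw [hF.arr K (by simp [Prog.arrs, Op.arrs, hKC])]
    simp only [wp_seq, wp_op, Op.apply, ne_eq, Nat.reduceEqDiff, not_false_eq_true,
      Function.update_self, Function.update_of_ne, h2, aX, aK]
    refine ⟨trivial, fun k => ?_, by omega⟩
    rw [countEq_succ]
    by_cases hk : s.arr K (s.arr X i) = k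
    · subst hk
      simp [hI]
    · rw [Function.update_of_ne (fun h => hk h.symm), hI, if_neg hk, add_zero]
  · rintro s' c' hF ⟨-, hI, hc⟩
    exact ⟨hI, by omega⟩

/-- Addition is done by unit steps, so a single key may be expensive. The clock is exact: 5 per key
and 3 per unit accumulated in register 4, which never exceeds n. -/
theorem wp_sortStart {M : ℕ} {κ : ℕ → ℕ} (hM : s.reg 20 = M) (hzero : s.reg 18 = 0)
    (hC : ∀ k, s.arr C k = countEq κ n k) :
    wp (sortStart C) (fun s' c' =>
      (∀ k < M, s'.arr C k = countLT n κ k) ∧ c' ≤ c + 3 + 5 * M + 3 * n) s c := by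
  simp only [sortStart, wp_seq, wp_op, Op.apply]
  refine wp_for (fun i s' c' => s'.reg 3 = i ∧ s'.reg 4 = countLT n κ i ∧
      (∀ k < i, s'.arr C k = countLT n κ k) ∧ (∀ k, i ≤ k → s'.arr C k = countEq κ n k) ∧
      c' = c + 2 + 5 * i + 3 * s'.reg 4) (k := 0) (N := M) (Nat.zero_le _) ?_ ?_ ?_ ?_
  · simp [hC, countLT]
  · intro i s' c' hF hI
    have r20 : s'.reg 20 = M := by rw [hF.reg 20 (by simp [Prog.regs, Op.regs])]; simp [hM]
    simp only [Test.Holds, hI.1, r20]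
  · rintro i s' c' - hi hF ⟨h3, h4, hlt, hge, hc⟩
    have r18 : s'.reg 18 = 0 := by rw [hF.reg 18 (by simp [Prog.regs, Op.regs])]; simp [hzero]
    simp only [wp_seq, wp_op, Op.apply, ne_eq, Nat.reduceEqDiff, not_false_eq_true,
      Function.update_of_ne, h3]
    refine wp_while (fun s'' c'' => s''.reg 4 + s''.reg 12 = countLT n κ (i + 1) ∧
        c'' = c + 5 + 5 * i + 3 * s''.reg 4) (fun s'' => s''.reg 12) ?_ ?_ ?_
    · simp only [ne_eq, Nat.reduceEqDiff, not_false_eq_true,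
        Function.update_self, Function.update_of_ne, hge i le_rfl, countLT_succ, h4]
      refine ⟨trivial, by omega⟩
    · rintro s'' c'' hF' ⟨hI, hc'⟩ hb
      have r18' : s''.reg 18 = 0 := by
        rw [hF'.reg 18 (by simp [Prog.regs, Op.regs])]; simp [r18]
      simp only [Test.Holds, r18'] at hb
      simp only [wp_seq, wp_op, Op.apply, ne_eq, Nat.reduceEqDiff, not_false_eq_true,
        Function.update_self, Function.update_of_ne]
      omega
    · rintro s'' c'' hF' ⟨hI, hc'⟩ hb
      have r18' : s''.reg 18 = 0 := by
        rw [hF'.reg 18 (by simp [Prog.regs, Op.regs])]; simp [r18]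
      have r3' : s''.reg 3 = i := by
        rw [hF'.reg 3 (by simp [Prog.regs, Op.regs])]; simp [h3]
      have aC : s''.arr C = Function.update (s'.arr C) i (s'.reg 4) := by
        rw [hF'.arr C (by simp [Prog.arrs, Op.arrs])]; simp
      simp only [Test.Holds, r18'] at hb
      simp only [wp_op, Op.apply, ne_eq, Nat.reduceEqDiff, not_false_eq_true,
        Function.update_self, Function.update_of_ne, r3', aC]
      refine ⟨trivial, by omega, fun k hk => ?_, fun k hk => ?_, by omega⟩
      · by_cases hki : k = i
        · subst hki; simp [h4]
        · rw [Function.update_of_ne hki]; exact hlt k (by omega)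
      · rw [Function.update_of_ne (by omega)]; exact hge k (by omega)
  · rintro s' c' hF ⟨-, h4, hI, -, hc⟩
    have := countLT_le (n := n) (κ := κ) M
    exact ⟨hI, by omega⟩

theorem wp_sortPlace {M : ℕ} {κ : ℕ → ℕ} (hn : s.reg 0 = n)
    (hκ : κ = fun i => s.arr K (s.arr X i)) (hκM : ∀ i < n, κ i < M)
    (hC : ∀ k < M, s.arr C k = countLT n κ k) (hXC : X ≠ C) (hKC : K ≠ C) (hXY : X ≠ Y)
    (hKY : K ≠ Y) (hYC : Y ≠ C) :
    wp (sortPlace X K Y C) (fun s' c' =>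
      (∀ i < n, s'.arr Y (sortRank n κ i) = s.arr X i) ∧ c' = c + 2 + 8 * n) s c := by
  simp only [sortPlace, wp_seq, wp_op, Op.apply]
  refine wp_for (fun i s' c' => s'.reg 2 = i ∧
      -- The counter of key k always points to the next free place of its block.
      (∀ k < M, s'.arr C k = countLT n κ k + countEq κ i k) ∧
      (∀ j < i, s'.arr Y (sortRank n κ j) = s.arr X j) ∧ c' = c + 1 + 8 * i)
      (k := 0) (N := n) (Nat.zero_le _) ?_ ?_ ?_ ?_
  · refine ⟨by simp, fun k hk => ?_, by simp, by simp⟩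
    simp [hC k hk, countEq]
  · intro i s' c' hF hI
    have r0 : s'.reg 0 = n := by rw [hF.reg 0 (by simp [Prog.regs, Op.regs])]; simp [hn]
    simp only [Test.Holds, hI.1, r0]
  · rintro i s' c' - hi hF ⟨h2, hI, hY, hc⟩
    have aX : s'.arr X = s.arr X := by rw [hF.arr X (by simp [Prog.arrs, Op.arrs, hXC, hXY])]
    have aK : s'.arr K = s.arr K := by rw [hF.arr K (by simp [Prog.arrs, Op.arrs, hKC, hKY])]
    have hk : s.arr K (s.arr X i) = κ i := by rw [hκ]
    have hCi : s'.arr C (κ i) = sortRank n κ i := hI _ (hκM i hi)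
    simp only [wp_seq, wp_op, Op.apply, ne_eq, Nat.reduceEqDiff, not_false_eq_true,
      Function.update_self, Function.update_of_ne, h2, aX, aK, hYC, hYC.symm, hk, hCi]
    refine ⟨trivial, fun k hkM => ?_, fun j hj => ?_, by omega⟩
    · rw [countEq_succ]
      by_cases hki : κ i = k
      · subst hki
        simp [sortRank, add_assoc]
      · rw [Function.update_of_ne (fun h => hki h.symm), hI k hkM, if_neg hki, add_zero]
    · rcases (show j < i ∨ j = i by omega) with hj | rfl
      -- Different items have different ranks, so earlier entries are not overwritten.
      · rw [Function.update_of_ne]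
        · exact hY j hj
        · rcases lt_trichotomy (κ j) (κ i) with h | h | h
          · exact (sortRank_lt_sortRank (by omega) (Or.inl h)).ne
          · exact (sortRank_lt_sortRank (by omega) (Or.inr ⟨h, hj⟩)).ne
          · exact (sortRank_lt_sortRank hi (Or.inl h)).ne'
      · simp
  · rintro s' c' hF ⟨-, -, hI, hc⟩
    exact ⟨hI, by omega⟩

theorem wp_sort {M : ℕ} (hn : s.reg 0 = n) (hM : s.reg 20 = M) (hzero : s.reg 18 = 0)
    (hC : ∀ k, s.arr C k = 0) (hκM : ∀ i < n, s.arr K (s.arr X i) < M) (hXC : X ≠ C)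
    (hKC : K ≠ C) (hXY : X ≠ Y) (hKY : K ≠ Y) (hYC : Y ≠ C) :
    wp (sort X K Y C) (fun s' c' => Sorted n (s.arr X) (s.arr K) (s'.arr Y) ∧
      c' ≤ c + 7 + 18 * n + 5 * M) s c := by
  unfold sort
  rw [wp_seq]
  refine wp_mono (wp_sortCount hn hC hXC hKC) ?_
  rintro s₁ c₁ hF₁ ⟨hC₁, hc₁⟩
  rw [wp_seq]
  have e₁ : ∀ x, x ∉ [2, 9, 10, 12, 2] → s₁.reg x = s.reg x := fun x hx =>
    hF₁.reg x (by simp only [sortCount, Prog.regs, Op.regs]; simpa using hx)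
  refine wp_mono (wp_sortStart (M := M) (by rw [e₁ 20 (by simp), hM])
    (by rw [e₁ 18 (by simp), hzero]) hC₁) ?_
  rintro s₂ c₂ hF₂ ⟨hC₂, hc₂⟩
  have r0 : s₂.reg 0 = n := by
    rw [hF₂.reg 0 (by simp [sortStart, Prog.regs, Op.regs]), e₁ 0 (by simp), hn]
  have aX : s₂.arr X = s.arr X := by
    rw [hF₂.arr X (by simp [sortStart, Prog.arrs, Op.arrs, hXC]),
      hF₁.arr X (by simp [sortCount, Prog.arrs, Op.arrs, hXC])]
  have aK : s₂.arr K = s.arr K := by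
    rw [hF₂.arr K (by simp [sortStart, Prog.arrs, Op.arrs, hKC]),
      hF₁.arr K (by simp [sortCount, Prog.arrs, Op.arrs, hKC])]
  refine wp_mono (wp_sortPlace (κ := fun i => s.arr K (s.arr X i)) r0 (by rw [aX, aK]) hκM hC₂
    hXC hKC hXY hKY hYC) ?_
  rintro s₃ c₃ - ⟨hY, hc₃⟩
  rw [aX] at hY
  refine ⟨⟨sortRank n fun i => s.arr K (s.arr X i), fun i hi => ⟨sortRank_lt hi, hY i hi⟩,
    fun i hi j hj h => sortRank_lt_sortRank hi h⟩, by omega⟩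

end

end RAM

/-! ### Keys, positions and extents of neighbourhoods -/

namespace RAM

/-- Write the vertices to array `3`, and twice their number to register `20`. -/
def initVertices : Prog :=
  .op (.copy 20 0) ;; .op (.const 2 0) ;;
    .while (.lt 2 0) (.op (.store 3 2 2) ;; .op (.succ 20) ;; .op (.succ 2))

/-- For each vertex, write `n` plus the number of neighbours in later layers minus the number of
neighbours in earlier layers to array `10`. The layers are given by array `8`. -/
def computeKeys : Prog :=
  .op (.const 2 0) ;; .while (.lt 2 0) (.op (.load 10 8 2) ;; .op (.copy 12 0) ;;
    nbrLoop 2 (.op (.load 16 8 15) ;; .ite (.lt 10 16) (.op (.succ 12))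
      (.ite (.lt 16 10) (.op (.pred 12)) nop)) ;; .op (.store 10 2 12) ;; .op (.succ 2))

/-- Array `15` becomes the inverse of array `13`. -/
def computePositions : Prog :=
  .op (.const 2 0) ;; .while (.lt 2 0) (.op (.load 9 13 2) ;; .op (.store 15 9 2) ;; .op (.succ 2))

/-- For each position, write the first and the last position of a vertex in the closed
neighbourhood to the arrays `16` and `17`. -/
def computeExtents : Prog :=
  .op (.const 2 0) ;; .while (.lt 2 0) (.op (.load 9 13 2) ;; .op (.copy 10 2) ;; .op (.copy 12 2) ;;
    nbrLoop 9 (.op (.load 16 15 15) ;; .ite (.lt 16 10) (.op (.copy 10 16)) nop ;;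
      .ite (.lt 12 16) (.op (.copy 12 16)) nop) ;; .op (.store 16 2 10) ;; .op (.store 17 2 12) ;;
    .op (.succ 2))

section

variable {n : ℕ} {H : SimpleGraph ℕ} {off adj : ℕ → ℕ} {s : State} {c : ℕ}

theorem wp_initVertices (hn : s.reg 0 = n) :
    wp initVertices (fun s' c' => (∀ i < n, s'.arr 3 i = i) ∧ s'.reg 20 = 2 * n ∧
      c' = c + 3 + 4 * n) s c := by
  simp only [initVertices, wp_seq, wp_op, Op.apply]
  refine wp_for (fun i s' c' => s'.reg 2 = i ∧ (∀ j < i, s'.arr 3 j = j) ∧ s'.reg 20 = n + i ∧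
    c' = c + 2 + 4 * i) (k := 0) (N := n) (Nat.zero_le _) ?_ ?_ ?_ ?_
  · simp [hn]
  · intro i s' c' hF hI
    have r0 : s'.reg 0 = n := by rw [hF.reg 0 (by simp [Prog.regs, Op.regs])]; simp [hn]
    simp only [Test.Holds, hI.1, r0]
  · rintro i s' c' - hi hF ⟨h2, hI, h20, hc⟩
    simp only [wp_seq, wp_op, Op.apply, ne_eq, Nat.reduceEqDiff, not_false_eq_true,
      Function.update_self, Function.update_of_ne, h2, h20]
    refine ⟨trivial, fun j hj => ?_, by omega, by omega⟩
    by_cases hji : j = i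
    · subst hji; simp
    · rw [Function.update_of_ne hji]; exact hI j (by omega)
  · rintro s' c' hF ⟨-, hI, h20, hc⟩
    exact ⟨hI, by omega, by omega⟩

theorem AdjLists.laterDegree_eq (hG : AdjLists n H off adj) (D : ℕ → ℕ) (v : ℕ) :
    laterDegree H D v = ((nbrs n H v).filter fun y => D v < D y).card := by
  rw [laterDegree, ← Set.ncard_coe_finset]
  congr 1
  ext w
  simp [hG.mem_nbrs]

theorem AdjLists.earlierDegree_eq (hG : AdjLists n H off adj) (D : ℕ → ℕ) (v : ℕ) :
    earlierDegree H D v = ((nbrs n H v).filter fun y => D y < D v).card := by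
  rw [earlierDegree, ← Set.ncard_coe_finset]
  congr 1
  ext w
  simp [hG.mem_nbrs]

theorem card_filter_insert {P : Finset ℕ} {w : ℕ} (hw : w ∉ P) (p : ℕ → Prop) [DecidablePred p] :
    ((insert w P).filter p).card = (P.filter p).card + if p w then 1 else 0 := by
  rw [Finset.filter_insert]
  split_ifs
  · rw [Finset.card_insert_of_notMem (by simp [hw])]
  · rfl

theorem totalDegree_eq_sum : totalDegree n H = ∑ v ∈ Finset.range n, (nbrs n H v).card := rfl

/-- The shift by n keeps the difference of degrees nonnegative, and the result is stated as an
equation of sums to avoid truncated subtraction. -/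
theorem wp_computeKeys (hG : AdjLists n H off adj) (hn : s.reg 0 = n) (hoff : s.arr 0 = off)
    (hadj : s.arr 1 = adj) :
    wp computeKeys (fun s' c' => (∀ v < n, s'.arr 10 v + earlierDegree H (s.arr 8) v =
      n + laterDegree H (s.arr 8) v) ∧ c' ≤ c + 2 + 11 * n + 8 * totalDegree n H) s c := by
  simp only [computeKeys, wp_seq, wp_op, Op.apply]
  refine wp_for (fun i s' c' => s'.reg 2 = i ∧ (∀ v < i, s'.arr 10 v + earlierDegree H (s.arr 8) v =
      n + laterDegree H (s.arr 8) v) ∧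
    c' ≤ c + 1 + 11 * i + 8 * ∑ v ∈ Finset.range i, (nbrs n H v).card)
    (k := 0) (N := n) (Nat.zero_le _) ?_ ?_ ?_ ?_
  · simp
  · intro i s' c' hF hI
    have r0 : s'.reg 0 = n := by
      rw [hF.reg 0 (by simp [nbrLoop, nop, Prog.regs, Op.regs])]; simp [hn]
    simp only [Test.Holds, hI.1, r0]
  · rintro i s' c' - hi hF ⟨h2, hI, hc⟩
    have r0 : s'.reg 0 = n := by
      rw [hF.reg 0 (by simp [nbrLoop, nop, Prog.regs, Op.regs])]; simp [hn]
    have a0 : s'.arr 0 = off := by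
      rw [hF.arr 0 (by simp [nbrLoop, nop, Prog.arrs, Op.arrs])]; exact hoff
    have a1 : s'.arr 1 = adj := by
      rw [hF.arr 1 (by simp [nbrLoop, nop, Prog.arrs, Op.arrs])]; exact hadj
    have a8 : s'.arr 8 = s.arr 8 := by
      rw [hF.arr 8 (by simp [nbrLoop, nop, Prog.arrs, Op.arrs])]
    simp only [wp_seq, wp_op, Op.apply, ne_eq, OfNat.zero_ne_ofNat,
      not_false_eq_true, Function.update_of_ne, h2, a8, r0]
    have hdeg := hG.card_nbrs_lt hi
    refine wp_nbrLoop hG (v := i) a0 a1 (by simp [h2]) hi (by norm_num)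
      (by simp [nop, Prog.regs, Op.regs]) (by simp [nop, Prog.arrs, Op.arrs])
      (fun P s'' c'' => s''.reg 12 + (P.filter fun y => s.arr 8 y < s.arr 8 i).card =
          n + (P.filter fun y => s.arr 8 i < s.arr 8 y).card ∧
        c'' ≤ c' + 7 + 8 * P.card) ?_ ?_ ?_
    · intro j j'
      simp
    · rintro P w s'' c'' j hw hwP hP hF' ⟨h12, hc'⟩
      have r10 : s''.reg 10 = s.arr 8 i := by
        rw [hF'.reg 10 (by simp [nbrLoop, nop, Prog.regs, Op.regs])]; simp
      have a8' : s''.arr 8 = s.arr 8 := by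
        rw [hF'.arr 8 (by simp [nbrLoop, nop, Prog.arrs, Op.arrs])]; exact a8
      -- Fewer than n decrements have occurred, so register 12 is positive and the predecessor is
      -- not truncated.
      have hcard : (P.filter fun y => s.arr 8 y < s.arr 8 i).card + 1 ≤ (nbrs n H i).card := by
        have h1 := Finset.card_filter_le P fun y => s.arr 8 y < s.arr 8 i
        have h2 := Finset.card_le_card (Finset.insert_subset (hG.mem_nbrs.2 hw) hP)
        rw [Finset.card_insert_of_notMem hwP] at h2
        omega
      simp only [nop, wp_seq, wp_op, wp_ite, Op.apply, Test.Holds, ne_eq, Nat.reduceEqDiff,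
        not_false_eq_true, Function.update_self, Function.update_of_ne, r10, a8',
        card_filter_insert hwP, Finset.card_insert_of_notMem hwP]
      refine ⟨fun h => ?_, fun h => ⟨fun h' => ?_, fun h' => ?_⟩⟩
      · rw [if_pos h, if_neg (by omega)]
        omega
      · rw [if_neg h, if_pos h']
        omega
      · rw [if_neg h, if_neg h']
        omega
    · rintro s'' c'' hF' ⟨h12, hc'⟩
      have r2 : s''.reg 2 = i := by
        rw [hF'.reg 2 (by simp [nbrLoop, nop, Prog.regs, Op.regs])]; simp [h2]
      have a10 : s''.arr 10 = s'.arr 10 := by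
        rw [hF'.arr 10 (by simp [nbrLoop, nop, Prog.arrs, Op.arrs])]
      simp only [wp_seq, wp_op, Op.apply, Function.update_self, r2, a10, Finset.sum_range_succ]
      refine ⟨trivial, fun v hv => ?_, by omega⟩
      rcases (show v < i ∨ v = i by omega) with hv | rfl
      · rw [Function.update_of_ne (by omega)]
        exact hI v hv
      · rw [Function.update_self, hG.laterDegree_eq, hG.earlierDegree_eq]
        exact h12
  · rintro s' c' hF ⟨-, hI, hc⟩
    exact ⟨hI, by rw [totalDegree_eq_sum]; omega⟩

theorem wp_computePositions (hn : s.reg 0 = n)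
    (hinj : ∀ i < n, ∀ j < n, s.arr 13 i = s.arr 13 j → i = j) :
    wp computePositions (fun s' c' => (∀ p < n, s'.arr 15 (s.arr 13 p) = p) ∧
      c' = c + 2 + 4 * n) s c := by
  simp only [computePositions, wp_seq, wp_op, Op.apply]
  refine wp_for (fun i s' c' => s'.reg 2 = i ∧ (∀ p < i, s'.arr 15 (s.arr 13 p) = p) ∧
    c' = c + 1 + 4 * i) (k := 0) (N := n) (Nat.zero_le _) ?_ ?_ ?_ ?_
  · simp
  · intro i s' c' hF hI
    have r0 : s'.reg 0 = n := by rw [hF.reg 0 (by simp [Prog.regs, Op.regs])]; simp [hn]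
    simp only [Test.Holds, hI.1, r0]
  · rintro i s' c' - hi hF ⟨h2, hI, hc⟩
    have a13 : s'.arr 13 = s.arr 13 := by rw [hF.arr 13 (by simp [Prog.arrs, Op.arrs])]
    simp only [wp_seq, wp_op, Op.apply, ne_eq, Nat.reduceEqDiff, not_false_eq_true,
      Function.update_self, Function.update_of_ne, h2, a13]
    refine ⟨trivial, fun p hp => ?_, by omega⟩
    rcases (show p < i ∨ p = i by omega) with hp | rfl
    · rw [Function.update_of_ne fun h => ?_]
      · exact hI p hp
      · have := hinj p (by omega) i hi h
        omega
    · simp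
  · rintro s' c' hF ⟨-, hI, hc⟩
    exact ⟨hI, by omega⟩

/-- `a` and `b` are the first and the last position in the set consisting of `p` and of the
positions of the elements of `P`. -/
structure IsExtent (pos : ℕ → ℕ) (P : Finset ℕ) (p a b : ℕ) : Prop where
  le : a ≤ p ∧ p ≤ b
  left : a = p ∨ ∃ y ∈ P, pos y = a
  right : b = p ∨ ∃ y ∈ P, pos y = b
  mem : ∀ y ∈ P, a ≤ pos y ∧ pos y ≤ b

theorem wp_computeExtents (hG : AdjLists n H off adj) (hn : s.reg 0 = n) (hoff : s.arr 0 = off)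
    (hadj : s.arr 1 = adj) (hord : ∀ p < n, s.arr 13 p < n) :
    wp computeExtents (fun s' c' =>
      (∀ p < n, IsExtent (s.arr 15) (nbrs n H (s.arr 13 p)) p (s'.arr 16 p) (s'.arr 17 p)) ∧
      c' ≤ c + 2 + 13 * n + 8 * ∑ p ∈ Finset.range n, (nbrs n H (s.arr 13 p)).card) s c := by
  simp only [computeExtents, wp_seq, wp_op, Op.apply]
  refine wp_for (fun i s' c' => s'.reg 2 = i ∧
    (∀ p < i, IsExtent (s.arr 15) (nbrs n H (s.arr 13 p)) p (s'.arr 16 p) (s'.arr 17 p)) ∧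
    c' ≤ c + 1 + 13 * i + 8 * ∑ p ∈ Finset.range i, (nbrs n H (s.arr 13 p)).card)
    (k := 0) (N := n) (Nat.zero_le _) ?_ ?_ ?_ ?_
  · simp
  · intro i s' c' hF hI
    have r0 : s'.reg 0 = n := by
      rw [hF.reg 0 (by simp [nbrLoop, nop, Prog.regs, Op.regs])]; simp [hn]
    simp only [Test.Holds, hI.1, r0]
  · rintro i s' c' - hi hF ⟨h2, hI, hc⟩
    have a0 : s'.arr 0 = off := by
      rw [hF.arr 0 (by simp [nbrLoop, nop, Prog.arrs, Op.arrs])]; exact hoff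
    have a1 : s'.arr 1 = adj := by
      rw [hF.arr 1 (by simp [nbrLoop, nop, Prog.arrs, Op.arrs])]; exact hadj
    have a13 : s'.arr 13 = s.arr 13 := by
      rw [hF.arr 13 (by simp [nbrLoop, nop, Prog.arrs, Op.arrs])]
    have a15 : s'.arr 15 = s.arr 15 := by
      rw [hF.arr 15 (by simp [nbrLoop, nop, Prog.arrs, Op.arrs])]
    simp only [wp_seq, wp_op, Op.apply, ne_eq, Nat.reduceEqDiff,
      not_false_eq_true, Function.update_of_ne, h2, a13]
    refine wp_nbrLoop hG (v := s.arr 13 i) a0 a1 (by simp) (hord i hi) (by norm_num)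
      (by simp [nop, Prog.regs, Op.regs]) (by simp [nop, Prog.arrs, Op.arrs])
      (fun P s'' c'' => IsExtent (s.arr 15) P i (s''.reg 10) (s''.reg 12) ∧
        c'' ≤ c' + 8 + 8 * P.card) ?_ ?_ ?_
    · intro j j'
      simp only [ne_eq, Nat.reduceEqDiff, not_false_eq_true, Function.update_self,
        Function.update_of_ne]
      exact ⟨⟨⟨le_rfl, le_rfl⟩, Or.inl rfl, Or.inl rfl, by simp⟩, by omega⟩
    · rintro P w s'' c'' j hw hwP hP hF' ⟨hE, hc'⟩
      have a15' : s''.arr 15 = s.arr 15 := by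
        rw [hF'.arr 15 (by simp [nbrLoop, nop, Prog.arrs, Op.arrs])]; exact a15
      simp only [nop, wp_seq, wp_op, wp_ite, Op.apply, Test.Holds, ne_eq, Nat.reduceEqDiff,
        not_false_eq_true, Function.update_self, Function.update_of_ne, a15',
        Finset.card_insert_of_notMem hwP]
      have hE1 := hE.le
      have hL := hE.left
      have hR := hE.right
      have hM := hE.mem
      have hL' : s''.reg 10 = i ∨ ∃ y ∈ insert w P, s.arr 15 y = s''.reg 10 := by
        rcases hL with h | ⟨y, hy, h⟩
        · exact Or.inl h
        · exact Or.inr ⟨y, Finset.mem_insert_of_mem hy, h⟩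
      have hR' : s''.reg 12 = i ∨ ∃ y ∈ insert w P, s.arr 15 y = s''.reg 12 := by
        rcases hR with h | ⟨y, hy, h⟩
        · exact Or.inl h
        · exact Or.inr ⟨y, Finset.mem_insert_of_mem hy, h⟩
      refine ⟨fun h => ⟨fun h' => ?_, fun h' => ?_⟩, fun h => ⟨fun h' => ?_, fun h' => ?_⟩⟩
      -- Both updates cannot occur: the current extent contains the position i, so no position is
      -- left of its start and right of its end.
      · omega
      · refine ⟨⟨by omega, Or.inr ⟨w, by simp, rfl⟩, hR', fun y hy => ?_⟩, by omega⟩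
        rcases Finset.mem_insert.1 hy with rfl | hy
        · omega
        · have := hM y hy
          omega
      · refine ⟨⟨by omega, hL', Or.inr ⟨w, by simp, rfl⟩, fun y hy => ?_⟩, by omega⟩
        rcases Finset.mem_insert.1 hy with rfl | hy
        · omega
        · have := hM y hy
          omega
      · refine ⟨⟨by omega, hL', hR', fun y hy => ?_⟩, by omega⟩
        rcases Finset.mem_insert.1 hy with rfl | hy
        · omega
        · have := hM y hy
          omega
    · rintro s'' c'' hF' ⟨hE, hc'⟩
      have r2 : s''.reg 2 = i := by
        rw [hF'.reg 2 (by simp [nbrLoop, nop, Prog.regs, Op.regs])]; simp [h2]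
      have a16 : s''.arr 16 = s'.arr 16 := by
        rw [hF'.arr 16 (by simp [nbrLoop, nop, Prog.arrs, Op.arrs])]
      have a17 : s''.arr 17 = s'.arr 17 := by
        rw [hF'.arr 17 (by simp [nbrLoop, nop, Prog.arrs, Op.arrs])]
      simp only [wp_seq, wp_op, Op.apply, Function.update_self, ne_eq, Nat.reduceEqDiff,
        not_false_eq_true, Function.update_of_ne, r2, a16, a17, Finset.sum_range_succ]
      refine ⟨trivial, fun v hv => ?_, by omega⟩
      rcases (show v < i ∨ v = i by omega) with hv | rfl
      · rw [Function.update_of_ne (by omega), Function.update_of_ne (by omega)]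
        exact hI v hv
      · rw [Function.update_self, Function.update_self]
        exact hE
  · rintro s' c' hF ⟨-, hI, hc⟩
    exact ⟨hI, by omega⟩

end

end RAM

/-! ### The greedy choice on position intervals -/

theorem hits_eq_add_one {V : Type*} {S L M : Finset V} {y : V} (hy : y ∈ S) (hyL : y ∉ L)
    (hM : ∀ x, x ∈ M ↔ x = y ∨ x ∈ L) : hits S M = hits S L + 1 := by
  classical
  rw [← hits_insert hy hyL]
  congr 1
  ext x
  rw [hM, Finset.mem_insert]

namespace RAM

/-- Mark the rightmost unmarked vertices between the positions in the registers `4` and `5`, until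
the number in register `6` is reached. -/
def enforce : Prog :=
  .op (.const 8 0) ;; .op (.copy 7 5) ;; .op (.succ 7) ;;
    .while (.lt 4 7) (.op (.pred 7) ;; .op (.load 9 13 7) ;; .op (.load 10 2 9) ;;
      .ite (.eq 10 18) nop (.op (.succ 8))) ;;
    .op (.copy 7 5) ;; .op (.succ 7) ;;
    .while (.lt 8 6) (.op (.pred 7) ;; .op (.load 9 13 7) ;; .op (.load 10 2 9) ;;
      .ite (.eq 10 18) (.op (.store 2 9 6) ;; .op (.succ 8)) nop)

/-- Enforce two marks around each pair and three marks around each triple of consecutive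
vertices. -/
def greedy : Prog :=
  .op (.const 2 1) ;; .op (.const 3 0) ;; .while (.lt 2 0) (
    .op (.load 10 16 2) ;;
    .ite (.lt 10 2) (.op (.load 4 16 3) ;; .op (.load 5 17 2) ;; .op (.const 6 2) ;; enforce ;;
        .op (.load 10 16 3) ;;
        .ite (.lt 10 3) (.op (.copy 11 3) ;; .op (.pred 11) ;; .op (.load 4 16 11) ;;
          .op (.const 6 3) ;; enforce) nop) nop ;;
    .op (.copy 3 2) ;; .op (.succ 2))

section

variable {n : ℕ}

/-- The vertices with a position between `a` and `b`. -/
def seg (pos : Fin n → ℕ) (a b : ℕ) : Finset (Fin n) :=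
  Finset.univ.filter fun v => a ≤ pos v ∧ pos v ≤ b

theorem mem_seg {pos : Fin n → ℕ} {a b : ℕ} {v : Fin n} :
    v ∈ seg pos a b ↔ a ≤ pos v ∧ pos v ≤ b := by
  simp [seg]

/-- `ord` and `pos` are inverse to each other, and `r` is compatible with the positions. -/
structure IsOrder (ord : ℕ → ℕ) (pos : Fin n → ℕ) (r : Fin n → ℝ) : Prop where
  pos_lt : ∀ v, pos v < n
  ord_pos : ∀ v, ord (pos v) = v
  exists_pos : ∀ p < n, ∃ v, pos v = p
  r_lt : ∀ u v, r u < r v ↔ pos u < pos v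

variable {ord : ℕ → ℕ} {pos : Fin n → ℕ} {r : Fin n → ℝ}

theorem IsOrder.r_le (h : IsOrder ord pos r) (u v : Fin n) : r u ≤ r v ↔ pos u ≤ pos v := by
  rw [← not_lt, ← not_lt, h.r_lt]

theorem IsOrder.pos_injective (h : IsOrder ord pos r) : Function.Injective pos := by
  intro u v huv
  have h1 := h.ord_pos u
  rw [huv, h.ord_pos v] at h1
  exact Fin.ext h1.symm

theorem IsOrder.r_injective (h : IsOrder ord pos r) : Function.Injective r := by
  intro u v huv
  exact h.pos_injective (le_antisymm ((h.r_le u v).1 huv.le) ((h.r_le v u).1 huv.ge))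

theorem IsOrder.hits_seg (h : IsOrder ord pos r) {y b : ℕ} (hy : y ≤ b) {v : Fin n}
    (hv : pos v = y) (L : Finset (Fin n)) :
    hits (seg pos y b) L = hits (seg pos (y + 1) b) L + if v ∈ L then 1 else 0 := by
  classical
  have : seg pos y b = insert v (seg pos (y + 1) b) := by
    ext w
    rw [Finset.mem_insert, mem_seg, mem_seg, ← h.pos_injective.eq_iff, hv]
    omega
  have hv' : v ∉ seg pos (y + 1) b := by rw [mem_seg]; omega
  rw [this, hits_eq_filter, hits_eq_filter, Finset.filter_insert]
  split_ifs
  · rw [Finset.card_insert_of_notMem]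
    rw [Finset.mem_filter]
    exact fun h => hv' h.1
  · rfl

theorem mem_output {s : State} {v : Fin n} : v ∈ output n s ↔ s.arr 2 v ≠ 0 := by
  simp [output]

/-- Marks are added one at a time, each at the rightmost unmarked position of the segment while the
comparison set has more hits there, so each addition preserves domination. The coefficient 13 is 6
for the counting scan plus 7 for the marking scan. -/
theorem wp_enforce (h : IsOrder ord pos r) {s : State} {c a b k : ℕ} (hord : s.arr 13 = ord)
    (hzero : s.reg 18 = 0) (ha : s.reg 4 = a) (hb : s.reg 5 = b) (hk : s.reg 6 = k) (hab : a ≤ b)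
    (hbn : b < n) (hk0 : 0 < k) (hkb : k ≤ b + 1 - a) (hL : ∀ v ∈ output n s, pos v ≤ b) :
    wp enforce (fun s' c' => (∀ v ∈ output n s', pos v ≤ b) ∧ output n s ⊆ output n s' ∧
      k ≤ hits (seg pos a b) (output n s') ∧
      (∀ L', k ≤ hits (seg pos a b) L' → Dominated r (output n s) L' →
        Dominated r (output n s') L') ∧ c' ≤ c + 7 + 13 * (b + 1 - a)) s c := by
  have hvert : ∀ y < n, ∃ v : Fin n, pos v = y ∧ ord y = v := fun y hy => by
    obtain ⟨v, rfl⟩ := h.exists_pos y hy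
    exact ⟨v, rfl, h.ord_pos v⟩
  simp only [enforce, wp_seq, wp_op, Op.apply]
  refine wp_while (fun s' c' => a ≤ s'.reg 7 ∧ s'.reg 7 ≤ b + 1 ∧
    s'.reg 8 = hits (seg pos (s'.reg 7) b) (output n s) ∧ c' ≤ c + 3 + 6 * (b + 1 - s'.reg 7))
    (fun s' => s'.reg 7) ?_ ?_ ?_
  · simp only [ne_eq, Nat.reduceEqDiff, not_false_eq_true, Function.update_self,
      Function.update_of_ne, hb]
    refine ⟨by omega, by omega, ?_, by omega⟩
    have : seg pos (b + 1) b = ∅ := by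
      ext v
      simp only [mem_seg, Finset.notMem_empty, iff_false]
      omega
    rw [this]
    simp [hits_eq]
  · rintro s' c' hF ⟨h1, h2, h8, hc⟩ hlt
    have r4 : s'.reg 4 = a := by
      rw [hF.reg 4 (by simp [nop, Prog.regs, Op.regs])]; simp [ha]
    have r18 : s'.reg 18 = 0 := by
      rw [hF.reg 18 (by simp [nop, Prog.regs, Op.regs])]; simp [hzero]
    have a13 : s'.arr 13 = ord := by
      rw [hF.arr 13 (by simp [nop, Prog.arrs, Op.arrs])]; simp [hord]
    have a2 : s'.arr 2 = s.arr 2 := by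
      rw [hF.arr 2 (by simp [nop, Prog.arrs, Op.arrs])]
    simp only [Test.Holds, r4] at hlt
    obtain ⟨y, hy⟩ : ∃ y, s'.reg 7 = y + 1 := ⟨s'.reg 7 - 1, by omega⟩
    obtain ⟨v, hv, hov⟩ := hvert y (by omega)
    have hstep := h.hits_seg (y := y) (b := b) (by omega) hv (output n s)
    simp only [nop, wp_seq, wp_op, wp_ite, Op.apply, Test.Holds, ne_eq, Nat.reduceEqDiff,
      not_false_eq_true, Function.update_self, Function.update_of_ne, hy, Nat.add_sub_cancel, a13,
      a2, r18, hov]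
    rw [hy] at h8 h1 h2 hc
    refine ⟨fun h0 => ?_, fun h0 => ?_⟩
    · rw [if_neg (by rw [mem_output]; simpa using h0)] at hstep
      refine ⟨⟨by omega, by omega, by omega, by omega⟩, by omega⟩
    · rw [if_pos (by rw [mem_output]; exact h0)] at hstep
      refine ⟨⟨by omega, by omega, by omega, by omega⟩, by omega⟩
  · rintro s' c' hF ⟨h1, h2, h8, hc⟩ hlt
    have r4 : s'.reg 4 = a := by
      rw [hF.reg 4 (by simp [nop, Prog.regs, Op.regs])]; simp [ha]
    have r5 : s'.reg 5 = b := by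
      rw [hF.reg 5 (by simp [nop, Prog.regs, Op.regs])]; simp [hb]
    have r6 : s'.reg 6 = k := by
      rw [hF.reg 6 (by simp [nop, Prog.regs, Op.regs])]; simp [hk]
    have r18 : s'.reg 18 = 0 := by
      rw [hF.reg 18 (by simp [nop, Prog.regs, Op.regs])]; simp [hzero]
    have a13 : s'.arr 13 = ord := by
      rw [hF.arr 13 (by simp [nop, Prog.arrs, Op.arrs])]; simp [hord]
    have a2 : s'.arr 2 = s.arr 2 := by
      rw [hF.arr 2 (by simp [nop, Prog.arrs, Op.arrs])]
    simp only [Test.Holds, r4, not_lt] at hlt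
    have e7 : s'.reg 7 = a := by omega
    rw [e7] at h8 hc
    simp only [wp_seq, wp_op, Op.apply, r5]
    refine wp_while (fun s'' c'' => a ≤ s''.reg 7 ∧ s''.reg 7 ≤ b + 1 ∧
      s''.reg 8 = hits (seg pos a b) (output n s'') ∧
      b + 1 - s''.reg 7 ≤ hits (seg pos (s''.reg 7) b) (output n s'') ∧
      (∀ v, s''.reg 7 ≤ pos v → pos v ≤ b → v ∈ output n s'') ∧
      (∀ v ∈ output n s'', pos v ≤ b) ∧ output n s ⊆ output n s'' ∧
      (∀ L', k ≤ hits (seg pos a b) L' → Dominated r (output n s) L' →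
        Dominated r (output n s'') L') ∧
      c'' ≤ c + 6 + 6 * (b + 1 - a) + 7 * (b + 1 - s''.reg 7)) (fun s'' => s''.reg 7) ?_ ?_ ?_
    · have ho : ∀ ρ, output n ⟨ρ, s'.arr⟩ = output n s := fun ρ => by
        ext v
        rw [mem_output, mem_output, a2]
      simp only [ne_eq, Nat.reduceEqDiff, not_false_eq_true, Function.update_self,
        Function.update_of_ne, ho]
      exact ⟨by omega, le_rfl, h8, by omega, fun v h1 h2 => by omega, hL, Finset.Subset.refl _,
        fun L' _ h => h, by omega⟩
    · rintro s'' c'' hF' ⟨g1, g2, g8, gy, gall, gb, gsub, gdom, gc⟩ glt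
      have r6' : s''.reg 6 = k := by
        rw [hF'.reg 6 (by simp [nop, Prog.regs, Op.regs])]; simp [r6]
      have r18' : s''.reg 18 = 0 := by
        rw [hF'.reg 18 (by simp [nop, Prog.regs, Op.regs])]; simp [r18]
      have a13' : s''.arr 13 = ord := by
        rw [hF'.arr 13 (by simp [nop, Prog.arrs, Op.arrs])]; exact a13
      simp only [Test.Holds, r6'] at glt
      -- If the scan had reached a, all b + 1 − a ≥ k positions would be marked and the loop would
      -- have stopped.
      have hya : a < s''.reg 7 := by
        by_contra hcon
        have : s''.reg 7 = a := by omega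
        rw [this] at gy
        omega
      obtain ⟨y, hy⟩ : ∃ y, s''.reg 7 = y + 1 := ⟨s''.reg 7 - 1, by omega⟩
      obtain ⟨v, hv, hov⟩ := hvert y (by omega)
      rw [hy] at g1 g2 gy gall gc
      have hstep := fun L => h.hits_seg (y := y) (b := b) (by omega) hv L
      have hvseg : v ∈ seg pos a b := by rw [mem_seg]; omega
      simp only [nop, wp_seq, wp_op, wp_ite, Op.apply, Test.Holds, ne_eq, Nat.reduceEqDiff,
        not_false_eq_true, Function.update_self, Function.update_of_ne, hy, Nat.add_sub_cancel,
        a13', r6', r18', hov]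
      refine ⟨fun h0 => ?_, fun h0 => ?_⟩
      · have hvL : v ∉ output n s'' := by rw [mem_output]; simpa using h0
        have ho : ∀ ρ w, w ∈ output n ⟨ρ, Function.update s''.arr 2
            (Function.update (s''.arr 2) v k)⟩ ↔ w = v ∨ w ∈ output n s'' := by
          intro ρ w
          simp only [mem_output, Function.update_self]
          by_cases hwv : w = v
          · subst hwv
            -- The mark written is k itself, which is nonzero.
            simp; omega
          · rw [Function.update_of_ne (fun h => hwv (Fin.ext h))]
            simp [hwv]
        generalize hout : output n _ = O
        have hO : ∀ w, w ∈ O ↔ w = v ∨ w ∈ output n s'' := by rw [← hout]; exact ho _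
        have hsubO : output n s'' ⊆ O := fun w hw => (hO w).2 (Or.inr hw)
        have hhits : hits (seg pos a b) O = hits (seg pos a b) (output n s'') + 1 :=
          hits_eq_add_one hvseg hvL hO
        have hyO := hstep O
        rw [if_pos ((hO v).2 (Or.inl rfl))] at hyO
        have hmono := hits_mono (le_refl (seg pos (y + 1) b)) hsubO
        refine ⟨⟨by omega, by omega, by omega, by omega, ?_, ?_, gsub.trans hsubO, ?_, by omega⟩,
          by omega⟩
        · intro w h1 h2
          rw [hO]
          by_cases hwy : pos w = y
          · left
            exact h.pos_injective (by rw [hwy, hv])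
          · exact Or.inr (gall w (by omega) h2)
        · intro w hw
          rcases (hO w).1 hw with rfl | hw
          · omega
          · exact gb w hw
        · intro L' hL' hdom
          -- No mark lies beyond b, so the marks in the segment are a final segment of all marks;
          -- every position of the segment right of y is already marked.
          refine (Dominated.insert_max h.r_injective (S := seg pos a b) ?_ hvseg hvL ?_
            (by omega) (gdom L' hL' hdom) hO)
          · intro x hx z hz hzx
            rw [h.r_le] at hzx
            rw [mem_seg] at hz ⊢
            exact ⟨hz.1.trans hzx, gb x hx⟩
          · intro x hx hxL
            rw [h.r_le, hv]
            by_contra hcon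
            rw [mem_seg] at hx
            exact hxL (gall x (by omega) hx.2)
      · have hvL : v ∈ output n s'' := by rw [mem_output]; exact h0
        have hyO := hstep (output n s'')
        rw [if_pos hvL] at hyO
        refine ⟨⟨by omega, by omega, g8, ?_, ?_, gb, gsub, gdom, by omega⟩, by omega⟩
        · change b + 1 - y ≤ hits (seg pos y b) (output n s'')
          omega
        · intro w h1 h2
          by_cases hwy : pos w = y
          · rw [h.pos_injective (hwy.trans hv.symm)]
            exact hvL
          · exact gall w (by omega) h2
    · rintro s'' c'' hF' ⟨g1, g2, g8, gy, gall, gb, gsub, gdom, gc⟩ glt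
      have r6' : s''.reg 6 = k := by
        rw [hF'.reg 6 (by simp [nop, Prog.regs, Op.regs])]; simp [r6]
      simp only [Test.Holds, r6', not_lt] at glt
      exact ⟨gb, gsub, by omega, gdom, by omega⟩

end

end RAM

/-! ### Greedy marking around consecutive pairs and triples. -/

namespace RAM

section

variable {n : ℕ} {ord : ℕ → ℕ} {pos : Fin n → ℕ} {r : Fin n → ℝ}

/-- The set `L` has two vertices around each pair and three vertices around each triple of
consecutive vertices in the same component, up to position `m`. -/
structure Covers (pos : Fin n → ℕ) (lo hi : ℕ → ℕ) (m : ℕ) (L : Finset (Fin n)) : Prop where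
  two : ∀ p, p + 1 < m → lo (p + 1) < p + 1 → 2 ≤ hits (seg pos (lo p) (hi (p + 1))) L
  three : ∀ p, p + 2 < m → lo (p + 2) < p + 2 → lo (p + 1) < p + 1 →
    3 ≤ hits (seg pos (lo p) (hi (p + 2))) L

theorem Covers.mono {lo hi : ℕ → ℕ} {m : ℕ} {L L' : Finset (Fin n)} (h : Covers pos lo hi m L)
    (hL : L ⊆ L') : Covers pos lo hi m L' :=
  ⟨fun p h1 h2 => (h.two p h1 h2).trans (hits_mono le_rfl hL),
    fun p h1 h2 h3 => (h.three p h1 h2 h3).trans (hits_mono le_rfl hL)⟩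

/-- Total length of the extents of the first `m` positions. -/
def extentSum (lo hi : ℕ → ℕ) (m : ℕ) : ℕ := ∑ p ∈ Finset.range m, (hi p + 1 - lo p)

theorem extentSum_succ (lo hi : ℕ → ℕ) (m : ℕ) :
    extentSum lo hi (m + 1) = extentSum lo hi m + (hi m + 1 - lo m) :=
  Finset.sum_range_succ _ _

/-- A segment around a pair or triple is no longer than the sum of the extents of its members. Each
extent is thus paid for by at most two pairs and three triples, five times 13 steps per unit.
Monotonicity of `hi` keeps all marks left of the end of the current segment. -/
theorem wp_greedy (h : IsOrder ord pos r) {lo hi : ℕ → ℕ} {s : State} {c : ℕ}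
    (hn : s.reg 0 = n) (hzero : s.reg 18 = 0) (hord : s.arr 13 = ord) (hlo : s.arr 16 = lo)
    (hhi : s.arr 17 = hi) (hout : ∀ i, s.arr 2 i = 0) (hlop : ∀ p < n, lo p ≤ p)
    (hhip : ∀ p < n, p ≤ hi p ∧ hi p < n) (hmono : ∀ p, p + 1 < n → hi p ≤ hi (p + 1)) :
    wp greedy (fun s' c' => Covers pos lo hi n (output n s') ∧
      (∀ L', Covers pos lo hi n L' → Dominated r (output n s') L') ∧
      c' ≤ c + 3 + 30 * n + 65 * extentSum lo hi n) s c := by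
  simp only [greedy, wp_seq, wp_op, Op.apply]
  -- The loop starts at position 1, so n − 1 rounds is the right count only for positive n; for n =
  -- 0 the test fails at once.
  rcases Nat.eq_zero_or_pos n with hn0 | hpos
  · refine wp_for (fun _ s' c' => s'.reg 2 = 1 ∧ c' = c + 2) (k := 0) (N := 0) le_rfl ?_ ?_ ?_ ?_
    · simp
    · intro i s' c' hF hI
      have r0 : s'.reg 0 = n := by
        rw [hF.reg 0 (by simp [enforce, nop, Prog.regs, Op.regs])]; simp [hn]
      simp [Test.Holds, hI.1, r0, hn0]
    · exact fun i s' c' _ h => absurd h (by omega)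
    · rintro s' c' - ⟨-, hc⟩
      refine ⟨⟨fun p hp => by omega, fun p hp => by omega⟩, fun L' _ => ?_, by omega⟩
      have : output n s' = ∅ := by
        subst hn0
        exact Finset.eq_empty_of_isEmpty _
      rw [this]
      exact Dominated.empty _ _
  refine wp_for (fun i s' c' => s'.reg 3 = i ∧ s'.reg 2 = i + 1 ∧
    Covers pos lo hi (i + 1) (output n s') ∧
    (∀ L', Covers pos lo hi n L' → Dominated r (output n s') L') ∧
    (∀ v ∈ output n s', pos v ≤ hi i) ∧
    c' ≤ c + 2 + 30 * i + 13 * (2 * extentSum lo hi (i + 1) + 2 * extentSum lo hi i +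
      extentSum lo hi (i - 1)))
    (k := 0) (N := n - 1) (Nat.zero_le _) ?_ ?_ ?_ ?_
  · have ho : ∀ ρ, output n ⟨ρ, s.arr⟩ = ∅ := fun ρ => by
      ext v
      simp [mem_output, hout]
    simp only [ne_eq, Nat.reduceEqDiff, not_false_eq_true, Function.update_self,
      Function.update_of_ne, ho]
    exact ⟨trivial, trivial, ⟨fun p hp => by omega, fun p hp => by omega⟩,
      fun L' _ => Dominated.empty _ _, by simp, by omega⟩
  · intro i s' c' hF hI
    have r0 : s'.reg 0 = n := by
      rw [hF.reg 0 (by simp [enforce, nop, Prog.regs, Op.regs])]; simp [hn]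
    simp only [Test.Holds, hI.2.1, r0]
    omega
  · rintro i s' c' - hi' hF ⟨h3, h2, hcov, hdom, hle, hc⟩
    have r18 : s'.reg 18 = 0 := by
      rw [hF.reg 18 (by simp [enforce, nop, Prog.regs, Op.regs])]; simp [hzero]
    have a13 : s'.arr 13 = ord := by
      rw [hF.arr 13 (by simp [enforce, nop, Prog.arrs, Op.arrs])]; exact hord
    have a16 : s'.arr 16 = lo := by
      rw [hF.arr 16 (by simp [enforce, nop, Prog.arrs, Op.arrs])]; exact hlo
    have a17 : s'.arr 17 = hi := by
      rw [hF.arr 17 (by simp [enforce, nop, Prog.arrs, Op.arrs])]; exact hhi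
    have q1 := hlop i (by omega)
    have q2 := hlop (i + 1) (by omega)
    have q3 := hhip i (by omega)
    have q4 := hhip (i + 1) (by omega)
    have q5 := hmono i (by omega)
    have e1 := extentSum_succ lo hi (i + 1)
    have e2 := extentSum_succ lo hi i
    -- Admitting position i + 1 creates only one new pair and one new triple, both ending there.
    have hcov2 : ∀ L, Covers pos lo hi (i + 1) L →
        (lo (i + 1) < i + 1 → 2 ≤ hits (seg pos (lo i) (hi (i + 1))) L) →
        (∀ j, i = j + 1 → lo (i + 1) < i + 1 → lo i < i →
          3 ≤ hits (seg pos (lo j) (hi (i + 1))) L) → Covers pos lo hi (i + 2) L := by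
      intro L hL h2 h3
      refine ⟨fun p hp hp' => ?_, fun p hp hp' hp'' => ?_⟩
      · rcases (show p + 1 < i + 1 ∨ p = i by omega) with hp | rfl
        · exact hL.two p hp hp'
        · exact h2 hp'
      · rcases (show p + 2 < i + 1 ∨ i = p + 1 by omega) with hp | rfl
        · exact hL.three p hp hp' hp''
        · exact h3 p rfl hp' hp''
    simp only [nop, wp_seq, wp_op, wp_ite, Op.apply, Test.Holds, ne_eq, Nat.reduceEqDiff,
      not_false_eq_true, Function.update_self, Function.update_of_ne, h2, h3, a16, a17]
    refine ⟨fun hlt => ?_, fun hlt => ?_⟩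
    · refine wp_mono (wp_enforce (s := ⟨Function.update (Function.update (Function.update
        (Function.update s'.reg 10 _) 4 _) 5 _) 6 2, s'.arr⟩) h (a := lo i) (b := hi (i + 1))
        (k := 2) a13 (by simp [r18]) rfl rfl rfl (by omega) (by omega) (by omega) (by omega)
        (fun v hv => (hle v hv).trans q5)) ?_
      rintro s₁ c₁ hF₁ ⟨hle₁, hsub₁, hk₁, hdom₁, hc₁⟩
      have f3 : s₁.reg 3 = i := by
        rw [hF₁.reg 3 (by simp [enforce, nop, Prog.regs, Op.regs])]; simp [h3]
      have f2 : s₁.reg 2 = i + 1 := by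
        rw [hF₁.reg 2 (by simp [enforce, nop, Prog.regs, Op.regs])]; simp [h2]
      have f5 : s₁.reg 5 = hi (i + 1) := by
        rw [hF₁.reg 5 (by simp [enforce, nop, Prog.regs, Op.regs])]; simp
      have f18 : s₁.reg 18 = 0 := by
        rw [hF₁.reg 18 (by simp [enforce, nop, Prog.regs, Op.regs])]; simp [r18]
      have b13 : s₁.arr 13 = ord := by
        rw [hF₁.arr 13 (by simp [enforce, nop, Prog.arrs, Op.arrs])]; exact a13
      have b16 : s₁.arr 16 = lo := by
        rw [hF₁.arr 16 (by simp [enforce, nop, Prog.arrs, Op.arrs])]; exact a16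
      have hcov₁ := hcov.mono hsub₁
      have hdom₁' : ∀ L', Covers pos lo hi n L' → Dominated r (output n s₁) L' := fun L' hL' =>
        hdom₁ L' (hL'.two i (by omega) hlt) (hdom L' hL')
      simp only [wp_seq, wp_op, wp_ite, Op.apply, Test.Holds, ne_eq, Nat.reduceEqDiff,
        not_false_eq_true, Function.update_self, Function.update_of_ne, f2, f3, b16]
      refine ⟨fun hlt' => ?_, fun hlt' => ?_⟩
      · obtain ⟨j, rfl⟩ : ∃ j, i = j + 1 := ⟨i - 1, by omega⟩
        have q6 := hlop j (by omega)
        have q7 := hhip j (by omega)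
        have e3 := extentSum_succ lo hi j
        simp only [Nat.add_sub_cancel] at hc ⊢
        refine wp_mono (wp_enforce (s := ⟨Function.update (Function.update (Function.update
          (Function.update (Function.update s₁.reg 10 _) 11 _) 11 _) 4 _) 6 3, s₁.arr⟩) h
          (a := lo j) (b := hi (j + 1 + 1)) (k := 3) b13 (by simp [f18]) (by simp)
          (by simp [f5]) (by simp) (by omega) (by omega) (by omega) (by omega) hle₁) ?_
        rintro s₂ c₂ hF₂ ⟨hle₂, hsub₂, hk₂, hdom₂, hc₂⟩
        have g2 : s₂.reg 2 = j + 1 + 1 := by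
          rw [hF₂.reg 2 (by simp [enforce, nop, Prog.regs, Op.regs])]; simp [f2]
        simp only [wp_seq, wp_op, Op.apply, ne_eq, Nat.reduceEqDiff,
          not_false_eq_true, Function.update_self, Function.update_of_ne, g2]
        refine ⟨trivial, trivial, hcov2 _ (hcov₁.mono hsub₂)
          (fun _ => hk₁.trans (hits_mono le_rfl hsub₂)) ?_, fun L' hL' =>
          hdom₂ L' (hL'.three j (by omega) hlt hlt') (hdom₁' L' hL'), hle₂, ?_⟩
        · intro j' hj' _ _
          obtain rfl : j = j' := by omega
          exact hk₂
        · omega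
      · refine ⟨trivial, trivial, hcov2 _ hcov₁ (fun _ => hk₁) (fun _ _ _ h => absurd h hlt'),
          hdom₁', hle₁, ?_⟩
        have e3 : extentSum lo hi (i - 1) ≤ extentSum lo hi i :=
          Finset.sum_le_sum_of_subset (by simp)
        simp only [Nat.add_sub_cancel]
        omega
    · refine ⟨trivial, trivial, hcov2 _ hcov (fun h => absurd h hlt) (fun _ _ h => absurd h hlt),
        hdom, fun v hv => (hle v hv).trans q5, ?_⟩
      have e3 : extentSum lo hi (i - 1) ≤ extentSum lo hi i :=
        Finset.sum_le_sum_of_subset (by simp)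
      simp only [Nat.add_sub_cancel]
      omega
  · rintro s' c' hF ⟨h3, h2, hcov, hdom, hle, hc⟩
    have m1 : extentSum lo hi (n - 1) ≤ extentSum lo hi n :=
      Finset.sum_le_sum_of_subset (by simp)
    have m2 : extentSum lo hi (n - 1 - 1) ≤ extentSum lo hi n :=
      Finset.sum_le_sum_of_subset (by simp; omega)
    rw [Nat.sub_add_cancel hpos] at hcov hc
    exact ⟨hcov, hdom, by omega⟩

end

end RAM

/-! ### From positions to interval representations -/

section Representation

variable {V : Type*} {G : SimpleGraph V}

/-- Take [pos v, hi v + pos v / N]. The added fraction makes right endpoints strictly increasing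
where `hi` has ties, which excludes containment. It is less than 1 and left endpoints are integers,
so no new intersection arises. -/
theorem exists_properIntervalRep {pos hi : V → ℕ} {N : ℕ} (hN : ∀ v, pos v < N)
    (hinj : Function.Injective pos) (hle : ∀ v, pos v ≤ hi v)
    (hadj : ∀ u v, pos u < pos v → (G.Adj u v ↔ pos v ≤ hi u))
    (hmono : ∀ u v, pos u < pos v → hi u ≤ hi v) :
    ∃ R : ProperIntervalRep G, ∀ u v, R.r u < R.r v ↔ pos u < pos v := by
  have hfrac : ∀ v, 0 ≤ (pos v : ℝ) / N ∧ (pos v : ℝ) / N < 1 := fun v => by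
    have hN0 : (0 : ℝ) < N := by
      have := hN v
      exact_mod_cast (show 0 < N by omega)
    refine ⟨by positivity, ?_⟩
    rw [div_lt_one hN0]
    exact_mod_cast hN v
  have hr : ∀ u v, pos u < pos v → (hi u : ℝ) + pos u / N < hi v + pos v / N := by
    intro u v huv
    have hN0 : (0 : ℝ) < N := by
      have := hN v
      exact_mod_cast (show 0 < N by omega)
    have h1 : (hi u : ℝ) ≤ hi v := by exact_mod_cast hmono u v huv
    have h2 : (pos u : ℝ) / N < pos v / N := by
      apply div_lt_div_of_pos_right _ hN0
      exact_mod_cast huv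
    linarith
  have hlr : ∀ v, (pos v : ℝ) ≤ hi v + pos v / N := fun v => by
    have h1 : (pos v : ℝ) ≤ hi v := by exact_mod_cast hle v
    linarith [(hfrac v).1]
  have key : ∀ u v, pos u < pos v → (G.Adj u v ↔
      (Set.Icc (pos u : ℝ) (hi u + pos u / N) ∩
        Set.Icc (pos v : ℝ) (hi v + pos v / N)).Nonempty) := by
    intro u v huv
    rw [hadj u v huv]
    have huv' : (pos u : ℝ) < pos v := by exact_mod_cast huv
    constructor
    · intro h
      have h' : (pos v : ℝ) ≤ hi u := by exact_mod_cast h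
      exact ⟨pos v, ⟨huv'.le, by linarith [(hfrac u).1]⟩, ⟨le_rfl, hlr v⟩⟩
    · rintro ⟨x, hx, hx'⟩
      have h1 : (pos v : ℝ) < hi u + 1 := by linarith [hx.2, hx'.1, (hfrac u).2]
      have h2 : pos v < hi u + 1 := by exact_mod_cast h1
      omega
  refine ⟨⟨fun v => pos v, fun v => hi v + pos v / N, hlr, ?_, ?_⟩, ?_⟩
  · intro u v huv
    rcases lt_or_gt_of_ne (hinj.ne huv) with h | h
    · exact key u v h
    · rw [G.adj_comm, Set.inter_comm]
      exact key v u h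
  · intro u v huv hsub
    rcases lt_or_gt_of_ne (hinj.ne huv) with h | h
    · have := (hsub ⟨le_rfl, hlr u⟩).1
      have h' : (pos u : ℝ) < pos v := by exact_mod_cast h
      linarith
    · have := (hsub ⟨hlr u, le_rfl⟩).2
      linarith [hr v u h]
  · intro u v
    refine ⟨fun h => ?_, hr u v⟩
    by_contra hcon
    rcases (not_lt.1 hcon).eq_or_lt with h' | h'
    · rw [hinj h'] at h
      exact lt_irrefl _ h
    · exact lt_asymm h (hr v u h')

theorem exists_edgeIntervalOrdering [Finite V] (R : ProperIntervalRep G) :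
    ∃ σ, IsEdgeIntervalOrdering R σ := by
  classical
  cases nonempty_fintype V
  let key : V × V → ℝ ×ₗ ℝ := fun e => toLex (R.r e.2, R.r e.1)
  have hkey : Function.Injective key := by
    rintro ⟨a, b⟩ ⟨a', b'⟩ h
    have h1 := congrArg (fun x => (ofLex x).1) h
    have h2 := congrArg (fun x => (ofLex x).2) h
    rw [Prod.mk.injEq]
    exact ⟨R.r_injective h2, R.r_injective h1⟩
  let _ : LinearOrder (V × V) := LinearOrder.lift' key hkey
  let E : Finset (V × V) := Finset.univ.filter fun e => G.Adj e.1 e.2 ∧ R.r e.1 < R.r e.2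
  refine ⟨E.sort (· ≤ ·), ?_, fun u v => ?_⟩
  · refine (Finset.sortedLT_sort E).pairwise.imp ?_
    intro e f hef
    have hlt : key e < key f := hef
    rw [Prod.Lex.lt_iff] at hlt
    rcases hlt with h | ⟨h, h'⟩
    · exact Or.inl h
    · exact Or.inr ⟨R.r_injective h, h'⟩
  · rw [Finset.mem_sort]
    simp [E]

end Representation

/-! ### Domination in terms of positions -/

open Classical in
theorem mem_edgeNbhd_union {V : Type*} [Fintype V] {G : SimpleGraph V} {e f : Sym2 V} {x : V} :
    x ∈ edgeNbhd G e ∪ edgeNbhd G f ↔ x ∈ edgeNbhd G e ∨ x ∈ edgeNbhd G f :=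
  Finset.mem_union

namespace RAM

section

variable {n : ℕ} {G : SimpleGraph (Fin n)} {pos : Fin n → ℕ} {lo hi : ℕ → ℕ}

/-- The closed neighbourhood of the vertex at position `p` consists of the positions from `lo p`
to `hi p`. -/
structure Extents (G : SimpleGraph (Fin n)) (pos : Fin n → ℕ) (lo hi : ℕ → ℕ) : Prop where
  inj : Function.Injective pos
  pos_lt : ∀ v, pos v < n
  exists_pos : ∀ p < n, ∃ v, pos v = p
  adj : ∀ u v, u = v ∨ G.Adj v u ↔ lo (pos v) ≤ pos u ∧ pos u ≤ hi (pos v)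
  lo_le : ∀ p < n, lo p ≤ p
  le_hi : ∀ p < n, p ≤ hi p ∧ hi p < n
  lo_mono : ∀ p q, p ≤ q → q < n → lo p ≤ lo q
  hi_mono : ∀ p q, p ≤ q → q < n → hi p ≤ hi q

/-- The two closed neighbourhoods overlap as u and v are adjacent; by monotonicity the union starts
with that of u and ends with that of v. -/
theorem Extents.edgeNbhd_eq (h : Extents G pos lo hi) {u v : Fin n} (huv : G.Adj u v)
    (hlt : pos u < pos v) : edgeNbhd G s(u, v) = seg pos (lo (pos u)) (hi (pos v)) := by
  ext x
  rw [mem_edgeNbhd, h.adj, h.adj, mem_seg]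
  have h1 := ((h.adj v u).1 (Or.inr huv))
  have h2 := h.lo_mono _ _ hlt.le (h.pos_lt v)
  have h3 := h.hi_mono _ _ hlt.le (h.pos_lt v)
  have h4 := ((h.adj u v).1 (Or.inr huv.symm))
  omega

/-- If a vertex has any neighbour on its left, its immediate predecessor is one. This is how the
program recognizes that consecutive positions belong together. -/
theorem Extents.adj_of_lt (h : Extents G pos lo hi) {u v : Fin n} {p : ℕ} (hu : pos u = p)
    (hv : pos v = p + 1) (hlo : lo (p + 1) < p + 1) : G.Adj u v := by
  have hle := h.le_hi (p + 1) (by rw [← hv]; exact h.pos_lt v)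
  have := (h.adj u v).2 (by rw [hu, hv]; omega)
  rcases this with rfl | hadj
  · omega
  · exact hadj.symm

theorem Extents.covers (h : Extents G pos lo hi) {L : Finset (Fin n)}
    (hL : IsLiarVEDominating G L) : Covers pos lo hi n L := by
  classical
  rw [isLiarVEDominating_iff] at hL
  constructor
  · intro p hp hlo
    obtain ⟨u, hu⟩ := h.exists_pos p (by omega)
    obtain ⟨v, hv⟩ := h.exists_pos (p + 1) hp
    have hadj := h.adj_of_lt hu hv hlo
    have := hL.1 s(u, v) hadj
    rwa [h.edgeNbhd_eq hadj (by omega), hu, hv] at this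
  · intro p hp hlo hlo'
    obtain ⟨u, hu⟩ := h.exists_pos p (by omega)
    obtain ⟨v, hv⟩ := h.exists_pos (p + 1) (by omega)
    obtain ⟨w, hw⟩ := h.exists_pos (p + 2) hp
    have huv := h.adj_of_lt hu hv hlo'
    have hvw := h.adj_of_lt hv hw hlo
    have hne : s(u, v) ≠ s(v, w) := by
      intro heq
      rw [Sym2.eq_iff] at heq
      rcases heq with ⟨rfl, -⟩ | ⟨rfl, -⟩ <;> omega
    refine (hL.2 _ huv _ hvw hne).trans (hits_mono ?_ le_rfl)
    have h1 := h.lo_mono p (p + 1) (by omega) (by omega)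
    have h2 := h.hi_mono (p + 1) (p + 2) (by omega) (by omega)
    intro x hx
    rw [mem_edgeNbhd_union, h.edgeNbhd_eq huv (by omega), h.edgeNbhd_eq hvw (by omega), mem_seg,
      mem_seg, hu, hv, hw] at hx
    rw [mem_seg]
    omega

/-- Disjoint neighbourhoods already give 2 + 2 hits. Otherwise their union has no gap and, with v'
at position p + 2 and u at most at p, contains the segment around the triple ending at v'. -/
theorem Extents.three_le (h : Extents G pos lo hi) {L : Finset (Fin n)}
    (hL : Covers pos lo hi n L) (htwo : ∀ e ∈ G.edgeSet, 2 ≤ hits (edgeNbhd G e) L)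
    {u v u' v' : Fin n} (huv : G.Adj u v) (huv' : G.Adj u' v') (hlt : pos u < pos v)
    (hlt' : pos u' < pos v') (hle : pos v < pos v' ∨ pos v = pos v' ∧ pos u < pos u')
    {W : Finset (Fin n)} (hW : ∀ x, x ∈ edgeNbhd G s(u, v) ∨ x ∈ edgeNbhd G s(u', v') → x ∈ W) :
    3 ≤ hits W L := by
  classical
  by_cases hdis : hi (pos v) < lo (pos u')
  · have h1 := htwo s(u, v) huv
    have h2 := htwo s(u', v') huv'
    have hd : Disjoint (edgeNbhd G s(u, v)) (edgeNbhd G s(u', v')) := by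
      rw [Finset.disjoint_left]
      intro x hx hx'
      rw [h.edgeNbhd_eq huv hlt, mem_seg] at hx
      rw [h.edgeNbhd_eq huv' hlt', mem_seg] at hx'
      omega
    have h3 : hits (edgeNbhd G s(u, v)) L + hits (edgeNbhd G s(u', v')) L ≤ hits W L := by
      rw [hits_eq_filter, hits_eq_filter, hits_eq_filter, ← Finset.card_union_of_disjoint]
      · refine Finset.card_le_card fun x hx => ?_
        rw [Finset.mem_union, Finset.mem_filter, Finset.mem_filter] at hx
        rw [Finset.mem_filter]
        rcases hx with hx | hx
        · exact ⟨hW x (Or.inl hx.1), hx.2⟩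
        · exact ⟨hW x (Or.inr hx.1), hx.2⟩
      · exact Finset.disjoint_filter_filter hd
    omega
  · have g1 := (h.adj u' v').1 (Or.inr huv'.symm)
    have g2 := (h.adj u v).1 (Or.inr huv.symm)
    -- Two positions precede v': those of u and v if the right ends differ, those of u and u' if
    -- they agree.
    obtain ⟨p, hp⟩ : ∃ p, pos v' = p + 2 := ⟨pos v' - 2, by omega⟩
    have hpn : p + 2 < n := by rw [← hp]; exact h.pos_lt v'
    obtain ⟨w, hw⟩ := h.exists_pos (p + 1) (by omega)
    have hlow : lo (p + 1) < p + 1 := by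
      -- A vertex left of p + 1 whose neighbourhood reaches p + 1 shows that the middle of the
      -- triple has a left neighbour. One of u, v, u' is such a vertex; v is needed when the two
      -- edges merely have touching neighbourhoods.
      have step : ∀ x : Fin n, pos x < p + 1 → p + 1 ≤ hi (pos x) → lo (p + 1) < p + 1 := by
        intro x hx hx'
        have h1 := h.lo_le (pos x) (h.pos_lt x)
        rcases (h.adj w x).2 (by rw [hw]; omega) with rfl | hadj
        · omega
        · have := (h.adj x w).1 (Or.inr hadj.symm)
          rw [hw] at this
          omega
      rcases hle with hle | ⟨hle, hle'⟩
      · by_cases hpu' : pos u' < p + 1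
        · exact step u' hpu' (by have := ((h.adj v' u').1 (Or.inr huv')).2; omega)
        · have hpu : pos u' = p + 1 := by omega
          rw [hpu] at hdis
          by_cases hpv : pos v < p + 1
          · by_contra hcon
            exact hcon (step v hpv (by omega))
          · have := (h.adj v u).1 (Or.inr huv)
            exact step u (by omega) (by omega)
      · exact step u (by omega) (by have := ((h.adj v u).1 (Or.inr huv)).2; omega)
    have hthree := hL.three p hpn (by rw [← hp]; omega) hlow
    refine hthree.trans (hits_mono ?_ le_rfl)
    intro x hx
    rw [mem_seg] at hx
    apply hW
    rw [h.edgeNbhd_eq huv hlt, h.edgeNbhd_eq huv' hlt', mem_seg, mem_seg]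
    have := h.lo_mono (pos u) p (by omega) (by omega)
    rw [hp]
    omega

/-- An edge with right end at p + 1 has its left end at p or before, so its neighbourhood contains
the segment of the consecutive pair; pairs of edges are reduced to triples by `Extents.three_le`. -/
theorem Extents.isLiarVEDominating (h : Extents G pos lo hi) {L : Finset (Fin n)}
    (hL : Covers pos lo hi n L) : IsLiarVEDominating G L := by
  classical
  have hform : ∀ e ∈ G.edgeSet, ∃ u v, e = s(u, v) ∧ G.Adj u v ∧ pos u < pos v := by
    intro e he
    induction e using Sym2.ind with
    | _ u v =>
    rcases lt_or_gt_of_ne (h.inj.ne (SimpleGraph.Adj.ne he)) with hlt | hlt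
    · exact ⟨u, v, rfl, he, hlt⟩
    · exact ⟨v, u, Sym2.eq_swap, SimpleGraph.Adj.symm he, hlt⟩
  have htwo : ∀ e ∈ G.edgeSet, 2 ≤ hits (edgeNbhd G e) L := by
    intro e he
    obtain ⟨u, v, rfl, huv, hlt⟩ := hform e he
    obtain ⟨p, hp⟩ : ∃ p, pos v = p + 1 := ⟨pos v - 1, by omega⟩
    have hpn : p + 1 < n := by rw [← hp]; exact h.pos_lt v
    have h1 := ((h.adj u v).1 (Or.inr huv.symm)).1
    refine (hL.two p hpn (by rw [← hp]; omega)).trans (hits_mono ?_ le_rfl)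
    intro x hx
    rw [h.edgeNbhd_eq huv hlt]
    rw [mem_seg] at hx ⊢
    have := h.lo_mono (pos u) p (by omega) (by omega)
    rw [hp]
    omega
  rw [isLiarVEDominating_iff]
  refine ⟨htwo, fun e he f hf hne => ?_⟩
  obtain ⟨u, v, rfl, huv, hlt⟩ := hform e he
  obtain ⟨u', v', rfl, huv', hlt'⟩ := hform f hf
  rcases lt_trichotomy (pos v) (pos v') with hv | hv | hv
  · exact h.three_le hL htwo huv huv' hlt hlt' (Or.inl hv) fun x hx => mem_edgeNbhd_union.2 hx
  · rcases lt_trichotomy (pos u) (pos u') with hu | hu | hu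
    · exact h.three_le hL htwo huv huv' hlt hlt' (Or.inr ⟨hv, hu⟩) fun x hx =>
        mem_edgeNbhd_union.2 hx
    · rw [h.inj hu, h.inj hv] at hne
      exact absurd rfl hne
    · exact h.three_le hL htwo huv' huv hlt' hlt (Or.inr ⟨hv.symm, hu⟩) fun x hx =>
        mem_edgeNbhd_union.2 hx.symm
  · exact h.three_le hL htwo huv' huv hlt' hlt (Or.inl hv) fun x hx => mem_edgeNbhd_union.2 hx.symm

end

end RAM

/-! ### From breadth-first searches to an umbrella ordering -/

namespace RAM

section

variable {n : ℕ} {H : SimpleGraph ℕ} {off adj : ℕ → ℕ}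

theorem mem_nbrs_iff {v w : ℕ} : w ∈ nbrs n H v ↔ w < n ∧ H.Adj v w := by
  classical
  rw [nbrs, Finset.mem_filter, Finset.mem_range]

theorem AdjLists.lt_of_reachable (hG : AdjLists n H off adj) {s x : ℕ} (h : H.Reachable s x)
    (hne : x ≠ s) : x < n := by
  obtain ⟨w⟩ := h.symm
  cases w with
  | nil => exact absurd rfl hne
  | cons h _ => exact (hG.lt _ _ h).1

theorem AdjLists.finite_reachable (hG : AdjLists n H off adj) (s : ℕ) :
    {x | H.Reachable s x}.Finite := by
  refine ((Set.finite_lt_nat n).insert s).subset fun x hx => ?_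
  by_cases hxs : x = s
  · exact Or.inl hxs
  · exact Or.inr (hG.lt_of_reachable hx hxs)

theorem AdjLists.ncard_neighborSet (hG : AdjLists n H off adj) (v : ℕ) :
    (H.neighborSet v).ncard = (nbrs n H v).card := by
  rw [← Set.ncard_coe_finset]
  congr 1
  ext w
  simp [hG.mem_nbrs]

variable {src : Set ℕ} {D B : ℕ → ℕ} {nb : ℕ}

/-- Levels drop along parents, so following them ends in a root. Roots are unique in their
components, so every other vertex there has a parent. -/
theorem BfsResult.exists_root (h : BfsResult n H src D B nb) (hG : AdjLists n H off adj) {x : ℕ}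
    (hx : x < n) : ∃ s ∈ src, Layering H D s ∧ H.Reachable s x := by
  obtain ⟨roots, hsub, huniq, hpar⟩ := h.roots
  have key : ∀ d x, x < n → D x = d → ∃ s ∈ roots, H.Reachable s x := by
    intro d
    induction d using Nat.strong_induction_on with
    | _ d ih =>
    intro x hx hd
    rcases hpar x hx with hr | ⟨y, hxy, hD⟩
    · exact ⟨x, hr, .rfl⟩
    · obtain ⟨s, hs, hsy⟩ := ih (D y) (by omega) y (hG.lt _ _ hxy).2 rfl
      exact ⟨s, hs, hsy.trans hxy.symm.reachable⟩
  obtain ⟨s, hs, hsx⟩ := key _ x hx rfl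
  refine ⟨s, hsub hs, ⟨h.adj_le, fun y hy hne => ?_⟩, hsx⟩
  rcases hpar y (hG.lt_of_reachable hy hne) with hr | hr
  · exact absurd (huniq s hs y hr hy).symm hne
  · exact hr

theorem BfsResult.exists_end_order (h : BfsResult n H src D B nb) (hG : AdjLists n H off adj)
    {ρ : ℕ → ℝ} (hinj : Function.Injective ρ) (hU : Umbrella H ρ) {k : ℕ} (hk : k < nb) :
    ∃ ρ' : ℕ → ℝ, Function.Injective ρ' ∧ Umbrella H ρ' ∧
      ∀ x, H.Reachable (B k) x → ρ' (B k) ≤ ρ' x := by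
  obtain ⟨hz, hbest⟩ := h.best k hk
  obtain ⟨s, -, hD, hs⟩ := h.exists_root hG hz
  refine _root_.exists_end_order hD hinj hU (hG.finite_reachable s) hs
    (fun x hx => (hbest x (hs.symm.trans hx)).2.1) fun x hx hxD => ?_
  rw [hG.ncard_neighborSet, hG.ncard_neighborSet]
  exact (hbest x (hs.symm.trans hx)).2.2 hxD

/-- The sources of the second search are the vertices found by the first one, hence each root is an
end of some umbrella order. That order may depend on the component. -/
theorem BfsResult.adj_of_layerLE {D₁ B₁ : ℕ → ℕ} {nb₁ : ℕ} (h₁ : BfsResult n H src D₁ B₁ nb₁)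
    (h : BfsResult n H {x | ∃ i < nb₁, B₁ i = x} D B nb) (hG : AdjLists n H off adj)
    {ρ : ℕ → ℝ} (hinj : Function.Injective ρ) (hU : Umbrella H ρ) {u v w : ℕ} (hv : v < n)
    (huv : u ≠ v) (hvw : v ≠ w) (huv' : LayerLE H D u v) (hvw' : LayerLE H D v w)
    (huw : H.Adj u w) : H.Adj u v ∧ H.Adj v w := by
  refine _root_.adj_of_layerLE hG.finite_reachable ?_ ?_ huv hvw huv' hvw' huw
  · obtain ⟨s, ⟨i, hi, rfl⟩, hD, hs⟩ := h.exists_root hG (hG.lt _ _ huw).1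
    exact ⟨B₁ i, hs, hD, h₁.exists_end_order hG hinj hU hi⟩
  · rintro (he | he)
    · exact (h.same v hv u he).symm
    · exact huw.reachable.trans (h.same v hv w he).symm

theorem exists_pos_eq {pos : Fin n → ℕ} (hinj : Function.Injective pos) (hlt : ∀ v, pos v < n)
    {p : ℕ} (hp : p < n) : ∃ v, pos v = p := by
  have hi : Function.Injective fun v => (⟨pos v, hlt v⟩ : Fin n) := fun u v h =>
    hinj (congrArg Fin.val h)
  obtain ⟨v, hv⟩ := Finite.injective_iff_surjective.1 hi ⟨p, hp⟩
  exact ⟨v, congrArg Fin.val hv⟩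

theorem Sorted.exists_eq {X K Y : ℕ → ℕ} (h : Sorted n X K Y) {p : ℕ} (hp : p < n) :
    ∃ i < n, Y p = X i := by
  obtain ⟨rk, hrk, hlt⟩ := h
  obtain ⟨i, hi⟩ := exists_pos_eq (pos := fun i : Fin n => rk i) (fun i j hij => by
    have h1 := hlt i i.2 j j.2
    have h2 := hlt j j.2 i i.2
    dsimp only at hij
    ext
    omega) (fun i => (hrk i i.2).1) hp
  exact ⟨i, i.2, by rw [← (hrk i i.2).2, ← hi]⟩

/-- Radix sort: a stable pass by the minor key K followed by one by the major key K' sorts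
lexicographically. -/
theorem Sorted.exists_pos {X Y Z K K' : ℕ → ℕ} (hX : ∀ i < n, X i = i) (h : Sorted n X K Y)
    (h' : Sorted n Y K' Z) : ∃ pos : ℕ → ℕ, (∀ v < n, pos v < n ∧ Z (pos v) = v) ∧
      ∀ u < n, ∀ v < n, pos u < pos v → K' u < K' v ∨ K' u = K' v ∧ K u ≤ K v := by
  obtain ⟨rk, hrk, hlt⟩ := h
  obtain ⟨rk', hrk', hlt'⟩ := h'
  have hY : ∀ v < n, Y (rk v) = v := fun v hv => by rw [(hrk v hv).2, hX v hv]
  refine ⟨fun v => rk' (rk v), fun v hv => ?_, fun u hu v hv huv => ?_⟩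
  · have := hrk' _ (hrk v hv).1
    exact ⟨this.1, by rw [this.2, hY v hv]⟩
  · by_contra hcon
    have h1 : K' v < K' u ∨ K' v = K' u ∧ K v < K u := by omega
    refine lt_asymm huv (hlt' _ (hrk v hv).1 _ (hrk u hu).1 ?_)
    rw [hY u hu, hY v hv]
    refine h1.imp_right fun h1 => ⟨h1.1, hlt v hv u hu (Or.inl ?_)⟩
    rw [hX u hu, hX v hv]
    exact h1.2

end

/-! ### Transfer between graphs on `Fin n` and on the natural numbers, and extents in the computed
order. -/

section

variable {n : ℕ} {G : SimpleGraph (Fin n)}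

theorem Encodes.adjLists {s : State} (h : Encodes G s) :
    AdjLists n (G.map Fin.valEmbedding) (s.arr 0) (s.arr 1) := by
  refine ⟨?_, h.offset_mono, fun v hv => ?_⟩
  · rintro v w ⟨-, v, w, -, rfl, rfl⟩
    exact ⟨v.2, w.2⟩
  · convert h.neighbors ⟨v, hv⟩ using 1
    ext w
    simp only [SimpleGraph.map_adj, Set.mem_ofPred_eq, Set.mem_image]
    constructor
    · rintro ⟨v', w', hadj, rfl, rfl⟩
      exact ⟨w', hadj, rfl⟩
    · rintro ⟨w', hadj, rfl⟩
      exact ⟨_, w', hadj, rfl, rfl⟩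

theorem map_val_adj {u v : Fin n} : (G.map Fin.valEmbedding).Adj u v ↔ G.Adj u v :=
  SimpleGraph.map_adj_apply (f := Fin.valEmbedding)

/-- Numbers from n on are isolated vertices; they are placed beyond an upper bound M of all right
endpoints, where no edge can span them. -/
theorem exists_umbrella_map (R : ProperIntervalRep G) : ∃ ρ : ℕ → ℝ, Function.Injective ρ ∧
    Umbrella (G.map Fin.valEmbedding) ρ := by
  obtain ⟨M, hM⟩ := (Set.finite_range R.r).bddAbove
  have hM' : ∀ v, R.r v ≤ M := fun v => hM ⟨v, rfl⟩
  have hval : ∀ (u : Fin n), (if h : (u : ℕ) < n then R.r ⟨u, h⟩ else M + 1 + (u : ℕ)) = R.r u :=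
    fun u => by rw [dif_pos u.2]
  refine ⟨fun x => if h : x < n then R.r ⟨x, h⟩ else M + 1 + x, fun x y hxy => ?_, ?_⟩
  · dsimp only at hxy
    split_ifs at hxy with hx hy hy
    · exact congrArg Fin.val (R.r_injective hxy)
    · have := hM' ⟨x, hx⟩
      have : (0 : ℝ) ≤ y := y.cast_nonneg
      linarith
    · have := hM' ⟨y, hy⟩
      have : (0 : ℝ) ≤ x := x.cast_nonneg
      linarith
    · exact_mod_cast add_left_cancel hxy
  · rintro _ v _ huv hvw ⟨-, u, w, hadj, rfl, rfl⟩
    replace huv := lt_of_eq_of_lt (hval u).symm huv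
    replace hvw := lt_of_lt_of_eq hvw (hval w)
    dsimp only at huv hvw
    have hv : v < n := by
      by_contra hv
      rw [dif_neg hv] at hvw
      have := hM' w
      have : (0 : ℝ) ≤ v := v.cast_nonneg
      linarith
    rw [dif_pos hv] at huv hvw
    have := R.umbrella u ⟨v, hv⟩ w huv hvw hadj
    exact ⟨map_val_adj.2 this.1, map_val_adj.2 this.2⟩

theorem totalDegree_map (n : ℕ) (G : SimpleGraph (Fin n)) :
    totalDegree n (G.map Fin.valEmbedding) = 2 * G.edgeSet.ncard := by
  classical
  rw [totalDegree, Finset.sum_range, Set.ncard_eq_toFinset_card', ← SimpleGraph.edgeFinset,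
    ← SimpleGraph.sum_degrees_eq_twice_card_edges]
  refine Finset.sum_congr rfl fun v _ => ?_
  rw [← SimpleGraph.card_neighborFinset_eq_degree, ← Finset.card_map Fin.valEmbedding]
  congr 1
  ext w
  simp only [mem_nbrs_iff, Finset.mem_map, SimpleGraph.mem_neighborFinset]
  constructor
  · rintro ⟨hw, hadj⟩
    exact ⟨⟨w, hw⟩, map_val_adj.1 hadj, rfl⟩
  · rintro ⟨w, hadj, rfl⟩
    exact ⟨w.2, map_val_adj.2 hadj⟩

theorem mem_nbrs_map {v w : Fin n} : (w : ℕ) ∈ nbrs n (G.map Fin.valEmbedding) v ↔ G.Adj v w := by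
  rw [mem_nbrs_iff, map_val_adj]
  exact and_iff_right w.2

/-- A closed neighbourhood is convex in an umbrella order, so its first and last positions determine
it. Monotonicity of these positions is again the umbrella property, applied to an extremal
neighbour. -/
theorem Extents.of_isExtent {posArr lo hi : ℕ → ℕ} {pos : Fin n → ℕ}
    (hinj : Function.Injective pos) (hlt : ∀ v, pos v < n)
    (hU : Umbrella G fun v => (pos v : ℝ)) (hpos : ∀ v : Fin n, posArr v = pos v)
    (hext : ∀ v : Fin n, IsExtent posArr (nbrs n (G.map Fin.valEmbedding) v) (pos v) (lo (pos v))
      (hi (pos v))) : Extents G pos lo hi := by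
  have hnbr : ∀ v : Fin n, ∀ y ∈ nbrs n (G.map Fin.valEmbedding) v, ∃ x : Fin n, y = x ∧
      G.Adj v x := by
    intro v y hy
    exact ⟨⟨y, (mem_nbrs_iff.1 hy).1⟩, rfl, mem_nbrs_map.1 hy⟩
  have hlo : ∀ v : Fin n, ∃ x, (x = v ∨ G.Adj v x) ∧ pos x = lo (pos v) := by
    intro v
    rcases (hext v).left with h | ⟨y, hy, h⟩
    · exact ⟨v, Or.inl rfl, h.symm⟩
    · obtain ⟨x, rfl, hx⟩ := hnbr v y hy
      exact ⟨x, Or.inr hx, by rw [← hpos, h]⟩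
  have hhi : ∀ v : Fin n, ∃ x, (x = v ∨ G.Adj v x) ∧ pos x = hi (pos v) := by
    intro v
    rcases (hext v).right with h | ⟨y, hy, h⟩
    · exact ⟨v, Or.inl rfl, h.symm⟩
    · obtain ⟨x, rfl, hx⟩ := hnbr v y hy
      exact ⟨x, Or.inr hx, by rw [← hpos, h]⟩
  have hmem : ∀ v x, G.Adj v x → lo (pos v) ≤ pos x ∧ pos x ≤ hi (pos v) := fun v x hx => by
    have := (hext v).mem x (mem_nbrs_map.2 hx)
    rwa [hpos] at this
  have hU' : ∀ u v w, pos u < pos v → pos v < pos w → G.Adj u w → G.Adj u v ∧ G.Adj v w :=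
    fun u v w h h' => hU u v w (Nat.cast_lt.2 h) (Nat.cast_lt.2 h')
  have hsurj := fun p (hp : p < n) => exists_pos_eq hinj hlt hp
  refine ⟨hinj, hlt, hsurj, fun u v => ⟨?_, ?_⟩, ?_, ?_, ?_, ?_⟩
  · rintro (rfl | h)
    · exact (hext u).le
    · exact hmem v u h
  · rintro ⟨h1, h2⟩
    obtain ⟨x, hx, hx'⟩ := hlo v
    obtain ⟨z, hz, hz'⟩ := hhi v
    refine hU.closedNbhd_convex (fun a b h => hinj (Nat.cast_injective h)) hx hz ?_ ?_
    · rw [hx']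
      exact_mod_cast h1
    · rw [hz']
      exact_mod_cast h2
  · intro p hp
    obtain ⟨v, rfl⟩ := hsurj p hp
    exact (hext v).le.1
  · intro p hp
    obtain ⟨v, rfl⟩ := hsurj p hp
    obtain ⟨z, -, hz⟩ := hhi v
    exact ⟨(hext v).le.2, by rw [← hz]; exact hlt z⟩
  · intro p q hpq hq
    obtain ⟨u, rfl⟩ := hsurj p (by omega)
    obtain ⟨v, rfl⟩ := hsurj q hq
    have h1 := (hext u).le.1
    obtain ⟨x, hx, hx'⟩ := hlo v
    by_contra hcon
    rcases hx with rfl | hx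
    · omega
    · rcases hpq.eq_or_lt with he | hl
      · rw [he] at hcon
        omega
      · have := hmem u x (hU' x u v (by omega) hl hx.symm).1.symm
        omega
  · intro p q hpq hq
    obtain ⟨u, rfl⟩ := hsurj p (by omega)
    obtain ⟨v, rfl⟩ := hsurj q hq
    have h1 := (hext v).le.2
    obtain ⟨x, hx, hx'⟩ := hhi u
    by_contra hcon
    rcases hx with rfl | hx
    · omega
    · rcases hpq.eq_or_lt with he | hl
      · rw [he] at hcon
        omega
      · have := hmem v x (hU' u v x hl (by omega) hx).2
        omega

/-- Each extent is filled by the closed neighbourhood of its vertex, so its length is at most one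
plus the degree. -/
theorem Extents.extentSum_le {pos : Fin n → ℕ} {lo hi ord : ℕ → ℕ} (h : Extents G pos lo hi)
    (hord : ∀ v, ord (pos v) = v) :
    extentSum lo hi n ≤ n + ∑ p ∈ Finset.range n, (nbrs n (G.map Fin.valEmbedding) (ord p)).card := by
  classical
  have hterm : ∀ p ∈ Finset.range n,
      hi p + 1 - lo p ≤ 1 + (nbrs n (G.map Fin.valEmbedding) (ord p)).card := by
    intro p hp
    obtain ⟨v, rfl⟩ := h.exists_pos p (Finset.mem_range.1 hp)
    rw [hord, ← Nat.card_Icc, add_comm 1]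
    refine le_trans ?_ (Finset.card_insert_le (v : ℕ) _)
    refine Finset.card_le_card_of_injOn ord ?_ ?_
    · intro q hq
      rw [Finset.mem_coe, Finset.mem_Icc] at hq
      have := h.le_hi _ (h.pos_lt v)
      obtain ⟨u, rfl⟩ := h.exists_pos q (by omega)
      rw [hord, Finset.mem_coe, Finset.mem_insert, mem_nbrs_map]
      exact ((h.adj u v).2 hq).imp_left (congrArg Fin.val)
    · intro q hq q' hq' he
      rw [Finset.mem_coe, Finset.mem_Icc] at hq hq'
      have := h.le_hi _ (h.pos_lt v)
      obtain ⟨u, rfl⟩ := h.exists_pos q (by omega)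
      obtain ⟨u', rfl⟩ := h.exists_pos q' (by omega)
      rw [hord, hord] at he
      rw [Fin.ext he]
  refine (Finset.sum_le_sum hterm).trans ?_
  rw [Finset.sum_add_distrib]
  simp

end

end RAM

/-! ### The program -/

namespace RAM

theorem Frame.seq {p q : Prog} {s s' s'' : State} (h : Frame p s s') (h' : Frame q s' s'') :
    Frame (p ;; q) s s'' :=
  (h.mono (List.subset_append_left _ _) (List.subset_append_left _ _)).trans
    (h'.mono (List.subset_append_right _ _) (List.subset_append_right _ _))

/-- Write an umbrella ordering of the vertices to array `13`. The second search starts from the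
best vertices found by the first one, which are ends of their components. -/
def computeOrder : Prog :=
  initVertices ;; .op (.copy 1 0) ;; bfs 3 4 5 6 ;; .op (.copy 1 17) ;; bfs 6 7 8 9 ;;
    computeKeys ;; sort 3 10 11 12 ;; sort 11 8 13 14

/-- Compute a minimum liar's vertex-edge dominating set of a proper interval graph. -/
def lvedsProgram : Prog := computeOrder ;; computePositions ;; computeExtents ;; greedy

section

variable {n : ℕ} {G : SimpleGraph (Fin n)}

theorem wp_computeOrder (R : ProperIntervalRep G) {s : State} (hs : Encodes G s) :
    wp computeOrder (fun s' c' => (∃ pos : Fin n → ℕ, (∀ v, pos v < n ∧ s'.arr 13 (pos v) = v) ∧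
      Umbrella G fun v => (pos v : ℝ)) ∧
      c' ≤ 33 + 167 * n + 28 * totalDegree n (G.map Fin.valEmbedding)) s 0 := by
  have hG := hs.adjLists
  obtain ⟨ρ, hρ, hU⟩ := exists_umbrella_map R
  unfold computeOrder
  rw [wp_seq]
  refine wp_mono (wp_initVertices hs.reg_zero) ?_
  rintro s₁ c₁ F₁ ⟨h3, h20, hc₁⟩
  have off₁ : s₁.arr 0 = s.arr 0 := F₁.arr 0 (by decide)
  have adj₁ : s₁.arr 1 = s.arr 1 := F₁.arr 1 (by decide)
  have reg₁ : s₁.reg 0 = n := by rw [F₁.reg 0 (by decide), hs.reg_zero]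
  have zero₁ : s₁.reg 18 = 0 := by rw [F₁.reg 18 (by decide), hs.reg_ne_zero 18 (by decide)]
  have arr₁ : ∀ a i, 2 ≤ a → a ≠ 3 → s₁.arr a i = 0 := fun a i ha ha' => by
    rw [F₁.arr a (by simpa [initVertices, Prog.arrs, Op.arrs] using ha'), hs.arr_rest a i ha]
  rw [wp_seq, wp_op]
  -- Keeping the new state opaque and using only its frame turns later facts about untouched memory
  -- into decidable checks.
  obtain ⟨s₂, hs₂⟩ : ∃ s₂, s₂ = (Op.copy 1 0).apply s₁ := ⟨_, rfl⟩
  have F₂ : Frame (.op (.copy 1 0)) s₁ s₂ := hs₂ ▸ (Exec.op _ _).frame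
  have reg₂ : s₂.reg 1 = n := by rw [hs₂, ← reg₁]; simp [Op.apply]
  rw [← hs₂, wp_seq]
  refine wp_mono (wp_bfs hG ⟨by decide, by decide, by decide, by decide, by decide, by decide,
    by decide, by decide, by decide⟩ (by rw [F₂.arr 0 (by decide), off₁])
    (by rw [F₂.arr 1 (by decide), adj₁]) (by rw [F₂.reg 0 (by decide), reg₁])
    (by rw [F₂.reg 18 (by decide), zero₁])
    (fun x => by rw [F₂.arr 5 (by decide), arr₁ 5 x (by decide) (by decide)])
    reg₂ le_rfl rfl ?_ ?_) ?_
  · rintro x ⟨i, hi, rfl⟩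
    rw [F₂.arr 3 (by decide), h3 i hi]
    exact hi
  · exact fun v hv => ⟨v, ⟨v, hv, by rw [F₂.arr 3 (by decide), h3 v hv]⟩, .rfl⟩
  rintro s₃ c₃ F₃ ⟨hbfs, hc₃⟩
  have E₃ := F₂.seq F₃
  rw [wp_seq, wp_op]
  obtain ⟨s₄, hs₄⟩ : ∃ s₄, s₄ = (Op.copy 1 17).apply s₃ := ⟨_, rfl⟩
  have F₄ : Frame (.op (.copy 1 17)) s₃ s₄ := hs₄ ▸ (Exec.op _ _).frame
  have reg₄ : s₄.reg 1 = s₃.reg 17 := by rw [hs₄]; simp [Op.apply]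
  have arr₄ : s₄.arr 6 = s₃.arr 6 := F₄.arr 6 (by decide)
  have E₄ := E₃.seq F₄
  rw [← hs₄, wp_seq]
  refine wp_mono (wp_bfs hG ⟨by decide, by decide, by decide, by decide, by decide, by decide,
    by decide, by decide, by decide⟩ (by rw [E₄.arr 0 (by decide), off₁])
    (by rw [E₄.arr 1 (by decide), adj₁]) (by rw [E₄.reg 0 (by decide), reg₁])
    (by rw [E₄.reg 18 (by decide), zero₁])
    (fun x => by rw [E₄.arr 8 (by decide), arr₁ 8 x (by decide) (by decide)])
    reg₄ hbfs.nb_le rfl ?_ ?_) ?_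
  · rintro x ⟨i, hi, rfl⟩
    rw [arr₄]
    exact (hbfs.best i hi).1
  · intro v hv
    obtain ⟨k, hk, hkv⟩ := hbfs.cover v hv
    exact ⟨_, ⟨k, hk, by rw [arr₄]⟩, hkv⟩
  rintro s₅ c₅ F₅ ⟨hbfs', hc₅⟩
  rw [arr₄] at hbfs'
  have E₅ := E₄.seq F₅
  rw [wp_seq]
  refine wp_mono (wp_computeKeys hG (by rw [E₅.reg 0 (by decide), reg₁])
    (by rw [E₅.arr 0 (by decide), off₁]) (by rw [E₅.arr 1 (by decide), adj₁])) ?_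
  rintro s₆ c₆ F₆ ⟨hkey, hc₆⟩
  have E₆ := E₅.seq F₆
  have ver₆ : ∀ i < n, s₆.arr 3 i = i := fun i hi => by rw [E₆.arr 3 (by decide), h3 i hi]
  rw [wp_seq]
  refine wp_mono (wp_sort (M := 2 * n) (by rw [E₆.reg 0 (by decide), reg₁])
    (by rw [E₆.reg 20 (by decide), h20]) (by rw [E₆.reg 18 (by decide), zero₁])
    (fun x => by rw [E₆.arr 12 (by decide), arr₁ 12 x (by decide) (by decide)]) ?_
    (by decide) (by decide) (by decide) (by decide) (by decide)) ?_
  -- Keys are n plus a difference of degrees and a degree is below n, so 2n bounds them strictly.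
  · intro i hi
    rw [ver₆ i hi]
    have h1 := hkey i hi
    have h2 : laterDegree (G.map Fin.valEmbedding) (s₅.arr 8) i < n := by
      rw [hG.laterDegree_eq]
      exact (Finset.card_filter_le _ _).trans_lt (hG.card_nbrs_lt hi)
    omega
  rintro s₇ c₇ F₇ ⟨hsort, hc₇⟩
  have E₇ := E₆.seq F₇
  have lev₇ : s₇.arr 8 = s₅.arr 8 := by rw [F₇.arr 8 (by decide), F₆.arr 8 (by decide)]
  refine wp_mono (wp_sort (M := 2 * n) (by rw [E₇.reg 0 (by decide), reg₁])
    (by rw [E₇.reg 20 (by decide), h20]) (by rw [E₇.reg 18 (by decide), zero₁])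
    (fun x => by rw [E₇.arr 14 (by decide), arr₁ 14 x (by decide) (by decide)]) ?_
    (by decide) (by decide) (by decide) (by decide) (by decide)) ?_
  · intro i hi
    obtain ⟨j, hj, he⟩ := hsort.exists_eq hi
    rw [he, ver₆ j hj, lev₇]
    have := (hbfs'.level j hj).2
    omega
  rintro s₈ c₈ F₈ ⟨hsort', hc₈⟩
  refine ⟨?_, by omega⟩
  rw [lev₇] at hsort'
  obtain ⟨pos, hpos, hle⟩ := hsort.exists_pos ver₆ hsort'
  have hlayer : ∀ u < n, ∀ v < n, pos u < pos v →
      LayerLE (G.map Fin.valEmbedding) (s₅.arr 8) u v := by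
    -- Comparing the shifted keys is the same as the inequality of `LayerLE` between sums of later
    -- and earlier degrees.
    intro u hu v hv huv
    have h1 := hkey u hu
    have h2 := hkey v hv
    refine (hle u hu v hv huv).imp_right fun h => ⟨h.1, ?_⟩
    omega
  refine ⟨fun v => pos v, fun v => hpos v v.2, fun u v w huv hvw huw => ?_⟩
  have huv' : pos u < pos v := Nat.cast_lt.1 huv
  have hvw' : pos v < pos w := Nat.cast_lt.1 hvw
  have := hbfs.adj_of_layerLE hbfs' hG hρ hU v.2 (by rintro h; rw [h] at huv'; omega)
    (by rintro h; rw [h] at hvw'; omega) (hlayer u u.2 v v.2 huv') (hlayer v v.2 w w.2 hvw')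
    (map_val_adj.2 huw)
  exact ⟨map_val_adj.1 this.1, map_val_adj.1 this.2⟩

/-- The given representation only guarantees that the searches succeed; the one in the conclusion is
built from the computed positions. -/
theorem wp_lvedsProgram (R : ProperIntervalRep G) {s : State} (hs : Encodes G s) :
    wp lvedsProgram (fun s' t => t ≤ 500 * (n + G.edgeSet.ncard + 1) ∧
      IsMinLiarVEDominating G (output n s') ∧
      ∃ (R : ProperIntervalRep G) (σ : List (Fin n × Fin n)), IsEdgeIntervalOrdering R σ ∧
        output n s' = lvedsProperInterval R σ) s 0 := by
  have hG := hs.adjLists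
  unfold lvedsProgram
  rw [wp_seq]
  refine wp_mono (wp_computeOrder R hs) ?_
  rintro s₁ c₁ F₁ ⟨⟨pos, hpos, hU⟩, hc₁⟩
  have hlt : ∀ v, pos v < n := fun v => (hpos v).1
  have hord : ∀ v, s₁.arr 13 (pos v) = v := fun v => (hpos v).2
  have hinj : Function.Injective pos := fun u v h => by
    have h1 := hord u
    rw [h, hord v] at h1
    exact Fin.ext h1.symm
  have hord_lt : ∀ p < n, s₁.arr 13 p < n := fun p hp => by
    obtain ⟨v, rfl⟩ := exists_pos_eq hinj hlt hp
    rw [hord]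
    exact v.2
  have hord_inj : ∀ p < n, ∀ q < n, s₁.arr 13 p = s₁.arr 13 q → p = q := fun p hp q hq h => by
    obtain ⟨u, rfl⟩ := exists_pos_eq hinj hlt hp
    obtain ⟨v, rfl⟩ := exists_pos_eq hinj hlt hq
    rw [hord, hord] at h
    rw [Fin.ext h]
  rw [wp_seq]
  refine wp_mono (wp_computePositions (by rw [F₁.reg 0 (by decide), hs.reg_zero]) hord_inj) ?_
  rintro s₂ c₂ F₂ ⟨hpos₂, hc₂⟩
  have E₂ := F₁.seq F₂
  have ord₂ : s₂.arr 13 = s₁.arr 13 := F₂.arr 13 (by decide)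
  rw [wp_seq]
  refine wp_mono (wp_computeExtents hG (by rw [E₂.reg 0 (by decide), hs.reg_zero])
    (E₂.arr 0 (by decide)) (E₂.arr 1 (by decide)) (by rwa [ord₂])) ?_
  rintro s₃ c₃ F₃ ⟨hext, hc₃⟩
  have E₃ := E₂.seq F₃
  rw [ord₂] at hext hc₃
  have X : Extents G pos (s₃.arr 16) (s₃.arr 17) := by
    refine Extents.of_isExtent (posArr := s₂.arr 15) hinj hlt hU (fun v => ?_) fun v => ?_
    · rw [← hpos₂ (pos v) (hlt v), hord]
    · have := hext (pos v) (hlt v)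
      rwa [hord] at this
  obtain ⟨R', hR'⟩ := exists_properIntervalRep (G := G) (hi := fun v => s₃.arr 17 (pos v)) hlt hinj
    (fun v => (X.le_hi _ (hlt v)).1) (fun u v huv => by
      have := X.lo_le _ (hlt u)
      have h := X.adj v u
      rw [or_iff_right (by rintro rfl; omega)] at h
      rw [h]
      exact and_iff_right (by omega)) (fun u v huv => X.hi_mono _ _ huv.le (hlt v))
  obtain ⟨σ, hσ⟩ := exists_edgeIntervalOrdering R'
  have hO : IsOrder (s₁.arr 13) pos R'.r := ⟨hlt, hord, X.exists_pos, hR'⟩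
  refine wp_mono (wp_greedy hO (by rw [E₃.reg 0 (by decide), hs.reg_zero])
    (by rw [E₃.reg 18 (by decide), hs.reg_ne_zero 18 (by decide)])
    (by rw [F₃.arr 13 (by decide), ord₂]) rfl rfl
    (fun i => by rw [E₃.arr 2 (by decide), hs.arr_rest 2 i le_rfl]) X.lo_le X.le_hi
    fun p hp => X.hi_mono p (p + 1) (by omega) hp) ?_
  rintro s₄ c₄ - ⟨hcov, hdom, hc₄⟩
  have hfeas := X.isLiarVEDominating hcov
  have hdom' : ∀ L', IsLiarVEDominating G L' → Dominated R'.r (output n s₄) L' := fun L' hL' =>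
    hdom L' (X.covers hL')
  obtain ⟨hσ₁, hσ₂⟩ := lvedsProperInterval_spec R' hσ
  -- Both sets are feasible and dominated by every feasible set, so each dominates the other and
  -- they coincide.
  refine ⟨?_, isMin_of_dominated hfeas hdom', R', σ, hσ,
    (hdom' _ hσ₁).antisymm R'.r_injective (hσ₂ _ hfeas)⟩
  -- The contributions add up to at most 279n + 202m + 40.
  have h1 := X.extentSum_le hord
  have h2 := sum_nbrs_le (H := G.map Fin.valEmbedding) hord_lt hord_inj
  rw [totalDegree_map] at h2 hc₁
  omega

end

end RAM

theorem mainTheorem2 :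
    (∀ (V : Type*) [Fintype V] (G : SimpleGraph V) (R : ProperIntervalRep G) (σ : List (V × V)),
      IsEdgeIntervalOrdering R σ → IsMinLiarVEDominating G (lvedsProperInterval R σ)) ∧
    ∃ (P : RAM.Prog) (c : ℕ), ∀ (n : ℕ) (G : SimpleGraph (Fin n)), IsProperIntervalGraph G →
      ∀ s : RAM.State, RAM.Encodes G s →
        ∃ (t : ℕ) (s' : RAM.State), RAM.Exec P s t s' ∧
          t ≤ c * (n + G.edgeSet.ncard + 1) ∧
          IsMinLiarVEDominating G (RAM.output n s') ∧
          ∃ (R : ProperIntervalRep G) (σ : List (Fin n × Fin n)), IsEdgeIntervalOrdering R σ ∧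
            RAM.output n s' = lvedsProperInterval R σ := by
  refine ⟨fun V _ G R σ hσ => ?_, RAM.lvedsProgram, 500, fun n G hR s hs => ?_⟩
  · obtain ⟨h, hdom⟩ := lvedsProperInterval_spec R hσ
    exact isMin_of_dominated h hdom
  · obtain ⟨R⟩ := hR
    obtain ⟨t, s', he, h⟩ := RAM.wp_lvedsProgram R hs
    rw [Nat.zero_add] at h
    exact ⟨t, s', he, h⟩
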